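/- **Nets.** A *ground-structure* is a finite (possibly empty) labelled directed acyclic graph whose edges are either *logical* or *structural* and whose nodes (*links*) are: $ax$ (two logical conclusions), $cut$ (two logical premises), $\otimes$ and $⅋$ (two ordered logical premises, one logical conclusion), $1$ and $\bot$ (one logical conclusion), $\flat$ (one logical premise, one structural conclusion), $?$ ($k\ge 0$ structural premises, one logical conclusion), and $!$ (no premise, one logical *main* conclusion and $k\ge 0$ structural *auxiliary* conclusions). Every edge is the conclusion of exactly one link and the premise of at most one; the edges that are premises of no link are the conclusions of the ground-structure, and they are given with an order. A *$\flat$-structure* $\pi$ is (inductively) a ground-structure together with, for each of its $!$-links $o$, a $\flat$-structure $\pi^o$ (the *box* of $o$) with exactly one logical conclusion, and a bijection between the auxiliary conclusions of $o$ and the structural conclusions of $\pi^o$. A *switching* of a ground-structure is the undirected graph obtained by deleting one premise of each $⅋$-link and all but one premise of each $?$-link with at least one premise. A *$\flat$-net* is a $\flat$-structure such that all switchings of all its ground-structures (at all depths) are acyclic. An *untyped net* is a $\flat$-net without structural conclusions. **Cut elimination.** $\pi\rightsquigarrow\pi'$ means that $\pi'$ is obtained from $\pi$ by reducing one cut-link,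 of any depth, as follows. ($ax$) An $ax$-link with conclusions $a,c$ and a cut with premises $a,b$ are removed, and $b$ is identified with $c$. ($\otimes/⅋$) The cut and the two links are replaced by a cut between the left premises and a cut between the right premises. ($1/\bot$) The cut and the two links are removed. ($!/?$) A cut between the main conclusion of a $!$-link $o$ and the conclusion of a $?$-link $w$ with $k\ge 0$ premises: the cut, $o$ and $w$ are removed; each of the $k$ $\flat$-links associated with the premises of $w$ (possibly inside boxes) is replaced by a copy of $\pi^o$ placed where this $\flat$-link is, whose main conclusion is cut against the premise of the $\flat$-link; each auxiliary conclusion of $o$ is replaced by $k$ structural edges, one for each copy, all of them leading (through the borders of boxes if needed) to the $?$-link with which it was associated. A cut-link is a *clash* if none of its premises is the conclusion of an $ax$-link and its premises are not the conclusions of, respectively, a $\otimes$ and a $⅋$, a $1$ and a $\bot$, or a $!$ and a $?$. The net $\pi$ is *strongly normalizable* if every reduction sequence $\pi\rightsquigarrow\pi_1\rightsquigarrow\cdots$ is finite and no $\pi'$ with $\pi\rightsquigarrow^*\pi'$ contains a clash (at any depth). **Experiments.** Let $A$ be a set and $*\notin A$. Let $D$ be the least set such that $D=(\{+,-\}\times(A\cup\{*\}))\cup(\{+,-\}\times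 D\times D)\cup(\{+,-\}\times\mathcal M_{\rm fin}(D))$ (where $\mathcal M_{\rm fin}$ denotes finite multisets, and the union is disjoint), and let $x^\perp$ be obtained from $x\in D$ by exchanging $+$ and $-$ everywhere in $x$. By induction on depth, an *$\mathcal S^{\rm ex}$-experiment* $e$ of a $\flat$-net $\pi$ assigns to each edge $a$ of its ground-structure an element $e(a)\in D$, and to each $!$-link $o$ of its ground-structure a **non-empty** finite multiset $e(o)=[e_1,\dots,e_n]$ of $\mathcal S^{\rm ex}$-experiments of $\pi^o$, such that: - $e(a)=e(b)^\perp$ if $a,b$ are the conclusions of an $ax$-link or the premises of a cut-link; - $e(c)=(+,*)$ (resp. $(-,*)$) if $c$ is the conclusion of a $1$-link (resp. $\bot$-link); - $e(c)=(+,e(a),e(b))$ (resp. $(-,e(a),e(b))$) if $c$ is the conclusion of a $\otimes$-link (resp. $⅋$-link) with premises $a,b$; - $e(c)=(-,[e(a)])$ if $c$ is the conclusion of a $\flat$-link with premise $a$; - if $c$ is the conclusion of a $?$-link with premises $a_1,\dots,a_n$, $n\ge1$, then $e(a_i)=(-,\mu_i)$ and $e(c)=(-,\sum_i\mu_i)$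 for some $\mu_i\in\mathcal M_{\rm fin}(D)$; - if $c$ is the conclusion of a $?$-link without premises, then $e(c)=(-,\mu)$ for some (arbitrary) $\mu\in\mathcal M_{\rm fin}(D)$; - if $c$ is the main conclusion of a $!$-link $o$ with $e(o)=[e_1,\dots,e_n]$ and $c^o$ is the main conclusion of $\pi^o$, then $e(c)=(+,[e_1(c^o),\dots,e_n(c^o)])$; if $c$ is an auxiliary conclusion of $o$ and $c^o$ the associated conclusion of $\pi^o$, then $e_i(c^o)=(-,\mu_i)$ and $e(c)=(-,\sum_i\mu_i)$ for some $\mu_i\in\mathcal M_{\rm fin}(D)$. Let $\mathcal W(e)=\sum_c\mu_c+\sum_o\sum_{f\in e(o)}\mathcal W(f)$, where $c$ ranges over the conclusions of the $?$-links without premises of the ground-structure, with $e(c)=(-,\mu_c)$, and $o$ over its $!$-links. If $c_1,\dots,c_n$ are the conclusions of $\pi$, let $|e|=\langle e(c_1),\dots,e(c_n)\rangle$. The *$\mathcal S^{\rm ex}$-interpretation* of $\pi$ is the set of all the pairs $(|e|,\mathcal W(e))$, where $e$ is an $\mathcal S^{\rm ex}$-experiment of $\pi$. **Theorem.** An untyped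 net $\pi$ is strongly normalizable if and only if its $\mathcal S^{\rm ex}$-interpretation is non-empty. -/

import Mathlib

namespace LLNet

/-! ## Links and structures

Logical edges and structural edges are named by natural numbers, in two separate
name spaces.  Names are unique in the whole net, except that a structural edge keeps
its name when it crosses the border of a box (a structural conclusion of a box and the
associated auxiliary conclusion of the `!`-link are drawn as one single line). -/

/-- An edge: `log a` is the logical edge `a`, `str s` the structural edge `s`. -/
inductive Edge : Type
  | log (a : ℕ)
  | str (s : ℕ)
  deriving DecidableEq

def Edge.isLog : Edge → Bool
  | log _ => true
  | str _ => false

/-- The name of an edge. -/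
def Edge.name : Edge → ℕ
  | log a => a
  | str s => s

/-- The links (the `∘`-nodes are not represented; a `!`-link comes with its box).
* `ax a b`: conclusions `a`, `b`;  `cut a b`: premises `a`, `b`;
* `tensor a b c`, `par a b c`: left premise `a`, right premise `b`, conclusion `c`;
* `one c`, `bot c`: conclusion `c`;
* `flat a s`: the `♭`-link with logical premise `a` and structural conclusion `s`;
* `why ss c`: the `?`-link with structural premises `ss` and logical conclusion `c`;
* `bang box i c`: the `!`-link with logical (main) conclusion `c`, whose box has ground links
  `box` and main conclusion `i`.  Its auxiliary conclusions are the structural conclusions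
  of the box. -/
inductive Link : Type
  | ax (a b : ℕ)
  | cut (a b : ℕ)
  | tensor (a b c : ℕ)
  | par (a b c : ℕ)
  | one (c : ℕ)
  | bot (c : ℕ)
  | flat (a s : ℕ)
  | why (ss : List ℕ) (c : ℕ)
  | bang (box : List Link) (i c : ℕ)

/-- The premises of a link. -/
def Link.prem : Link → List Edge
  | .ax _ _ => []
  | .cut a b => [.log a, .log b]
  | .tensor a b _ => [.log a, .log b]
  | .par a b _ => [.log a, .log b]
  | .one _ => []
  | .bot _ => []
  | .flat a _ => [.log a]
  | .why ss _ => ss.map .str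
  | .bang _ _ _ => []

/-- The targets of a ground-structure: the edges that are premises of one of its links. -/
def targets (L : List Link) : List Edge := L.flatMap Link.prem

mutual
/-- The conclusions of a link.  Those of a `!`-link are its main conclusion and
one auxiliary conclusion for each structural conclusion of the box. -/
def Link.concl : Link → List Edge
  | .ax a b => [.log a, .log b]
  | .cut _ _ => []
  | .tensor _ _ c => [.log c]
  | .par _ _ c => [.log c]
  | .one c => [.log c]
  | .bot c => [.log c]
  | .flat _ s => [.str s]
  | .why _ c => [.log c]
  | .bang box _ c =>
      .log c :: (sources box).filter (fun e => !e.isLog && decide (e ∉ targets box))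
/-- The edges of a ground-structure: the conclusions of its links. -/
def sources : List Link → List Edge
  | [] => []
  | l :: L => l.concl ++ sources L
end

/-- The conclusions of a ground-structure: its edges that are not a premise of any link
(that is, those that are premises of `∘`-nodes). -/
def conclusions (L : List Link) : List Edge :=
  (sources L).filter (fun e => decide (e ∉ targets L))

mutual
/-- All the edge names of a link: its logical conclusions, its conclusion if it is a `♭`-link,
and the names of the edges of its box if it is a `!`-link. -/
def Link.names : Link → List Edge
  | .ax a b => [.log a, .log b]
  | .cut _ _ => []
  | .tensor _ _ c => [.log c]
  | .par _ _ c => [.log c]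
  | .one c => [.log c]
  | .bot c => [.log c]
  | .flat _ s => [.str s]
  | .why _ c => [.log c]
  | .bang box _ c => .log c :: names box
/-- All the edge names at all depths (a structural line is listed once, at its `♭`-link). -/
def names : List Link → List Edge
  | [] => []
  | l :: L => l.names ++ names L
end

/-- `GStructIn G L`: `G` is (the list of links of) a ground-structure of some depth of the
structure with ground links `L`. -/
inductive GStructIn (G : List Link) : List Link → Prop
  | ground : GStructIn G G
  | box {L B : List Link} {i c : ℕ} : Link.bang B i c ∈ L → GStructIn G B → GStructIn G L

/-! ## Well-formedness and correctness -/

/-- `e` is a premise and `d` a conclusion of the same link of `L`. -/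
def DirectlyAbove (L : List Link) (e d : Edge) : Prop :=
  ∃ l ∈ L, e ∈ l.prem ∧ d ∈ l.concl

/-- The directed graph `L` has no oriented cycle. -/
def DirectedAcyclic (L : List Link) : Prop :=
  ∀ e, ¬ Relation.TransGen (DirectlyAbove L) e e

/-- The links some of whose premises are deleted by switchings. -/
def Link.IsSwitched : Link → Prop
  | .par _ _ _ => True
  | .why _ _ => True
  | _ => False

/-- `S` is the set of edges that are kept by some switching of `L`: exactly one of the two
premises of each `⅋`-link, exactly one premise of each `?`-link with at least one premise, and
all the edges that are not premises of such links. -/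
structure IsSwitching (L : List Link) (S : Set Edge) : Prop where
  par : ∀ a b c, Link.par a b c ∈ L → (Edge.log a ∈ S ↔ Edge.log b ∉ S)
  why : ∀ ss c, Link.why ss c ∈ L → ss ≠ [] → ∃! s, s ∈ ss ∧ Edge.str s ∈ S
  other : ∀ e ∈ sources L, (∀ l ∈ L, l.IsSwitched → e ∉ l.prem) → e ∈ S

/-- The undirected graph of the links of `L` and of the edges in `S`, in which every edge is
subdivided by a vertex of its own, so that parallel edges between two links do form a cycle.
(The `∘`-nodes, being leaves, are irrelevant for cycles.) -/
def switchingGraph (L : List Link) (S : Set Edge) : SimpleGraph (Fin L.length ⊕ Edge) :=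
  SimpleGraph.fromRel fun x y =>
    ∃ (k : Fin L.length) (e : Edge), x = .inl k ∧ y = .inr e ∧ e ∈ S ∧
      (e ∈ (L.get k).prem ∨ e ∈ (L.get k).concl)

/-- Conditions on a single ground-structure: every edge is the premise of at most one link and
has a source, the graph is directed acyclic, and every box has exactly one logical conclusion,
namely its main conclusion.  (That an edge has only one source is part of the uniqueness
of names, see `Struct.IsStructure`.) -/
structure IsGStruct (L : List Link) : Prop where
  nodup : (targets L).Nodup
  subset : targets L ⊆ sources L
  acyclic : DirectedAcyclic L
  boxes : ∀ B i c, Link.bang B i c ∈ L →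
    (conclusions B).filter (fun e => e.isLog) = [Edge.log i]

/-- Data of a structure without structural conclusions: its ground links and the ordered list
of its (logical) conclusions. -/
structure Struct : Type where
  links : List Link
  concl : List ℕ

namespace Struct

/-- The untyped structures all of whose conclusions are logical. -/
structure IsStructure (π : Struct) : Prop where
  names_nodup : (names π.links).Nodup
  gstruct : ∀ G, GStructIn G π.links → IsGStruct G
  concl_perm : (π.concl.map Edge.log).Perm (conclusions π.links)

/-- Untyped nets: every switching of every ground-structure is acyclic, and there are no
structural conclusions. -/
structure IsNet (π : Struct) : Prop extends IsStructure π where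
  switching : ∀ G, GStructIn G π.links → ∀ S, IsSwitching G S → (switchingGraph G S).IsAcyclic

end Struct

/-! ## Clashes -/

def Link.IsAx : Link → Prop
  | .ax _ _ => True
  | _ => False

/-- The pairs of links whose logical conclusions are dual: `⊗/⅋`, `1/⊥`, `!/?`. -/
def Link.Dual : Link → Link → Prop
  | .tensor _ _ _, .par _ _ _ => True
  | .par _ _ _, .tensor _ _ _ => True
  | .one _, .bot _ => True
  | .bot _, .one _ => True
  | .bang _ _ _, .why _ _ => True
  | .why _ _, .bang _ _ _ => True
  | _, _ => False

/-- Some cut-link of some depth is a clash: its premises are not dual, and none of them is a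
conclusion of an `ax`-link. -/
def HasClash (L : List Link) : Prop :=
  ∃ G, GStructIn G L ∧ ∃ a b, Link.cut a b ∈ G ∧
    ∃ l ∈ G, ∃ m ∈ G, Edge.log a ∈ l.concl ∧ Edge.log b ∈ m.concl ∧
      ¬ l.IsAx ∧ ¬ m.IsAx ∧ ¬ l.Dual m

/-! ## Cut elimination -/

mutual
/-- Renaming of the logical edges by `f` and of the structural edges by `g`, at all depths. -/
def Link.rename (f g : ℕ → ℕ) : Link → Link
  | .ax a b => .ax (f a) (f b)
  | .cut a b => .cut (f a) (f b)
  | .tensor a b c => .tensor (f a) (f b) (f c)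
  | .par a b c => .par (f a) (f b) (f c)
  | .one c => .one (f c)
  | .bot c => .bot (f c)
  | .flat a s => .flat (f a) (g s)
  | .why ss c => .why (ss.map g) (f c)
  | .bang box i c => .bang (rename f g box) (f i) (f c)
def rename (f g : ℕ → ℕ) : List Link → List Link
  | [] => []
  | l :: L => l.rename f g :: rename f g L
end

mutual
/-- Replace every `♭`-link `flat a s`, at every depth, by the links `r a s`. -/
def Link.graft (r : ℕ → ℕ → List Link) : Link → List Link
  | .flat a s => r a s
  | .bang box i c => [.bang (graft r box) i c]
  | .ax a b => [.ax a b]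
  | .cut a b => [.cut a b]
  | .tensor a b c => [.tensor a b c]
  | .par a b c => [.par a b c]
  | .one c => [.one c]
  | .bot c => [.bot c]
  | .why ss c => [.why ss c]
def graft (r : ℕ → ℕ → List Link) : List Link → List Link
  | [] => []
  | l :: L => l.graft r ++ graft r L
end

/-- Replace every premise `s` of a `?`-link by the premises `θ s`. -/
def Link.expand (θ : ℕ → List ℕ) : Link → Link
  | .why ss c => .why (ss.flatMap θ) c
  | l => l

/-- What a `♭`-link `flat a s` becomes when a box with links `B` and main conclusion `i` is cut
against a `?`-link with premises `ss`: if `s` is the `j`-th premise (`j ≥ 1`), then the premise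
`a` is cut against the main conclusion of the `j`-th copy of the box, which is placed there.
The names `x` of the `j`-th copy are `x + j * N`. -/
def boxCopy (N : ℕ) (B : List Link) (i : ℕ) (ss : List ℕ) (a s : ℕ) : List Link :=
  if s ∈ ss then
    .cut a (i + (ss.idxOf s + 1) * N) ::
      rename (fun x => x + (ss.idxOf s + 1) * N) (fun x => x + (ss.idxOf s + 1) * N) B
  else [.flat a s]

/-- Each structural conclusion of the box `B` is replaced by its `k` copies. -/
def auxCopies (N : ℕ) (B : List Link) (k : ℕ) (s : ℕ) : List ℕ :=
  if Edge.str s ∈ conclusions B then (List.range k).map (fun j => s + (j + 1) * N) else [s]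

/-- `CutStep N L L' θ`: the elimination of one cut (of any depth) of `L` gives `L'`, and
each structural conclusion `s` of `L` becomes the structural conclusions `θ s` of `L'`.
The number `N` is larger than all the names in use, and serves to name the copies of a box. -/
inductive CutStep (N : ℕ) : List Link → List Link → (ℕ → List ℕ) → Prop
  /-- `a`, `b` are erased: the link with conclusion `b` now has conclusion `c`. -/
  | ax {L Γ : List Link} {x t : Link} {a b c : ℕ}
      (hx : x = .ax a c ∨ x = .ax c a) (ht : t = .cut a b ∨ t = .cut b a)
      (hL : L.Perm (x :: t :: Γ)) :
      CutStep N L (rename (fun e => if e = b then c else e) id Γ) (fun s => [s])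
  | tensorPar {L Γ : List Link} {t : Link} {a₁ a₂ a b₁ b₂ b : ℕ}
      (ht : t = .cut a b ∨ t = .cut b a)
      (hL : L.Perm (.tensor a₁ a₂ a :: .par b₁ b₂ b :: t :: Γ)) :
      CutStep N L (.cut a₁ b₁ :: .cut a₂ b₂ :: Γ) (fun s => [s])
  | oneBot {L Γ : List Link} {t : Link} {a b : ℕ}
      (ht : t = .cut a b ∨ t = .cut b a)
      (hL : L.Perm (.one a :: .bot b :: t :: Γ)) :
      CutStep N L Γ (fun s => [s])
  /-- The box is dispatched to the `♭`-links associated with the premises of the `?`-link,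
  whatever their depth, and the premises of `?`-links associated with the auxiliary conclusions
  of the `!`-link are duplicated accordingly. -/
  | bangWhy {L Γ B : List Link} {t : Link} {i a b : ℕ} {ss : List ℕ}
      (ht : t = .cut a b ∨ t = .cut b a)
      (hL : L.Perm (.bang B i a :: .why ss b :: t :: Γ)) :
      CutStep N L
        (graft (boxCopy N B i ss) (Γ.map (Link.expand (auxCopies N B ss.length))))
        (auxCopies N B ss.length)
  /-- Elimination of a cut inside a box. -/
  | box {L Γ B B' : List Link} {i c : ℕ} {θ : ℕ → List ℕ}
      (hL : L.Perm (.bang B i c :: Γ)) (hB : CutStep N B B' θ) :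
      CutStep N L (.bang B' i c :: Γ.map (Link.expand θ)) θ

namespace Struct

/-- A strict upper bound of all the names in use. -/
def fresh (π : Struct) : ℕ :=
  (names π.links).foldr (fun e n => max (e.name + 1) n) 0

/-- `π'` is a one step reduct of `π`. -/
def Reduces (π π' : Struct) : Prop :=
  (∃ θ, CutStep π.fresh π.links π'.links θ) ∧ π'.concl = π.concl

/-- Every reduction sequence from `π` is finite, and no reduct of `π` (`π` included)
contains a clash. -/
def StronglyNormalizable (π : Struct) : Prop :=
  (¬ ∃ R : ℕ → Struct, R 0 = π ∧ ∀ n, (R n).Reduces (R (n + 1))) ∧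
  ∀ π', Relation.ReflTransGen Reduces π π' → ¬ HasClash π'.links

end Struct

/-! ## The set `D` of points -/

universe u

/-- Points with bags presented as lists; the sign `+` is `true`, the sign `-` is `false`,
and the element `∗` added to `A` is `none`. -/
inductive PreD (A : Type u) : Type u
  | atom (p : Bool) (a : Option A)
  | pair (p : Bool) (x y : PreD A)
  | bag (p : Bool) (xs : List (PreD A))

namespace PreD

variable {A : Type u}

mutual
/-- Equality of points up to the order of the elements of bags, at all depths. -/
inductive Equiv : PreD A → PreD A → Prop
  | atom (p : Bool) (a : Option A) : Equiv (.atom p a) (.atom p a)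
  | pair (p : Bool) {x y x₁ y₁ : PreD A} :
      Equiv x x₁ → Equiv y y₁ → Equiv (.pair p x y) (.pair p x₁ y₁)
  | bag (p : Bool) {xs ys : List (PreD A)} :
      EquivList xs ys → Equiv (.bag p xs) (.bag p ys)
inductive EquivList : List (PreD A) → List (PreD A) → Prop
  | nil : EquivList [] []
  | cons {x y : PreD A} {xs ys : List (PreD A)} :
      Equiv x y → EquivList xs ys → EquivList (x :: xs) (y :: ys)
  | swap {x y : PreD A} {xs ys : List (PreD A)} :
      EquivList xs ys → EquivList (x :: y :: xs) (y :: x :: ys)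
  | trans {xs ys zs : List (PreD A)} : EquivList xs ys → EquivList ys zs → EquivList xs zs
end

mutual
theorem Equiv.refl : ∀ x : PreD A, Equiv x x
  | .atom p a => .atom p a
  | .pair p x y => .pair p (Equiv.refl x) (Equiv.refl y)
  | .bag p xs => .bag p (EquivList.refl xs)
theorem EquivList.refl : ∀ xs : List (PreD A), EquivList xs xs
  | [] => .nil
  | x :: xs => .cons (Equiv.refl x) (EquivList.refl xs)
end

mutual
theorem Equiv.symm : ∀ {x y : PreD A}, Equiv x y → Equiv y x
  | _, _, .atom p a => .atom p a
  | _, _, .pair p h k => .pair p (Equiv.symm h) (Equiv.symm k)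
  | _, _, .bag p h => .bag p (EquivList.symm h)
theorem EquivList.symm : ∀ {xs ys : List (PreD A)}, EquivList xs ys → EquivList ys xs
  | _, _, .nil => .nil
  | _, _, .cons h k => .cons (Equiv.symm h) (EquivList.symm k)
  | _, _, .swap h => .swap (EquivList.symm h)
  | _, _, .trans h k => .trans (EquivList.symm k) (EquivList.symm h)
end

theorem Equiv.trans : ∀ {x y z : PreD A}, Equiv x y → Equiv y z → Equiv x z
  | _, _, _, .atom p a, .atom _ _ => .atom p a
  | _, _, _, .pair p h k, .pair _ h₁ k₁ => .pair p (Equiv.trans h h₁) (Equiv.trans k k₁)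
  | _, _, _, .bag p h, .bag _ h₁ => .bag p (EquivList.trans h h₁)

instance setoid (A : Type u) : Setoid (PreD A) where
  r := Equiv
  iseqv := ⟨Equiv.refl, Equiv.symm, Equiv.trans⟩

mutual
/-- Flip all the signs. -/
def neg : PreD A → PreD A
  | .atom p a => .atom (!p) a
  | .pair p x y => .pair (!p) (neg x) (neg y)
  | .bag p xs => .bag (!p) (negList xs)
def negList : List (PreD A) → List (PreD A)
  | [] => []
  | x :: xs => neg x :: negList xs
end

mutual
theorem Equiv.neg : ∀ {x y : PreD A}, Equiv x y → Equiv (PreD.neg x) (PreD.neg y)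
  | _, _, .atom p a => Equiv.refl _
  | _, _, .pair p h k => by
      simp only [PreD.neg]; exact .pair _ (Equiv.neg h) (Equiv.neg k)
  | _, _, .bag p h => by
      simp only [PreD.neg]; exact .bag _ (EquivList.neg h)
theorem EquivList.neg :
    ∀ {xs ys : List (PreD A)}, EquivList xs ys → EquivList (negList xs) (negList ys)
  | _, _, .nil => .nil
  | _, _, .cons h k => by
      simp only [PreD.negList]; exact .cons (Equiv.neg h) (EquivList.neg k)
  | _, _, .swap h => by
      simp only [PreD.negList]; exact .swap (EquivList.neg h)
  | _, _, .trans h k => .trans (EquivList.neg h) (EquivList.neg k)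
end

end PreD

/-- The set `D`, the least solution of
`D = ({+,-} × (A ∪ {∗})) ∪ ({+,-} × D × D) ∪ ({+,-} × finite multisets of D)`. -/
def D (A : Type u) : Type u := Quotient (PreD.setoid A)

namespace D

variable {A : Type u}

/-- The point presented by an element of `PreD`. -/
def mk (x : PreD A) : D A := Quotient.mk (PreD.setoid A) x

/-- A presentation of a point. -/
noncomputable def out (x : D A) : PreD A := Quotient.out (s := PreD.setoid A) x

theorem mk_out (x : D A) : mk x.out = x := Quotient.out_eq x

/-- The point `(p, a)`, with `a ∈ A ∪ {∗}`. -/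
def atom (p : Bool) (a : Option A) : D A := mk (.atom p a)

/-- The point `(p, x, y)`. -/
def pair (p : Bool) (x y : D A) : D A :=
  Quotient.map₂ (PreD.pair p) (fun _ _ h _ _ k => PreD.Equiv.pair p h k) x y

/-- The point `(p, m)`, for a finite multiset `m` of points. -/
noncomputable def bag (p : Bool) (m : Multiset (D A)) : D A :=
  mk (.bag p (m.toList.map out))

/-- The dual `x^⊥`: all the signs are flipped. -/
def neg (x : D A) : D A := Quotient.map PreD.neg (fun _ _ h => PreD.Equiv.neg h) x

theorem coe_map_mk_eq {xs ys : List (PreD A)} (h : PreD.EquivList xs ys) :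
    ((xs.map mk : List (D A)) : Multiset (D A)) =
      (ys.map mk : List (D A)) := by
  refine PreD.EquivList.rec (motive_1 := fun _ _ _ => True)
    (motive_2 := fun xs ys _ =>
      ((xs.map mk : List (D A)) : Multiset (D A)) =
        (ys.map mk : List (D A)))
    ?_ ?_ ?_ ?_ ?_ ?_ ?_ h
  · intros; trivial
  · intros; trivial
  · intros; trivial
  · rfl
  · intro x y xs ys hxy _ _ ih
    have hq : mk x = mk y := Quotient.sound hxy
    simp only [List.map_cons, ← Multiset.cons_coe]
    rw [hq]
    exact congrArg _ ih
  · intro x y xs ys _ ih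
    simp only [List.map_cons, ← Multiset.cons_coe]
    rw [Multiset.cons_swap]
    exact congrArg _ (congrArg _ ih)
  · intro _ _ _ _ _ h k
    exact h.trans k

/-- The multiset `m` of a point `(p, m)` (and the empty one for the other points). -/
def elems (x : D A) : Multiset (D A) :=
  Quotient.lift
    (fun y : PreD A => match y with
      | .bag _ xs => ((xs.map mk : List (D A)) : Multiset (D A))
      | _ => 0)
    (by
      intro a b h
      cases h with
      | atom p a => rfl
      | pair p h k => rfl
      | bag p h => exact coe_map_mk_eq h)
    x

theorem elems_bag (p : Bool) (m : Multiset (D A)) : (bag p m).elems = m := by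
  show (((m.toList.map out).map mk : List (D A)) : Multiset (D A)) = m
  have h : (mk ∘ out : D A → D A) = id := funext mk_out
  rw [List.map_map, h, List.map_id]
  exact Multiset.coe_toList m

end D

/-! ## Experiments -/

/-- The data of an experiment: the points `lab a` of the logical edges `a` and `slab s` of the
structural edges `s` of the ground-structure, and, for the `!`-link with main
conclusion `c`, the multiset `copies c` (presented as a list) of experiments of its box.
The values at names that are not used in the ground-structure play no role. -/
inductive Experiment (A : Type u) : Type u
  | mk (lab slab : ℕ → D A) (copies : ℕ → List (Experiment A))

namespace Experiment

variable {A : Type u}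

def lab : Experiment A → ℕ → D A
  | mk f _ _ => f

def slab : Experiment A → ℕ → D A
  | mk _ g _ => g

def copies : Experiment A → ℕ → List (Experiment A)
  | mk _ _ k => k

/-- `IsSex L e`: `e` is an `𝓢ᵉˣ`-experiment of the structure with ground links `L`. -/
inductive IsSex : List Link → Experiment A → Prop
  | mk {L : List Link} {e : Experiment A}
      (ax : ∀ a b, Link.ax a b ∈ L → e.lab a = (e.lab b).neg)
      (cut : ∀ a b, Link.cut a b ∈ L → e.lab a = (e.lab b).neg)
      (one : ∀ c, Link.one c ∈ L → e.lab c = D.atom true none)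
      (bot : ∀ c, Link.bot c ∈ L → e.lab c = D.atom false none)
      (tensor : ∀ a b c, Link.tensor a b c ∈ L → e.lab c = D.pair true (e.lab a) (e.lab b))
      (par : ∀ a b c, Link.par a b c ∈ L → e.lab c = D.pair false (e.lab a) (e.lab b))
      (flat : ∀ a s, Link.flat a s ∈ L → e.slab s = D.bag false {e.lab a})
      (why : ∀ ss c, Link.why ss c ∈ L → ss ≠ [] →
        ∃ μ : ℕ → Multiset (D A), (∀ s ∈ ss, e.slab s = D.bag false (μ s)) ∧
          e.lab c = D.bag false (ss.map μ).sum)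
      (weakening : ∀ c, Link.why [] c ∈ L → ∃ μ : Multiset (D A), e.lab c = D.bag false μ)
      (nonempty : ∀ B i c, Link.bang B i c ∈ L → e.copies c ≠ [])
      (boxes : ∀ B i c, Link.bang B i c ∈ L → ∀ f ∈ e.copies c, IsSex B f)
      (main : ∀ B i c, Link.bang B i c ∈ L →
        e.lab c = D.bag true (((e.copies c).map (fun f => f.lab i) : List (D A)) :
          Multiset (D A)))
      (aux : ∀ B i c, Link.bang B i c ∈ L → ∀ s, Edge.str s ∈ conclusions B →
        ∃ μ : Experiment A → Multiset (D A),
          (∀ f ∈ e.copies c, f.slab s = D.bag false (μ f)) ∧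
          e.slab s = D.bag false ((e.copies c).map μ).sum) :
      IsSex L e

end Experiment

mutual
/-- The contribution of a link to `𝓦(e)`. -/
def Link.weakenings {A : Type u} : Link → Experiment A → Multiset (D A)
  | .why [] c, e => (e.lab c).elems
  | .bang box _ c, e => ((e.copies c).map (fun f => weakenings box f)).sum
  | _, _ => 0
/-- The multiset `𝓦(e)`: the sum of the multisets `μ` with `e(c) = (-, μ)` over the conclusions
`c` of the `?`-links without premises of the ground-structure, plus the sum of the `𝓦(f)` over
all the experiments `f` that `e` associates with the `!`-links. -/
def weakenings {A : Type u} : List Link → Experiment A → Multiset (D A)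
  | [], _ => 0
  | l :: L, e => l.weakenings e + weakenings L e
end

/-- The `𝓢ᵉˣ`-interpretation: the set of the pairs `(|e|, 𝓦(e))`, where `e` is an
`𝓢ᵉˣ`-experiment and `|e|` is the sequence of its values on the conclusions. -/
def Struct.sexInterpretation (A : Type u) (π : Struct) : Set (List (D A) × Multiset (D A)) :=
  {r | ∃ e : Experiment A, Experiment.IsSex π.links e ∧
    r = (π.concl.map e.lab, weakenings π.links e)}

end LLNet

-- The size of an experiment counts one for each link, the links of a box being counted once for
-- every experiment chosen for this box. If `π` has an experiment, a reduction step yields an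
-- experiment of the reduct of smaller size. In a step `!/?` the multiset of the `?`-link is matched
-- with the main conclusions of the experiments of the box; these are dealt out to the `♭`-links,
-- one for each use, so nothing is duplicated. A step inside a box makes each of its experiments
-- smaller, and there is at least one because the multisets are non-empty. Hence all reduction
-- sequences are finite. Non-emptiness also gives every ground-structure of every depth an
-- experiment, and a clash admits none, since the two sides of a cut would have labels that are not
-- dual.
--
-- When a box is erased, lines that led to a `?`-link disappear while the label of this link stays.
-- The descent therefore uses relaxed experiments (`Ex false`), in which a `?`-link with premises
-- may hold additional points. The lemmas are `Ex.reduce` and `Ex.not_hasClash`.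
--
-- Conversely, strict experiments (`Ex true`) pull back along every step that erases no box
-- (`NonErasing.expandable`). An erasing step cannot be pulled back in this way, because nothing
-- provides an experiment of the erased box. So one argues by induction on reducibility, using
-- non-erasing steps only. When none is left and there is no clash, every cut opposes a box to a
-- `?`-link without premises, whose label is arbitrary and can be taken dual to that of the box. The
-- boxes are of the same kind and have experiments by induction on depth; the links are then
-- labelled in topological order (`Normal.exists_ex`). Non-emptiness of the interpretation only asks
-- for some experiment, so `𝓦(e)` plays no part.
--
-- Both directions need switching acyclicity in all reducts. It is used in an algebraic form: a flow
-- is a function from edges to `ZMod 2` with even total at each link and at most one non-zero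
-- premise at each `⅋`- and `?`-link; `Correct` says that a flow vanishing on the out-edges vanishes
-- on all premises. Flows of a reduct are pulled back to flows of the original net, which shows that
-- well-formedness `WF` is preserved (`wf_step`). Acyclic switchings give `WF` to begin with
-- (`Struct.IsNet.wf`): the support of a flow lies in a switching, and an acyclic graph carries no
-- even set of edges. `WF` also yields the topological order.
--
-- Edges of all depths are collected in the multisets `src` and `tgt`, so that edges internal to a
-- box cancel modulo two and a box acts as a single vertex.

namespace LLNet

universe u

/-! ## The algebra of points -/

namespace PreD

variable {A : Type u}

mutual
theorem neg_neg : ∀ x : PreD A, neg (neg x) = x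
  | .atom p a => by simp [neg]
  | .pair p x y => by simp [neg, neg_neg x, neg_neg y]
  | .bag p xs => by simp [neg, negList_negList xs]
theorem negList_negList : ∀ xs : List (PreD A), negList (negList xs) = xs
  | [] => rfl
  | x :: xs => by simp [negList, neg_neg x, negList_negList xs]
end

theorem negList_eq_map (xs : List (PreD A)) : negList xs = xs.map neg := by
  induction xs with
  | nil => rfl
  | cons x xs ih => simp [negList, ih]

theorem EquivList.of_perm {xs ys : List (PreD A)} (h : xs.Perm ys) : EquivList xs ys := by
  induction h with
  | nil => exact .nil
  | cons x _ ih => exact .cons (Equiv.refl x) ih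
  | swap x y l => exact .swap (EquivList.refl l)
  | trans _ _ h k => exact .trans h k

end PreD

namespace D

variable {A : Type u}

theorem neg_neg (x : D A) : x.neg.neg = x := by
  induction x using Quotient.ind
  exact congrArg mk (PreD.neg_neg _)

theorem neg_involutive : Function.Involutive (neg : D A → D A) := neg_neg

theorem neg_inj {x y : D A} : x.neg = y.neg ↔ x = y := neg_involutive.injective.eq_iff

theorem eq_neg_comm {x y : D A} : x = y.neg ↔ y = x.neg :=
  ⟨fun h => by rw [h, neg_neg], fun h => by rw [h, neg_neg]⟩

theorem neg_pair (p : Bool) (x y : D A) : (pair p x y).neg = pair (!p) x.neg y.neg := by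
  induction x using Quotient.ind
  induction y using Quotient.ind
  rfl

theorem pair_inj {p q : Bool} {x y x' y' : D A} (h : pair p x y = pair q x' y') :
    x = x' ∧ y = y' := by
  induction x using Quotient.ind
  induction y using Quotient.ind
  induction x' using Quotient.ind
  induction y' using Quotient.ind
  have h' := Quotient.exact h
  cases h' with
  | pair _ h k => exact ⟨Quotient.sound h, Quotient.sound k⟩

/-- `bag` is defined through chosen representatives and a chosen order; this allows any presentation
of the elements to be used instead. -/
theorem mk_bag (p : Bool) (xs : List (PreD A)) :
    mk (.bag p xs) = bag p ((xs.map mk : List (D A)) : Multiset (D A)) := by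
  refine Quotient.sound (PreD.Equiv.bag p ?_)
  have h₁ : ∀ ys : List (PreD A), PreD.EquivList ys ((ys.map mk).map out) := by
    intro ys
    induction ys with
    | nil => exact .nil
    | cons y ys ih => exact .cons (Quotient.exact (mk_out (mk y)).symm) ih
  refine (h₁ xs).trans (PreD.EquivList.of_perm (List.Perm.map _ ?_))
  exact Multiset.coe_eq_coe.1 (Multiset.coe_toList _).symm

theorem neg_bag (p : Bool) (m : Multiset (D A)) : (bag p m).neg = bag (!p) (m.map neg) := by
  have h : (bag p m).neg = mk (.bag (!p) (PreD.negList (m.toList.map out))) := rfl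
  rw [h, mk_bag, PreD.negList_eq_map]
  congr 1
  have h₂ : (fun x : D A => mk (PreD.neg (out x))) = neg := by
    funext x
    show neg (mk (out x)) = neg x
    rw [mk_out]
  rw [List.map_map, List.map_map]
  show ((m.toList.map (fun x : D A => mk (PreD.neg (out x))) : List (D A)) : Multiset (D A)) = _
  rw [h₂, ← Multiset.map_coe, Multiset.coe_toList]

theorem bag_inj {p q : Bool} {m m' : Multiset (D A)} (h : bag p m = bag q m') : m = m' := by
  rw [← elems_bag p m, h, elems_bag]

/-- The sign and the outermost constructor of a point. -/
def shape (x : D A) : Bool × Fin 3 :=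
  Quotient.lift
    (fun y : PreD A => match y with
      | .atom p _ => (p, 0)
      | .pair p _ _ => (p, 1)
      | .bag p _ => (p, 2))
    (by intro a b h; cases h <;> rfl) x

theorem shape_pair (p : Bool) (x y : D A) : (pair p x y).shape = (p, 1) := by
  induction x using Quotient.ind
  induction y using Quotient.ind
  rfl

theorem shape_neg (x : D A) : x.neg.shape = (!x.shape.1, x.shape.2) := by
  induction x using Quotient.ind with
  | _ y => cases y <;> rfl

end D

/-! ## Sources and targets at all depths -/

/-- Induction on depth, extracted from the recursor of a nested inductive type: only boxes come with
an induction hypothesis. -/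
theorem Link.ind {P : Link → Prop} (bang : ∀ B i c, (∀ l ∈ B, P l) → P (.bang B i c))
    (other : ∀ l, (∀ B i c, l ≠ .bang B i c) → P l) (l : Link) : P l := by
  refine Link.rec (motive_1 := P) (motive_2 := fun L => ∀ l ∈ L, P l)
    ?_ ?_ ?_ ?_ ?_ ?_ ?_ ?_ ?_ ?_ ?_ l
  case refine_9 => exact fun B i c h => bang B i c h
  case refine_10 => simp
  case refine_11 => intro l L h k; simpa using ⟨h, k⟩
  all_goals intros; exact other _ (by simp)

/-- The edges of a link, including those of the box of a `!`-link. -/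
def Link.src (l : Link) : Multiset Edge := l.names

/-- The edges of all depths. -/
def src (L : List Link) : Multiset Edge := names L

mutual
/-- The premises of a link, including those of the links of its box and the main conclusion of
this box. -/
def Link.tgt : Link → Multiset Edge
  | .bang B i _ => .log i ::ₘ tgt B
  | .ax _ _ => 0
  | .cut a b => {.log a, .log b}
  | .tensor a b _ => {.log a, .log b}
  | .par a b _ => {.log a, .log b}
  | .one _ => 0
  | .bot _ => 0
  | .flat a _ => {.log a}
  | .why ss _ => (ss.map .str : List Edge)
/-- The premises of links of all depths, including the main conclusions of boxes. -/
def tgt : List Link → Multiset Edge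
  | [] => 0
  | l :: L => l.tgt + tgt L
end

@[simp] theorem src_nil : src [] = 0 := rfl
@[simp] theorem src_cons (l : Link) (L : List Link) : src (l :: L) = l.src + src L := by
  simp [src, Link.src, names]
@[simp] theorem tgt_nil : tgt [] = 0 := by simp [tgt]
@[simp] theorem tgt_cons (l : Link) (L : List Link) : tgt (l :: L) = l.tgt + tgt L := by
  simp [tgt]

theorem src_eq_sum (L : List Link) : src L = (L.map Link.src).sum := by
  induction L with
  | nil => rfl
  | cons l L ih => simp [ih]

theorem tgt_eq_sum (L : List Link) : tgt L = (L.map Link.tgt).sum := by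
  induction L with
  | nil => simp
  | cons l L ih => simp [ih]

theorem src_perm {L L' : List Link} (h : L.Perm L') : src L = src L' := by
  rw [src_eq_sum, src_eq_sum, (h.map _).sum_eq]

theorem tgt_perm {L L' : List Link} (h : L.Perm L') : tgt L = tgt L' := by
  rw [tgt_eq_sum, tgt_eq_sum, (h.map _).sum_eq]

@[simp] theorem src_append (L L' : List Link) : src (L ++ L') = src L + src L' := by
  simp [src_eq_sum]

@[simp] theorem tgt_append (L L' : List Link) : tgt (L ++ L') = tgt L + tgt L' := by
  simp [tgt_eq_sum]

theorem mem_src {L : List Link} {e : Edge} : e ∈ src L ↔ ∃ l ∈ L, e ∈ l.src := by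
  induction L with
  | nil => simp
  | cons l L ih => simp [ih]

theorem mem_tgt {L : List Link} {e : Edge} : e ∈ tgt L ↔ ∃ l ∈ L, e ∈ l.tgt := by
  induction L with
  | nil => simp
  | cons l L ih => simp [ih]

namespace Link
@[simp] theorem src_ax (a b : ℕ) : (ax a b).src = {.log a, .log b} := by simp [src, names]; rfl
@[simp] theorem src_cut (a b : ℕ) : (cut a b).src = 0 := by simp [src, names]
@[simp] theorem src_tensor (a b c : ℕ) : (tensor a b c).src = {.log c} := by simp [src, names]
@[simp] theorem src_par (a b c : ℕ) : (par a b c).src = {.log c} := by simp [src, names]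
@[simp] theorem src_one (c : ℕ) : (one c).src = {.log c} := by simp [src, names]
@[simp] theorem src_bot (c : ℕ) : (bot c).src = {.log c} := by simp [src, names]
@[simp] theorem src_flat (a s : ℕ) : (flat a s).src = {.str s} := by simp [src, names]
@[simp] theorem src_why (ss : List ℕ) (c : ℕ) : (why ss c).src = {.log c} := by simp [src, names]
@[simp] theorem src_bang (B : List Link) (i c : ℕ) :
    (bang B i c).src = .log c ::ₘ LLNet.src B := by simp [src, names, LLNet.src]

attribute [simp] tgt.eq_1 tgt.eq_2 tgt.eq_3 tgt.eq_4 tgt.eq_5 tgt.eq_6 tgt.eq_7 tgt.eq_8 tgt.eq_9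

theorem concl_subset_src (l : Link) {e : Edge} (he : e ∈ l.concl) : e ∈ l.src := by
  revert e
  refine Link.ind (P := fun l => ∀ {e : Edge}, e ∈ l.concl → e ∈ l.src) ?_ ?_ l
  · intro B i c ih e he
    simp only [concl, List.mem_cons, List.mem_filter, src_bang, Multiset.mem_cons] at he ⊢
    rcases he with rfl | ⟨he, -⟩
    · exact .inl rfl
    · right
      have : ∀ L : List Link, (∀ l ∈ L, ∀ {e : Edge}, e ∈ l.concl → e ∈ l.src) →
          e ∈ sources L → e ∈ LLNet.src L := by
        intro L
        induction L with
        | nil => simp [sources]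
        | cons l L ihL =>
          intro h
          simp only [sources, List.mem_append, src_cons, Multiset.mem_add]
          exact Or.imp (fun k => h l (by simp) k) (ihL fun m hm => h m (by simp [hm]))
      exact this B ih he
  · intro l hl e he
    cases l <;> simp_all [concl]

theorem prem_subset_tgt (l : Link) {e : Edge} (he : e ∈ l.prem) : e ∈ l.tgt := by
  cases l <;> simp_all [prem]

end Link

theorem mem_sources {L : List Link} {e : Edge} : e ∈ sources L ↔ ∃ l ∈ L, e ∈ l.concl := by
  induction L with
  | nil => simp [sources]
  | cons l L ih => simp [sources, ih]

theorem mem_targets {L : List Link} {e : Edge} : e ∈ targets L ↔ ∃ l ∈ L, e ∈ l.prem := by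
  simp [targets]

theorem targets_subset_tgt {L : List Link} {e : Edge} (h : e ∈ targets L) : e ∈ tgt L := by
  obtain ⟨l, hl, he⟩ := mem_targets.1 h
  exact mem_tgt.2 ⟨l, hl, l.prem_subset_tgt he⟩

theorem sources_subset_src {L : List Link} {e : Edge} (h : e ∈ sources L) : e ∈ src L := by
  obtain ⟨l, hl, he⟩ := mem_sources.1 h
  exact mem_src.2 ⟨l, hl, l.concl_subset_src he⟩

/-! ## Flows modulo two -/

theorem zmod2_cases (t : ZMod 2) : t = 0 ∨ t = 1 := by
  revert t
  decide

theorem zmod2_eq_one_of_add {t : ZMod 2} (h : 0 = 1 + t) : t = 1 := by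
  revert t
  decide

open Classical in
/-- In a graph each of whose edges `e` has boundary `∂ e`, the sum of two vertices (modulo `2`),
a set of edges whose boundary contains `u` contains a path from `u` to another point of its
boundary. -/
theorem exists_path_of_boundary {V E : Type*} (d : E → V → ZMod 2) (C : Finset E)
    (hd : ∀ e ∈ C, ∃ x y, d e = Pi.single x 1 + Pi.single y 1) (u : V) (τ : V → ZMod 2)
    (hC : ∑ e ∈ C, d e = Pi.single u 1 + τ) :
    ∃ P ⊆ C, ∃ v, τ v = 1 ∧ ∑ e ∈ P, d e = Pi.single u 1 + Pi.single v 1 := by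
  have h2 : ∀ f : V → ZMod 2, f + f = 0 := fun f => by
    funext x
    exact CharTwo.add_self_eq_zero (f x)
  -- The path is built edge by edge: its first edge is removed from `C`, and the starting point
  -- moves to the other end of this edge.
  induction hn : C.card generalizing C u with
  | zero =>
    rw [Finset.card_eq_zero] at hn
    subst hn
    refine ⟨∅, by simp, u, ?_, ?_⟩
    · have := congrFun hC u
      simp only [Finset.sum_empty, Pi.zero_apply, Pi.add_apply, Pi.single_eq_same] at this
      exact zmod2_eq_one_of_add this
    · simp [h2]
  | succ n ih =>
    by_cases hu : τ u = 1
    · exact ⟨∅, by simp, u, hu, by simp [h2]⟩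
    have hu0 : τ u = 0 := (zmod2_cases _).resolve_right hu
    -- `u` has odd degree in `C`, so some edge of `C` that is not a loop leaves `u`.
    have : ∑ e ∈ C, d e u ≠ 0 := by
      have := congrFun hC u
      simp only [Finset.sum_apply, Pi.add_apply, Pi.single_eq_same, hu0] at this
      rw [this]
      decide
    obtain ⟨e, he, heu⟩ := Finset.exists_ne_zero_of_sum_ne_zero this
    obtain ⟨w, hw⟩ : ∃ w, d e = Pi.single u 1 + Pi.single w 1 := by
      obtain ⟨x, y, hxy⟩ := hd e he
      by_cases hx : x = u
      · exact ⟨y, hx ▸ hxy⟩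
      by_cases hy : y = u
      · exact ⟨x, by rw [hxy, hy, add_comm]⟩
      · refine absurd ?_ heu
        rw [hxy]
        simp [Ne.symm hx, Ne.symm hy]
    have hCe : ∑ e ∈ C.erase e, d e = Pi.single w 1 + τ := by
      have h := Finset.add_sum_erase C d he
      rw [hC, hw] at h
      have h' := congrArg (fun f => Pi.single u 1 + Pi.single w 1 + f) h
      simp only [← add_assoc] at h'
      have e1 : ∀ p q r : V → ZMod 2, p + q + p + q + r = r := fun p q r => by
        rw [show p + q + p + q + r = (p + p) + (q + q) + r by abel, h2, h2]; simp
      rw [e1] at h'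
      rw [h', show (Pi.single u 1 + Pi.single w 1 + Pi.single u 1 + τ : V → ZMod 2) =
        (Pi.single u 1 + Pi.single u 1) + (Pi.single w 1 + τ) by abel, h2, zero_add]
    obtain ⟨P, hP, v, hv, hPv⟩ := ih (C.erase e) (fun e' he' => hd e' (Finset.mem_of_mem_erase he'))
      w hCe (by rw [Finset.card_erase_of_mem he, hn]; rfl)
    have heP : e ∉ P := fun h => by simpa using hP h
    refine ⟨insert e P, ?_, v, hv, ?_⟩
    · intro x hx
      rcases Finset.mem_insert.1 hx with rfl | hx
      · exact he
      · exact Finset.mem_of_mem_erase (hP hx)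
    · rw [Finset.sum_insert heP, hPv, hw,
        show (Pi.single u 1 + Pi.single w 1 + (Pi.single w 1 + Pi.single v 1) : V → ZMod 2) =
          Pi.single u 1 + Pi.single v 1 + (Pi.single w 1 + Pi.single w 1) by abel, h2, add_zero]

/-- The sum of the values of `χ` at the edges incident with `l`. -/
def flux (χ : Edge → ZMod 2) (l : Link) : ZMod 2 := (l.src.map χ).sum + (l.tgt.map χ).sum

/-- `χ` is the indicator function of a set of edges that meets each link in an even number of
edges, and that contains at most one premise of each `⅋`- and `?`-link. -/
structure Flow (L : List Link) (χ : Edge → ZMod 2) : Prop where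
  flux : ∀ l ∈ L, flux χ l = 0
  par : ∀ a b c, Link.par a b c ∈ L → χ (.log a) * χ (.log b) = 0
  why : ∀ ss c, Link.why ss c ∈ L → ss.Pairwise fun s t => χ (.str s) * χ (.str t) = 0

/-- Switching acyclicity, in algebraic form. -/
def Correct (L : List Link) : Prop :=
  ∀ χ, Flow L χ → (∀ e ∈ src L, e ∉ tgt L → χ e = 0) → ∀ l ∈ L, ∀ e ∈ l.prem, χ e = 0

mutual
/-- The conditions on the box of a link, at all depths. -/
def Link.Good : Link → Prop
  | .bang B i _ => Goods B ∧ Correct B ∧ tgt B ⊆ src B ∧ .log i ∈ src B ∧ .log i ∉ tgt B ∧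
      ∀ x, .log x ∈ src B → x = i ∨ .log x ∈ tgt B
  | .ax _ _ => True
  | .cut _ _ => True
  | .tensor _ _ _ => True
  | .par _ _ _ => True
  | .one _ => True
  | .bot _ => True
  | .flat _ _ => True
  | .why _ _ => True
def Goods : List Link → Prop
  | [] => True
  | l :: L => l.Good ∧ Goods L
end

theorem goods_iff {L : List Link} : Goods L ↔ ∀ l ∈ L, l.Good := by
  induction L with
  | nil => simp [Goods]
  | cons l L ih => simp [Goods, ih]

theorem good_bang {B : List Link} {i c : ℕ} : (Link.bang B i c).Good ↔
    (∀ l ∈ B, l.Good) ∧ Correct B ∧ tgt B ⊆ src B ∧ .log i ∈ src B ∧ .log i ∉ tgt B ∧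
      ∀ x, .log x ∈ src B → x = i ∨ .log x ∈ tgt B := by
  simp only [Link.Good, goods_iff]

theorem good_of_not_bang {l : Link} (h : ∀ B i c, l ≠ .bang B i c) : l.Good := by
  cases l <;> simp_all [Link.Good]

/-- The conditions on a structure that are used, and preserved by cut elimination. -/
structure WF (L : List Link) : Prop where
  src_nodup : (src L).Nodup
  tgt_nodup : (tgt L).Nodup
  subset : tgt L ⊆ src L
  correct : Correct L
  good : ∀ l ∈ L, l.Good

theorem Flow.perm {L L' : List Link} {χ : Edge → ZMod 2} (h : L.Perm L') (hf : Flow L χ) :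
    Flow L' χ :=
  ⟨fun l hl => hf.flux l (h.mem_iff.2 hl), fun a b c hl => hf.par a b c (h.mem_iff.2 hl),
    fun ss c hl => hf.why ss c (h.mem_iff.2 hl)⟩

theorem WF.perm {L L' : List Link} (h : L.Perm L') (hL : WF L) : WF L' where
  src_nodup := src_perm h ▸ hL.src_nodup
  tgt_nodup := tgt_perm h ▸ hL.tgt_nodup
  subset := src_perm h ▸ tgt_perm h ▸ hL.subset
  correct := fun χ hχ hc l hl =>
    hL.correct χ (hχ.perm h.symm) (src_perm h ▸ tgt_perm h ▸ hc) l (h.mem_iff.2 hl)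
  good := fun l hl => hL.good l (h.mem_iff.2 hl)

/-- Boxes of well-formed structures are well-formed. -/
theorem WF.box {L B : List Link} {i c : ℕ} (h : WF L) (hB : .bang B i c ∈ L) : WF B := by
  obtain ⟨L₁, L₂, rfl⟩ := List.append_of_mem hB
  have hs := h.src_nodup
  have ht := h.tgt_nodup
  obtain ⟨h₁, h₂, h₃, -⟩ := good_bang.1 (h.good _ hB)
  simp only [src_append, src_cons, Link.src_bang, Multiset.nodup_add, Multiset.nodup_cons] at hs
  simp only [tgt_append, tgt_cons, Link.tgt, Multiset.nodup_add, Multiset.nodup_cons] at ht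
  exact ⟨hs.2.1.1.2, ht.2.1.1.2, h₃, h₂, h₁⟩

-- Linearity of the flux, and paths inside flows

theorem flux_add (χ ψ : Edge → ZMod 2) (l : Link) : flux (χ + ψ) l = flux χ l + flux ψ l := by
  have h : (χ + ψ : Edge → ZMod 2) = fun e => χ e + ψ e := rfl
  simp only [flux, h, Multiset.sum_map_add]
  ring

theorem flux_sum {ι : Type*} (s : Finset ι) (χ : ι → Edge → ZMod 2) (l : Link) :
    flux (∑ k ∈ s, χ k) l = ∑ k ∈ s, flux (χ k) l := by
  classical
  induction s using Finset.induction_on with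
  | empty => simp [flux]
  | insert a s ha ih => rw [Finset.sum_insert ha, Finset.sum_insert ha, flux_add, ih]

theorem flux_congr {χ ψ : Edge → ZMod 2} {l : Link} (h : ∀ e ∈ l.src, χ e = ψ e)
    (h' : ∀ e ∈ l.tgt, χ e = ψ e) : flux χ l = flux ψ l := by
  rw [flux, flux, Multiset.map_congr rfl h, Multiset.map_congr rfl h']

open Classical in
theorem flux_single (e : Edge) (l : Link) :
    flux (Pi.single e 1) l = (l.src.count e : ZMod 2) + (l.tgt.count e : ZMod 2) := by
  have : ∀ m : Multiset Edge,
      (m.map (Pi.single e 1 : Edge → ZMod 2)).sum = (m.count e : ZMod 2) := by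
    intro m
    induction m using Multiset.induction_on with
    | empty => simp
    | cons a m ih =>
      rw [Multiset.map_cons, Multiset.sum_cons, ih, Multiset.count_cons, Pi.single_apply]
      push_cast
      simp only [eq_comm (a := a)]
      ring
  rw [flux, this, this]

-- The links are going to be the vertices of a graph. Since the total multiset has no repetition, an
-- edge of it is incident with one vertex, which makes its column of incidences a unit vector.
open Classical in
theorem exists_unique_count {L : List Link} {g : Link → Multiset Edge} {e : Edge}
    (hn : ((L.map g).sum).Nodup) (he : e ∈ (L.map g).sum) :
    ∃ x ∈ L, ∀ l ∈ L, ((g l).count e : ZMod 2) = (Pi.single x 1 : Link → ZMod 2) l := by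
  induction L with
  | nil => simp at he
  | cons m L ih =>
    simp only [List.map_cons, List.sum_cons, Multiset.nodup_add] at hn
    simp only [List.map_cons, List.sum_cons, Multiset.mem_add] at he
    by_cases hm : e ∈ g m
    · refine ⟨m, by simp, ?_⟩
      intro l hl
      by_cases hlm : l = m
      · subst hlm
        rw [Multiset.count_eq_one_of_mem hn.1 hm]
        simp
      · have hl' : l ∈ L := by simpa [hlm] using hl
        rw [Multiset.count_eq_zero_of_notMem, Pi.single_eq_of_ne hlm]
        · simp
        · intro h
          refine Multiset.disjoint_left.1 hn.2.2 hm ?_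
          have : ∀ L : List Link, l ∈ L → g l ⊆ (L.map g).sum := by
            intro L
            induction L with
            | nil => simp
            | cons k L ih' =>
              intro hk x hx
              simp only [List.map_cons, List.sum_cons, Multiset.mem_add]
              rcases List.mem_cons.1 hk with rfl | hk
              · exact .inl hx
              · exact .inr (ih' hk hx)
          exact this L hl' h
    · obtain ⟨x, hx, h⟩ := ih hn.2.1 (he.resolve_left hm)
      refine ⟨x, by simp [hx], ?_⟩
      intro l hl
      rcases List.mem_cons.1 hl with rfl | hl
      · rw [Multiset.count_eq_zero_of_notMem hm]
        by_cases hlx : l = x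
        · subst hlx
          have := h l hx
          rw [Multiset.count_eq_zero_of_notMem hm] at this
          exact this
        · rw [Pi.single_eq_of_ne hlx]
          simp
      · exact h l hl

/-- An edge that is attached to precisely one link of `L`. -/
def IsOpen (L : List Link) (e : Edge) : Prop :=
  (e ∈ src L ∧ e ∉ tgt L) ∨ (e ∉ src L ∧ e ∈ tgt L)

open Classical in
/-- A flow that enters `Γ` through an open edge `u` contains a path to another open edge. -/
theorem exists_path_flow {Γ : List Link} (hs : (src Γ).Nodup) (ht : (tgt Γ).Nodup)
    {χ : Edge → ZMod 2} (hχ : ∀ l ∈ Γ, flux χ l = 0) {u : Edge} (hu : IsOpen Γ u)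
    (hu1 : χ u = 1) :
    ∃ (ψ : Edge → ZMod 2) (v : Edge), (∀ l ∈ Γ, flux ψ l = 0) ∧ (∀ e, χ e = 0 → ψ e = 0) ∧
      v ≠ u ∧ IsOpen Γ v ∧ ψ u = 1 ∧ ψ v = 1 ∧
      (∀ e, e ≠ u → e ≠ v → ¬ (e ∈ src Γ ∧ e ∈ tgt Γ) → ψ e = 0) := by
  have hs' := hs
  have ht' := ht
  rw [src_eq_sum] at hs'
  rw [tgt_eq_sum] at ht'
  have h2 : ∀ f : Link → ZMod 2, f + f = 0 := fun f => by
    funext x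
    exact CharTwo.add_self_eq_zero (f x)
  -- The boundary of an edge in the graph whose vertices are the links of `Γ`: two vertices for an
  -- edge with source and target in `Γ`, one vertex for an open edge.
  let d : Edge → Link → ZMod 2 := fun e l => if l ∈ Γ then flux (Pi.single e 1) l else 0
  have hsrc : ∀ e ∈ src Γ, ∃ x, ∀ l,
      (if l ∈ Γ then (l.src.count e : ZMod 2) else 0) = (Pi.single x 1 : Link → ZMod 2) l := by
    intro e he
    obtain ⟨x, hx, h⟩ := exists_unique_count hs' (src_eq_sum Γ ▸ he)
    refine ⟨x, fun l => ?_⟩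
    split_ifs with hl
    · exact h l hl
    · rw [Pi.single_eq_of_ne]
      rintro rfl
      exact hl hx
  have htgt : ∀ e ∈ tgt Γ, ∃ x, ∀ l,
      (if l ∈ Γ then (l.tgt.count e : ZMod 2) else 0) = (Pi.single x 1 : Link → ZMod 2) l := by
    intro e he
    obtain ⟨x, hx, h⟩ := exists_unique_count ht' (tgt_eq_sum Γ ▸ he)
    refine ⟨x, fun l => ?_⟩
    split_ifs with hl
    · exact h l hl
    · rw [Pi.single_eq_of_ne]
      rintro rfl
      exact hl hx
  have hnsrc : ∀ e, e ∉ src Γ → ∀ l ∈ Γ, l.src.count e = 0 := fun e he l hl =>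
    Multiset.count_eq_zero_of_notMem fun h => he (mem_src.2 ⟨l, hl, h⟩)
  have hntgt : ∀ e, e ∉ tgt Γ → ∀ l ∈ Γ, l.tgt.count e = 0 := fun e he l hl =>
    Multiset.count_eq_zero_of_notMem fun h => he (mem_tgt.2 ⟨l, hl, h⟩)
  have hboth : ∀ e, e ∈ src Γ → e ∈ tgt Γ → ∃ x y, d e = Pi.single x 1 + Pi.single y 1 := by
    intro e h h'
    obtain ⟨x, hx⟩ := hsrc e h
    obtain ⟨y, hy⟩ := htgt e h'
    refine ⟨x, y, ?_⟩
    funext l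
    rw [Pi.add_apply, ← hx, ← hy]
    simp only [d, flux_single]
    split_ifs <;> simp
  have hopen : ∀ e, IsOpen Γ e → ∃ x, d e = Pi.single x 1 := by
    rintro e (⟨h, h'⟩ | ⟨h, h'⟩)
    · obtain ⟨x, hx⟩ := hsrc e h
      refine ⟨x, ?_⟩
      funext l
      rw [← hx]
      simp only [d, flux_single]
      split_ifs with hl
      · rw [hntgt e h' l hl]; simp
      · rfl
    · obtain ⟨x, hx⟩ := htgt e h'
      refine ⟨x, ?_⟩
      funext l
      rw [← hx]
      simp only [d, flux_single]
      split_ifs with hl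
      · rw [hnsrc e h l hl]; simp
      · rfl
  let E : Finset Edge := (src Γ + tgt Γ).toFinset.filter (fun e => χ e = 1)
  let C := E.filter (fun e => e ∈ src Γ ∧ e ∈ tgt Γ)
  let O := E.filter (fun e => ¬ (e ∈ src Γ ∧ e ∈ tgt Γ))
  have hO : ∀ e, e ∈ O ↔ IsOpen Γ e ∧ χ e = 1 := by
    intro e
    simp only [O, E, Finset.mem_filter, Multiset.mem_toFinset, Multiset.mem_add, IsOpen]
    tauto
  have hind : ∀ (S : Finset Edge) (e : Edge),
      (∑ k ∈ S, (Pi.single k 1 : Edge → ZMod 2)) e = if e ∈ S then 1 else 0 := by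
    intro S e
    rw [Finset.sum_apply]
    simp [Pi.single_apply]
  have hdS : ∀ (S : Finset Edge), ∀ l ∈ Γ,
      flux (∑ k ∈ S, (Pi.single k 1 : Edge → ZMod 2)) l = (∑ k ∈ S, d k) l := by
    intro S l hl
    rw [flux_sum, Finset.sum_apply]
    simp [d, hl]
  have hE : ∑ e ∈ E, d e = 0 := by
    funext l
    by_cases hl : l ∈ Γ
    · rw [← hdS E l hl, Pi.zero_apply, ← hχ l hl]
      have key : ∀ e, e ∈ src Γ + tgt Γ → (∑ k ∈ E, (Pi.single k 1 : Edge → ZMod 2)) e = χ e := by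
        intro e he
        rw [hind]
        rcases zmod2_cases (χ e) with h | h <;> simp_all [E]
      refine flux_congr ?_ ?_
      · exact fun e he => key e (Multiset.mem_add.2 (.inl (mem_src.2 ⟨l, hl, he⟩)))
      · exact fun e he => key e (Multiset.mem_add.2 (.inr (mem_tgt.2 ⟨l, hl, he⟩)))
    · rw [Finset.sum_apply]
      simp [d, hl]
  -- The support of `χ` has boundary zero, so its closed and its open edges have the same boundary.
  -- Removing `u` from the open ones puts the closed ones in the form required by
  -- `exists_path_of_boundary`.
  have hCO : ∑ e ∈ C, d e = ∑ e ∈ O, d e := by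
    have : ∑ e ∈ C, d e + ∑ e ∈ O, d e = 0 := by
      rw [← hE]
      exact Finset.sum_filter_add_sum_filter_not E _ d
    have h3 := congrArg (· + ∑ e ∈ O, d e) this
    simpa [add_assoc, h2] using h3
  have huO : u ∈ O := (hO u).2 ⟨hu, hu1⟩
  obtain ⟨x, hx⟩ := hopen u hu
  rw [← Finset.add_sum_erase O d huO, hx] at hCO
  obtain ⟨P, hPC, y, hy, hP⟩ := exists_path_of_boundary d C (fun e he => by
    have := (Finset.mem_filter.1 he).2
    exact hboth e this.1 this.2) x _ hCO
  rw [Finset.sum_apply] at hy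
  obtain ⟨v, hv, hvy⟩ := Finset.exists_ne_zero_of_sum_ne_zero (by rw [hy]; decide)
  obtain ⟨hvu, hvO⟩ := Finset.mem_erase.1 hv
  obtain ⟨hv1, hv2⟩ := (hO v).1 hvO
  obtain ⟨z, hz⟩ := hopen v hv1
  obtain rfl : y = z := by
    by_contra hyz
    rw [hz, Pi.single_eq_of_ne hyz] at hvy
    exact hvy rfl
  have hPo : ∀ e ∈ P, e ∈ src Γ ∧ e ∈ tgt Γ := fun e he => (Finset.mem_filter.1 (hPC he)).2
  have hnP : ∀ e, IsOpen Γ e → e ∉ P := by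
    rintro e (h | h) he
    · exact h.2 (hPo e he).2
    · exact h.1 (hPo e he).1
  -- The path of closed edges, completed by its two open ends, is even at every link.
  let S := insert u (insert v P)
  refine ⟨∑ k ∈ S, (Pi.single k 1 : Edge → ZMod 2), v, ?_, ?_, hvu, hv1, ?_, ?_, ?_⟩
  · intro l hl
    rw [hdS S l hl, Finset.sum_insert, Finset.sum_insert (hnP v hv1), hP, hx, hz,
      show (Pi.single x 1 + (Pi.single y 1 + (Pi.single x 1 + Pi.single y 1)) : Link → ZMod 2) =
        (Pi.single x 1 + Pi.single x 1) + (Pi.single y 1 + Pi.single y 1) by abel, h2, h2]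
    · simp
    · simp only [Finset.mem_insert, not_or]
      exact ⟨fun h => hvu h.symm, hnP u hu⟩
  · intro e he
    rw [hind, if_neg]
    intro heS
    have : χ e = 1 := by
      rcases Finset.mem_insert.1 heS with rfl | heS
      · exact hu1
      · rcases Finset.mem_insert.1 heS with rfl | heS
        · exact hv2
        · have := hPC heS
          simp only [C, E, Finset.mem_filter] at this
          exact this.1.2
    rw [he] at this
    exact absurd this (by decide)
  · rw [hind, if_pos (by simp [S])]
  · rw [hind, if_pos (by simp [S])]
  · intro e heu hev he
    rw [hind, if_neg]
    simp only [S, Finset.mem_insert, not_or]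
    exact ⟨heu, hev, fun h => he (hPo e h)⟩

/-! ## Renaming -/

/-- Renaming of edges. -/
def Edge.map (f g : ℕ → ℕ) : Edge → Edge
  | .log a => .log (f a)
  | .str s => .str (g s)

@[simp] theorem Edge.map_log (f g : ℕ → ℕ) (a : ℕ) : Edge.map f g (.log a) = .log (f a) := rfl
@[simp] theorem Edge.map_str (f g : ℕ → ℕ) (a : ℕ) : Edge.map f g (.str a) = .str (g a) := rfl

theorem rename_eq_map (f g : ℕ → ℕ) (L : List Link) : rename f g L = L.map (Link.rename f g) := by
  induction L with
  | nil => simp [rename]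
  | cons l L ih => simp [rename, ih]

theorem sum_map_map {L : List Link} {g h : Link → Multiset Edge} {k : Link → Link}
    {f : Edge → Edge} (H : ∀ l ∈ L, g (k l) = (h l).map f) :
    ((L.map k).map g).sum = ((L.map h).sum).map f := by
  induction L with
  | nil => simp
  | cons l L ih =>
    simp only [List.map_cons, List.sum_cons, Multiset.map_add]
    rw [H l (by simp), ih fun m hm => H m (by simp [hm])]

theorem Link.src_tgt_rename (f g : ℕ → ℕ) (l : Link) :
    (l.rename f g).src = l.src.map (Edge.map f g) ∧
      (l.rename f g).tgt = l.tgt.map (Edge.map f g) := by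
  refine Link.ind (P := fun l => (l.rename f g).src = l.src.map (Edge.map f g) ∧
      (l.rename f g).tgt = l.tgt.map (Edge.map f g)) ?_ ?_ l
  · intro B i c ih
    have h₁ := sum_map_map (g := Link.src) (h := Link.src) fun l hl => (ih l hl).1
    have h₂ := sum_map_map (g := Link.tgt) (h := Link.tgt) fun l hl => (ih l hl).2
    rw [← rename_eq_map] at h₁ h₂
    rw [← src_eq_sum, ← src_eq_sum] at h₁
    rw [← tgt_eq_sum, ← tgt_eq_sum] at h₂
    simp [Link.rename, h₁, h₂]
  · intro l hl
    cases l <;> simp_all [Link.rename, Function.comp_def]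

theorem Link.src_rename (f g : ℕ → ℕ) (l : Link) :
    (l.rename f g).src = l.src.map (Edge.map f g) := (l.src_tgt_rename f g).1

theorem Link.tgt_rename (f g : ℕ → ℕ) (l : Link) :
    (l.rename f g).tgt = l.tgt.map (Edge.map f g) := (l.src_tgt_rename f g).2

theorem src_rename (f g : ℕ → ℕ) (L : List Link) :
    src (rename f g L) = (src L).map (Edge.map f g) := by
  rw [src_eq_sum, src_eq_sum, rename_eq_map]
  exact sum_map_map fun l _ => l.src_rename f g

theorem tgt_rename (f g : ℕ → ℕ) (L : List Link) :
    tgt (rename f g L) = (tgt L).map (Edge.map f g) := by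
  rw [tgt_eq_sum, tgt_eq_sum, rename_eq_map]
  exact sum_map_map fun l _ => l.tgt_rename f g

theorem Link.prem_rename (f g : ℕ → ℕ) (l : Link) :
    (l.rename f g).prem = l.prem.map (Edge.map f g) := by
  cases l <;> simp [Link.rename, Link.prem]

theorem flux_rename (f g : ℕ → ℕ) (χ : Edge → ZMod 2) (l : Link) :
    flux χ (l.rename f g) = flux (χ ∘ Edge.map f g) l := by
  simp [flux, Link.src_rename, Link.tgt_rename]

theorem Flow.of_rename {f g : ℕ → ℕ} {χ : Edge → ZMod 2} {L : List Link}
    (h : Flow (rename f g L) χ) : Flow L (χ ∘ Edge.map f g) := by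
  rw [rename_eq_map] at h
  refine ⟨?_, ?_, ?_⟩
  · intro l hl
    rw [← flux_rename]
    exact h.flux _ (List.mem_map_of_mem hl)
  · intro a b c hl
    exact h.par (f a) (f b) (f c) (List.mem_map_of_mem (f := Link.rename f g) hl)
  · intro ss c hl
    have := h.why (ss.map g) (f c) (List.mem_map_of_mem (f := Link.rename f g) hl)
    exact List.pairwise_map.1 this

theorem Edge.map_injective {f g : ℕ → ℕ} (hf : f.Injective) (hg : g.Injective) :
    (Edge.map f g).Injective := by
  rintro (a | a) (b | b) h
  · simpa using hf (by simpa using h)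
  · simp at h
  · simp at h
  · simpa using hg (by simpa using h)

/-- Flows are pulled back along the renaming. Injectivity guarantees that an edge which is no
premise remains so, hence that the pull-back still vanishes on the out-edges. -/
theorem Correct.rename {f g : ℕ → ℕ} (hf : f.Injective) (hg : g.Injective) {L : List Link}
    (h : Correct L) : Correct (rename f g L) := by
  have hm := Edge.map_injective hf hg
  intro χ hχ hc l hl e he
  rw [rename_eq_map] at hl
  obtain ⟨l, hlL, rfl⟩ := List.mem_map.1 hl
  rw [Link.prem_rename] at he
  obtain ⟨e, hel, rfl⟩ := List.mem_map.1 he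
  refine h _ hχ.of_rename ?_ l hlL e hel
  intro e he he'
  refine hc _ ?_ ?_
  · rw [src_rename]
    exact Multiset.mem_map_of_mem _ he
  · rw [tgt_rename, Multiset.mem_map_of_injective hm]
    exact he'

theorem good_rename {f g : ℕ → ℕ} (hf : f.Injective) (hg : g.Injective) {l : Link} :
    l.Good → (l.rename f g).Good := by
  have hm := Edge.map_injective hf hg
  refine Link.ind (P := fun l => l.Good → (l.rename f g).Good) ?_ ?_ l
  · intro B i c ih h
    obtain ⟨h₁, h₂, h₃, h₄, h₅, h₆⟩ := good_bang.1 h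
    rw [Link.rename, good_bang]
    refine ⟨?_, h₂.rename hf hg, ?_, ?_, ?_, ?_⟩
    · intro l hl
      rw [rename_eq_map] at hl
      obtain ⟨l, hlB, rfl⟩ := List.mem_map.1 hl
      exact ih l hlB (h₁ l hlB)
    · rw [src_rename, tgt_rename]
      exact Multiset.map_subset_map h₃
    · rw [src_rename]
      exact Multiset.mem_map_of_mem (Edge.map f g) h₄
    · rw [tgt_rename, ← Edge.map_log f g, Multiset.mem_map_of_injective hm]
      exact h₅
    · intro x hx
      rw [src_rename] at hx
      obtain ⟨e, he, hex⟩ := Multiset.mem_map.1 hx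
      cases e with
      | str s => simp at hex
      | log y =>
        obtain rfl : f y = x := by simpa using hex
        rcases h₆ y he with rfl | h
        · exact .inl rfl
        · right
          rw [tgt_rename]
          exact Multiset.mem_map_of_mem (Edge.map f g) h
  · intro l hl _
    refine good_of_not_bang ?_
    cases l <;> simp_all [Link.rename]

/-! ## Out-edges -/

theorem WF.exists_out {L : List Link} (h : WF L) : ∃ X, src L = tgt L + X := by
  obtain ⟨X, hX⟩ := Multiset.le_iff_exists_add.1 ((Multiset.le_iff_subset h.tgt_nodup).2 h.subset)
  exact ⟨X, hX⟩

theorem mem_out {L : List Link} {X : Multiset Edge} (h : (src L).Nodup) (hX : src L = tgt L + X)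
    {e : Edge} : e ∈ X ↔ e ∈ src L ∧ e ∉ tgt L := by
  rw [hX] at h ⊢
  have := (Multiset.nodup_add.1 h).2.2
  rw [Multiset.mem_add]
  exact ⟨fun he => ⟨.inr he, fun h' => Multiset.disjoint_left.1 this h' he⟩,
    fun he => he.1.resolve_left he.2⟩

/-- Writing the edges as premises plus out-edges `X` settles at once that premises are edges and are
not repeated. For a reduction step it is then enough to follow the equation of multisets. -/
theorem WF.mk' {L : List Link} {X : Multiset Edge} (hs : (src L).Nodup) (hX : src L = tgt L + X)
    (hc : Correct L) (hg : ∀ l ∈ L, l.Good) : WF L := by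
  have h := hs
  rw [hX] at h
  exact ⟨hs, (Multiset.nodup_add.1 h).1, hX ▸ Multiset.subset_of_le (Multiset.le_add_right _ _),
    hc, hg⟩

/-- The out-edges of a box: its main conclusion and its structural conclusions. -/
theorem exists_out_box {B : List Link} {i c : ℕ} (hB : WF B) (h : (Link.bang B i c).Good) :
    ∃ Y, src B = tgt B + (.log i ::ₘ Y) ∧ ∀ x, .log x ∉ Y := by
  obtain ⟨Z, hZ⟩ := hB.exists_out
  obtain ⟨-, -, -, h₄, h₅, h₆⟩ := good_bang.1 h
  have hi : .log i ∈ Z := (mem_out hB.src_nodup hZ).2 ⟨h₄, h₅⟩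
  obtain ⟨Y, rfl⟩ := Multiset.exists_cons_of_mem hi
  refine ⟨Y, hZ, fun x hx => ?_⟩
  have hx' := (mem_out hB.src_nodup hZ).1 (Multiset.mem_cons_of_mem hx)
  rcases h₆ x hx'.1 with rfl | h
  · have := hB.src_nodup
    rw [hZ] at this
    exact (Multiset.nodup_cons.1 (Multiset.nodup_add.1 this).2.1).1 hx
  · exact hx'.2 h

theorem good_bang_of_out {B : List Link} {i c : ℕ} {Y : Multiset Edge} (hB : WF B)
    (hY : src B = tgt B + Y) (hi : .log i ∈ Y) (h : ∀ x, .log x ∈ Y → x = i) :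
    (Link.bang B i c).Good := by
  rw [good_bang]
  refine ⟨hB.good, hB.correct, hB.subset, ((mem_out hB.src_nodup hY).1 hi).1,
    ((mem_out hB.src_nodup hY).1 hi).2, fun x hx => ?_⟩
  by_cases hx' : .log x ∈ tgt B
  · exact .inr hx'
  · exact .inl (h x ((mem_out hB.src_nodup hY).2 ⟨hx, hx'⟩))

/-- An edge that is produced and consumed in the box is counted twice and cancels. As `i` itself
occurs in `X`, it cancels too: a box is a vertex that meets only its main and auxiliary conclusions.
-/
theorem flux_bang {B : List Link} {i c : ℕ} {X : Multiset Edge} (hX : src B = tgt B + X)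
    (χ : Edge → ZMod 2) :
    flux χ (.bang B i c) = χ (.log c) + χ (.log i) + (X.map χ).sum := by
  simp only [flux, Link.src_bang, Link.tgt, hX, Multiset.map_cons, Multiset.map_add,
    Multiset.sum_cons, Multiset.sum_add]
  have : ((tgt B).map χ).sum + ((tgt B).map χ).sum = 0 := CharTwo.add_self_eq_zero _
  linear_combination this

theorem Link.tgt_eq_prem {l : Link} (h : ∀ B i c, l ≠ .bang B i c) : l.tgt = l.prem := by
  cases l <;> simp_all [Link.prem] <;> rfl

theorem Link.src_eq_concl {l : Link} (h : ∀ B i c, l ≠ .bang B i c) : l.src = l.concl := by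
  cases l <;> simp_all [Link.concl] ; rfl

theorem eq_of_mem_sum {L : List Link} {g : Link → Multiset Edge} (h : ((L.map g).sum).Nodup)
    {l m : Link} (hl : l ∈ L) (hm : m ∈ L) {e : Edge} (hel : e ∈ g l) (hem : e ∈ g m) :
    l = m := by
  have key : ∀ L : List Link, ∀ l ∈ L, e ∈ g l → e ∈ (L.map g).sum := by
    intro L l hl he
    obtain ⟨p, q, rfl⟩ := List.append_of_mem hl
    simp [he]
  induction L with
  | nil => simp at hl
  | cons k L ih =>
    simp only [List.map_cons, List.sum_cons, Multiset.nodup_add] at h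
    rcases List.mem_cons.1 hl with rfl | hl' <;> rcases List.mem_cons.1 hm with rfl | hm'
    · rfl
    · exact absurd (key L m hm' hem) (Multiset.disjoint_left.1 h.2.2 hel)
    · exact absurd (key L l hl' hel) (Multiset.disjoint_left.1 h.2.2 hem)
    · exact ih h.2.1 hl' hm'

theorem WF.eq_of_src {L : List Link} (h : WF L) {l m : Link} (hl : l ∈ L) (hm : m ∈ L) {e : Edge}
    (hel : e ∈ l.src) (hem : e ∈ m.src) : l = m :=
  eq_of_mem_sum (src_eq_sum L ▸ h.src_nodup) hl hm hel hem

theorem WF.eq_of_tgt {L : List Link} (h : WF L) {l m : Link} (hl : l ∈ L) (hm : m ∈ L) {e : Edge}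
    (hel : e ∈ l.tgt) (hem : e ∈ m.tgt) : l = m :=
  eq_of_mem_sum (tgt_eq_sum L ▸ h.tgt_nodup) hl hm hel hem

theorem str_mem_concl_bang {B : List Link} {i c s : ℕ} :
    Edge.str s ∈ (Link.bang B i c).concl ↔ Edge.str s ∈ conclusions B := by
  simp [Link.concl, conclusions, Edge.isLog]

theorem tgt_bang_subset {L B : List Link} {i c : ℕ} (h : WF L) (hl : .bang B i c ∈ L) :
    (Link.bang B i c).tgt ⊆ src B := by
  intro e he
  rcases Multiset.mem_cons.1 (by simpa using he : e ∈ .log i ::ₘ tgt B) with rfl | he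
  · exact (good_bang.1 (h.good _ hl)).2.2.2.1
  · exact (h.box hl).subset he

/-- The structural conclusions are the structural edges that are premises of no link of any depth. -/
theorem mem_conclusions {L : List Link} (h : WF L) {s : ℕ} :
    .str s ∈ conclusions L ↔ .str s ∈ src L ∧ .str s ∉ tgt L := by
  -- One level of the induction on depth: the claim for a structure, given the claim for its boxes.
  have key : ∀ L : List Link, WF L → (∀ l ∈ L, ∀ B i c, l = .bang B i c →
      WF B → ∀ s, (Edge.str s ∈ conclusions B ↔ Edge.str s ∈ src B ∧ Edge.str s ∉ tgt B)) →
      ∀ s, (Edge.str s ∈ conclusions L ↔ Edge.str s ∈ src L ∧ Edge.str s ∉ tgt L) := by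
    intro L h ih s
    simp only [conclusions, List.mem_filter, decide_eq_true_eq]
    constructor
    · rintro ⟨hs, ht⟩
      refine ⟨sources_subset_src hs, fun hk => ?_⟩
      obtain ⟨k, hk, hsk⟩ := mem_tgt.1 hk
      obtain ⟨m, hm, hsm⟩ := mem_sources.1 hs
      by_cases hkb : ∃ B' i' c', k = .bang B' i' c'
      · obtain ⟨B, i, c, rfl⟩ := hkb
        -- A line consumed inside a box originates there, so the link that produces it at ground
        -- level is this very box. But a box does not export a line that it consumes.
        have hsB := tgt_bang_subset h hk hsk
        obtain rfl := h.eq_of_src hm hk (m.concl_subset_src hsm) (by simp [hsB])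
        rw [str_mem_concl_bang, ih _ hk B i c rfl (h.box hk)] at hsm
        exact hsm.2 (by simpa using hsk)
      · push Not at hkb
        rw [Link.tgt_eq_prem hkb] at hsk
        exact ht (mem_targets.2 ⟨k, hk, hsk⟩)
    · rintro ⟨hs, ht⟩
      refine ⟨?_, fun h' => ht (targets_subset_tgt h')⟩
      obtain ⟨m, hm, hsm⟩ := mem_src.1 hs
      refine mem_sources.2 ⟨m, hm, ?_⟩
      by_cases hmb : ∃ B' i' c', m = .bang B' i' c'
      · obtain ⟨B, i, c, rfl⟩ := hmb
        rw [str_mem_concl_bang, ih _ hm B i c rfl (h.box hm)]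
        exact ⟨by simpa using hsm, fun h' => ht (mem_tgt.2 ⟨_, hm, by simp [h']⟩)⟩
      · push Not at hmb
        rwa [Link.src_eq_concl hmb] at hsm
  refine key L h (fun l _ => ?_) s
  refine Link.ind (P := fun l => ∀ B i c, l = .bang B i c →
      WF B → ∀ s, (Edge.str s ∈ conclusions B ↔ Edge.str s ∈ src B ∧ Edge.str s ∉ tgt B)) ?_ ?_ l
  · rintro B i c ih _ _ _ ⟨⟩ hB
    exact key B hB ih
  · rintro l hl B i c rfl
    exact absurd rfl (hl B i c)

/-- The source of a logical premise of a link is a link of the same ground-structure. -/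
theorem WF.exists_source {L : List Link} (h : WF L) {l : Link} (hl : l ∈ L) {a : ℕ}
    (ha : .log a ∈ l.prem) : ∃ m ∈ L, .log a ∈ m.concl := by
  obtain ⟨m, hm, ham⟩ := mem_src.1 (h.subset (mem_tgt.2 ⟨l, hl, l.prem_subset_tgt ha⟩))
  refine ⟨m, hm, ?_⟩
  by_cases hmb : ∃ B' i' c', m = .bang B' i' c'
  · obtain ⟨B, i, c, rfl⟩ := hmb
    rw [Link.src_bang, Multiset.mem_cons] at ham
    rcases ham with h' | h'
    · exact List.mem_cons.2 (.inl h')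
    · have : Edge.log a ∈ (Link.bang B i c).tgt := by
        rcases (good_bang.1 (h.good _ hm)).2.2.2.2.2 a h' with rfl | h' <;> simp [*]
      obtain rfl := h.eq_of_tgt hm hl this (l.prem_subset_tgt ha)
      simp [Link.prem] at ha
  · push Not at hmb
    rwa [Link.src_eq_concl hmb] at ham

/-! ## Substitution of sets of edges for edges -/

/-- The pull-back of `χ` when every edge `e` is replaced by the edges `ρ e`. -/
def pull (ρ : Edge → Multiset Edge) (χ : Edge → ZMod 2) (e : Edge) : ZMod 2 := ((ρ e).map χ).sum

/-- `pull` is the transpose of substitution; this is what turns equations between multisets of edges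
into equations between fluxes. -/
theorem sum_map_bind (ρ : Edge → Multiset Edge) (χ : Edge → ZMod 2) (m : Multiset Edge) :
    ((m.bind ρ).map χ).sum = (m.map (pull ρ χ)).sum := by
  induction m using Multiset.induction_on with
  | empty => simp
  | cons a m ih => simp [ih, pull]

theorem bind_eq_self {ρ : Edge → Multiset Edge} {m : Multiset Edge} (h : ∀ e ∈ m, ρ e = {e}) :
    m.bind ρ = m := by
  induction m using Multiset.induction_on with
  | empty => simp
  | cons a m ih =>
    rw [Multiset.cons_bind, h a (by simp), ih fun e he => h e (by simp [he]),
      Multiset.singleton_add]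

/-- The structural edge `s` is replaced by the structural edges `θ s`. -/
def spread (θ : ℕ → List ℕ) : Edge → Multiset Edge
  | .log a => {.log a}
  | .str s => ((θ s).map .str : List Edge)

@[simp] theorem spread_log (θ : ℕ → List ℕ) (a : ℕ) : spread θ (.log a) = {.log a} := rfl

theorem spread_of_eq {θ : ℕ → List ℕ} {s : ℕ} (h : θ s = [s]) : spread θ (.str s) = {.str s} := by
  simp [spread, h]

@[simp] theorem pull_spread_log (θ : ℕ → List ℕ) (χ : Edge → ZMod 2) (a : ℕ) :
    pull (spread θ) χ (.log a) = χ (.log a) := by simp [pull]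

theorem log_mem_bind_spread {θ : ℕ → List ℕ} {m : Multiset Edge} {x : ℕ} :
    .log x ∈ m.bind (spread θ) ↔ .log x ∈ m := by
  rw [Multiset.mem_bind]
  constructor
  · rintro ⟨e | s, he, h⟩
    · simp only [spread_log, Multiset.mem_singleton] at h
      exact h ▸ he
    · simp [spread] at h
  · exact fun h => ⟨_, h, by simp⟩

theorem Link.src_expand (θ : ℕ → List ℕ) (l : Link) : (l.expand θ).src = l.src := by
  cases l <;> simp [Link.expand]

theorem src_expand (θ : ℕ → List ℕ) (L : List Link) : src (L.map (Link.expand θ)) = src L := by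
  rw [src_eq_sum, src_eq_sum, List.map_map]
  congr 1
  exact List.map_congr_left fun l _ => l.src_expand θ

theorem Link.tgt_why_expand (θ : ℕ → List ℕ) (ss : List ℕ) (c : ℕ) :
    ((Link.why ss c).expand θ).tgt = (Link.why ss c).tgt.bind (spread θ) := by
  simp only [Link.expand, Link.tgt]
  induction ss with
  | nil => simp
  | cons s ss ih =>
    simp only [List.flatMap_cons, List.map_append, List.map_cons, ← Multiset.cons_coe,
      Multiset.cons_bind, ← ih, ← Multiset.coe_add]
    rfl

/-- Only `?`-links receive lines from outside; the lines consumed within a box are produced in it.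
-/
theorem Link.Good.tgt_subset {l : Link} (h : l.Good) {s : ℕ} (hs : .str s ∈ l.tgt)
    (hl : ∀ ss c, l ≠ .why ss c) : .str s ∈ l.src := by
  cases l with
  | bang B i c =>
    simp only [Link.tgt, Multiset.mem_cons, reduceCtorEq, false_or] at hs
    simp [(good_bang.1 h).2.2.1 hs]
  | why ss c => exact absurd rfl (hl ss c)
  | _ => simp at hs

theorem Link.expand_of_ne {θ : ℕ → List ℕ} {l : Link} (h : ∀ ss c, l ≠ .why ss c) :
    l.expand θ = l := by
  cases l <;> simp_all [Link.expand]

/-- `expand` acts on `?`-links of the ground level alone, whereas `spread θ` acts on all premises.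
The two agree because the lines consumed in a box are produced there, and these are fixed by `θ`. -/
theorem Link.tgt_expand {θ : ℕ → List ℕ} {l : Link} (h : l.Good)
    (hθ : ∀ s, .str s ∈ l.src → θ s = [s]) : (l.expand θ).tgt = l.tgt.bind (spread θ) := by
  by_cases hl : ∃ ss c, l = .why ss c
  · obtain ⟨ss, c, rfl⟩ := hl
    exact Link.tgt_why_expand θ ss c
  · push Not at hl
    rw [Link.expand_of_ne hl, bind_eq_self]
    rintro (a | s) he
    · rfl
    · exact spread_of_eq (hθ s (h.tgt_subset he hl))

theorem tgt_expand {θ : ℕ → List ℕ} {L : List Link} (h : ∀ l ∈ L, l.Good)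
    (hθ : ∀ s, .str s ∈ src L → θ s = [s]) :
    tgt (L.map (Link.expand θ)) = (tgt L).bind (spread θ) := by
  induction L with
  | nil => simp
  | cons l L ih =>
    simp only [src_cons, Multiset.mem_add] at hθ
    simp only [List.map_cons, tgt_cons, Multiset.add_bind]
    rw [Link.tgt_expand (h l (by simp)) fun s hs => hθ s (.inl hs),
      ih (fun m hm => h m (by simp [hm])) fun s hs => hθ s (.inr hs)]

theorem bind_spread_src {θ : ℕ → List ℕ} {m : Multiset Edge} (hθ : ∀ s, .str s ∈ m → θ s = [s]) :
    m.bind (spread θ) = m := by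
  refine bind_eq_self ?_
  rintro (a | s) he
  · rfl
  · exact spread_of_eq (hθ s he)

theorem flux_expand {θ : ℕ → List ℕ} {l : Link} (h : l.Good)
    (hθ : ∀ s, .str s ∈ l.src → θ s = [s]) (χ : Edge → ZMod 2) :
    flux χ (l.expand θ) = flux (pull (spread θ) χ) l := by
  rw [flux, flux, Link.tgt_expand h hθ, Link.src_expand, sum_map_bind, ← sum_map_bind _ _ l.src,
    bind_spread_src hθ]

theorem Link.Good.expand {l : Link} (h : l.Good) (θ : ℕ → List ℕ) : (l.expand θ).Good := by
  cases l <;> simp_all [Link.expand, Link.Good]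

theorem pull_spread_str (θ : ℕ → List ℕ) (χ : Edge → ZMod 2) (s : ℕ) :
    pull (spread θ) χ (.str s) = ((θ s).map fun y => χ (.str y)).sum := by
  simp [pull, spread, Function.comp_def]

theorem sum_mul_eq_zero {ι κ : Type*} {f : ι → ZMod 2} {g : κ → ZMod 2} {l : List ι} {m : List κ}
    (h : ∀ x ∈ l, ∀ y ∈ m, f x * g y = 0) : (l.map f).sum * (m.map g).sum = 0 := by
  rw [mul_eq_zero]
  by_cases hl : ∀ x ∈ l, f x = 0
  · exact .inl (List.sum_eq_zero (by simpa using hl))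
  · push Not at hl
    obtain ⟨x, hx, hx'⟩ := hl
    refine .inr (List.sum_eq_zero ?_)
    simp only [List.mem_map, forall_exists_index, and_imp, forall_apply_eq_imp_iff₂]
    exact fun y hy => (mul_eq_zero.1 (h x hx y hy)).resolve_left hx'

/-- At most one term is non-zero, so no cancellation modulo two can hide it. This recovers the
values on the copies of a premise from the value of the pull-back. -/
theorem eq_zero_of_sum_eq_zero {ι : Type*} {f : ι → ZMod 2} {l : List ι}
    (h : l.Pairwise fun x y => f x * f y = 0) (hs : (l.map f).sum = 0) : ∀ x ∈ l, f x = 0 := by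
  induction l with
  | nil => simp
  | cons a l ih =>
    rw [List.pairwise_cons] at h
    simp only [List.map_cons, List.sum_cons] at hs
    have ha : f a = 0 := by
      by_contra ha
      have : (l.map f).sum = 0 := List.sum_eq_zero (by
        simp only [List.mem_map, forall_exists_index, and_imp, forall_apply_eq_imp_iff₂]
        exact fun y hy => (mul_eq_zero.1 (h.1 y hy)).resolve_left ha)
      rw [this, add_zero] at hs
      exact ha hs
    rw [ha, zero_add] at hs
    simpa [ha] using ih h.2 hs

theorem Flow.of_expand {θ : ℕ → List ℕ} {χ : Edge → ZMod 2} {L : List Link}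
    (hg : ∀ l ∈ L, l.Good) (hθ : ∀ s, .str s ∈ src L → θ s = [s])
    (h : Flow (L.map (Link.expand θ)) χ) : Flow L (pull (spread θ) χ) := by
  refine ⟨?_, ?_, ?_⟩
  · intro l hl
    rw [← flux_expand (hg l hl) fun s hs => hθ s (mem_src.2 ⟨l, hl, hs⟩)]
    exact h.flux _ (List.mem_map_of_mem hl)
  · intro a b c hl
    simpa using h.par a b c (List.mem_map_of_mem (f := Link.expand θ) hl)
  · intro ss c hl
    have := h.why _ c (List.mem_map_of_mem (f := Link.expand θ) hl)
    rw [List.pairwise_flatMap] at this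
    refine this.2.imp fun {s t} hst => ?_
    rw [pull_spread_str, pull_spread_str]
    exact sum_mul_eq_zero hst

/-- A flow vanishes on the premises if its pull-back does. -/
theorem Flow.prem_expand {θ : ℕ → List ℕ} {χ : Edge → ZMod 2} {L : List Link}
    (h : Flow (L.map (Link.expand θ)) χ) {l : Link} (hl : l ∈ L)
    (h0 : ∀ e ∈ l.prem, pull (spread θ) χ e = 0)
    (hθ : ∀ s, (∃ a, l = .flat a s) → θ s = [s]) : ∀ e ∈ (l.expand θ).prem, χ e = 0 := by
  by_cases hw : ∃ ss c, l = .why ss c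
  · obtain ⟨ss, c, rfl⟩ := hw
    have hp := h.why _ c (List.mem_map_of_mem (f := Link.expand θ) hl)
    rw [List.pairwise_flatMap] at hp
    intro e he
    simp only [Link.expand, Link.prem, List.mem_map, List.mem_flatMap] at he
    obtain ⟨y, ⟨s, hs, hy⟩, rfl⟩ := he
    refine eq_zero_of_sum_eq_zero (f := fun y => χ (.str y)) (hp.1 s hs) ?_ y hy
    rw [← pull_spread_str]
    exact h0 _ (by simpa [Link.prem] using hs)
  · push Not at hw
    rw [Link.expand_of_ne hw]
    intro e he
    have : ∃ a, e = .log a := by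
      cases l <;> simp_all [Link.prem]
      all_goals rcases he with rfl | rfl <;> simp
    obtain ⟨a, rfl⟩ := this
    simpa using h0 _ he

/-! ## Reduction steps as transformations of edges -/

/-- What the elimination of a cut of `L` does to its edges. -/
structure StepRel (N : ℕ) (L L' : List Link) (θ : ℕ → List ℕ) : Prop where
  fresh : ∀ e ∈ src L', e ∈ src L ∨ N ≤ e.name
  out : ∀ X, src L = tgt L + X → src L' = tgt L' + X.bind (spread θ)
  old : ∀ s, .str s ∉ src L → θ s = [s]

theorem StepRel.perm {N : ℕ} {L L₁ L' : List Link} {θ : ℕ → List ℕ} (h : L.Perm L₁)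
    (hs : StepRel N L₁ L' θ) : StepRel N L L' θ where
  fresh := src_perm h ▸ hs.fresh
  out := src_perm h ▸ tgt_perm h ▸ hs.out
  old := src_perm h ▸ hs.old

/-- At the outer level a box counts only through its out-edges, and those of `B'` are the images
under `θ` of those of `B`. Flows are therefore pulled back along `spread θ`, whatever happened
inside the box. -/
theorem wf_box {N : ℕ} {B B' Γ : List Link} {i c : ℕ} {θ : ℕ → List ℕ}
    (h : WF (.bang B i c :: Γ)) (hN : ∀ e ∈ src (.bang B i c :: Γ), e.name < N)
    (hB' : WF B') (hr : StepRel N B B' θ) :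
    WF (.bang B' i c :: Γ.map (Link.expand θ)) ∧
      StepRel N (.bang B i c :: Γ) (.bang B' i c :: Γ.map (Link.expand θ)) θ := by
  have hB := h.box (List.mem_cons_self ..)
  have hbg := h.good _ (List.mem_cons_self ..)
  have hΓ : ∀ l ∈ Γ, l.Good := fun l hl => h.good l (List.mem_cons_of_mem _ hl)
  obtain ⟨Y, hY, hYl⟩ := exists_out_box hB hbg
  have hY' := hr.out _ hY
  have hs := h.src_nodup
  simp only [src_cons, Link.src_bang, Multiset.nodup_add, Multiset.nodup_cons] at hs
  have hθ : ∀ s, .str s ∈ src Γ → θ s = [s] := fun s hs' => hr.old s fun h' =>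
    Multiset.disjoint_left.1 hs.2.2 (Multiset.mem_cons_of_mem h') hs'
  have htΓ := tgt_expand hΓ hθ
  have hsΓ := bind_spread_src hθ
  simp only [src_cons, Link.src_bang] at hN
  have hout : ∀ X, src (.bang B i c :: Γ) = tgt (.bang B i c :: Γ) + X →
      src (.bang B' i c :: Γ.map (Link.expand θ)) =
        tgt (.bang B' i c :: Γ.map (Link.expand θ)) + X.bind (spread θ) := by
    intro X hX
    simp only [src_cons, Link.src_bang, tgt_cons, Link.tgt, hY] at hX
    simp only [src_cons, Link.src_bang, tgt_cons, Link.tgt, hY', src_expand, htΓ]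
    -- The premises inside `B` are cancelled before substituting, since the reduction changes them
    -- in an uncontrolled way.
    have e : {Edge.log c} + {Edge.log i} + Y + src Γ = {Edge.log i} + (tgt Γ + X) := by
      ext x
      have := congrArg (Multiset.count x) hX
      simp only [← Multiset.singleton_add, Multiset.count_add] at this ⊢
      omega
    have e' := congrArg (Multiset.bind · (spread θ)) e
    simp only [Multiset.add_bind, Multiset.singleton_bind, spread_log, hsΓ] at e'
    ext x
    have := congrArg (Multiset.count x) e'
    simp only [← Multiset.singleton_add, Multiset.count_add, Multiset.add_bind,
      Multiset.singleton_bind, spread_log] at this ⊢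
    omega
  obtain ⟨X, hX⟩ := h.exists_out
  have hnd : (src (.bang B' i c :: Γ.map (Link.expand θ))).Nodup := by
    simp only [src_cons, Link.src_bang, src_expand, Multiset.nodup_add, Multiset.nodup_cons]
    refine ⟨⟨?_, hB'.src_nodup⟩, hs.2.1, ?_⟩
    · intro h'
      rcases hr.fresh _ h' with h' | h'
      · exact hs.1.1 h'
      · exact absurd (hN (.log c) (by simp)) (by omega)
    · rw [Multiset.disjoint_left]
      intro e he he'
      rcases Multiset.mem_cons.1 he with rfl | he
      · exact Multiset.disjoint_left.1 hs.2.2 (Multiset.mem_cons_self ..) he'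
      · rcases hr.fresh _ he with h' | h'
        · exact Multiset.disjoint_left.1 hs.2.2 (Multiset.mem_cons_of_mem h') he'
        · exact absurd (hN e (by simp [he'])) (by omega)
  refine ⟨WF.mk' hnd (hout X hX) ?_ ?_, ?_, hout, ?_⟩
  · intro χ hχ hc
    have hχΓ : Flow (Γ.map (Link.expand θ)) χ :=
      ⟨fun l hl => hχ.flux l (List.mem_cons_of_mem _ hl),
        fun a b c hl => hχ.par a b c (List.mem_cons_of_mem _ hl),
        fun ss c hl => hχ.why ss c (List.mem_cons_of_mem _ hl)⟩
    have hp := hχΓ.of_expand hΓ hθ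
    have hf : Flow (.bang B i c :: Γ) (pull (spread θ) χ) := by
      refine ⟨?_, ?_, ?_⟩
      · intro l hl
        rcases List.mem_cons.1 hl with rfl | hl
        · have := hχ.flux _ (List.mem_cons_self ..)
          rw [flux_bang hY', sum_map_bind] at this
          rw [flux_bang hY]
          simpa using this
        · exact hp.flux l hl
      · intro a b c' hl
        exact hp.par a b c' (by simpa using hl)
      · intro ss c' hl
        exact hp.why ss c' (by simpa using hl)
    have h0 := h.correct _ hf ?_
    · intro l hl
      rcases List.mem_cons.1 hl with rfl | hl
      · simp [Link.prem]
      · obtain ⟨l, hlΓ, rfl⟩ := List.mem_map.1 hl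
        refine hχΓ.prem_expand hlΓ (h0 l (List.mem_cons_of_mem _ hlΓ)) ?_
        rintro s ⟨a, rfl⟩
        exact hθ s (mem_src.2 ⟨_, hlΓ, by simp⟩)
    · intro e he he'
      -- The images of an out-edge are out-edges of the new structure, where `χ` vanishes.
      have heX := (mem_out h.src_nodup hX).2 ⟨he, he'⟩
      refine Multiset.sum_eq_zero fun x hx => ?_
      obtain ⟨y, hy, rfl⟩ := Multiset.mem_map.1 hx
      have := (mem_out hnd (hout X hX)).1 (Multiset.mem_bind.2 ⟨e, heX, hy⟩)
      exact hc y this.1 this.2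
  · intro l hl
    rcases List.mem_cons.1 hl with rfl | hl
    · refine good_bang_of_out hB' hY' (by simp) fun x hx => ?_
      rw [log_mem_bind_spread] at hx
      rcases Multiset.mem_cons.1 hx with hx | hx
      · simpa using hx
      · exact absurd hx (hYl x)
    · obtain ⟨l, hlΓ, rfl⟩ := List.mem_map.1 hl
      exact (hΓ l hlΓ).expand θ
  · intro e he
    simp only [src_cons, Link.src_bang, src_expand, Multiset.mem_add, Multiset.mem_cons] at he ⊢
    rcases he with (he | he) | he
    · exact .inl (.inl (.inl he))
    · exact (hr.fresh e he).imp (fun h => .inl (.inr h)) id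
    · exact .inl (.inr he)
  · intro s hs'
    refine hr.old s fun h' => hs' (by simp [h'])

/-! ## Dispatching the copies of a box -/

/-- Addition of `K` to the name of an edge. -/
def Edge.shift (K : ℕ) : Edge → Edge := Edge.map (· + K) (· + K)

@[simp] theorem Edge.shift_log (K a : ℕ) : Edge.shift K (.log a) = .log (a + K) := rfl
@[simp] theorem Edge.shift_str (K a : ℕ) : Edge.shift K (.str a) = .str (a + K) := rfl
@[simp] theorem Edge.name_shift (K : ℕ) (e : Edge) : (e.shift K).name = e.name + K := by
  cases e <;> rfl

theorem Edge.shift_injective (K : ℕ) : (Edge.shift K).Injective :=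
  Edge.map_injective (add_left_injective K) (add_left_injective K)

/-- What is added to the names of the copy of the box that corresponds to the premise `s`. -/
def offset (N : ℕ) (ss : List ℕ) (s : ℕ) : ℕ := (ss.idxOf s + 1) * N

theorem boxCopy_of_mem {N : ℕ} {B : List Link} {i : ℕ} {ss : List ℕ} {a s : ℕ} (h : s ∈ ss) :
    boxCopy N B i ss a s = .cut a (i + offset N ss s) ::
      rename (· + offset N ss s) (· + offset N ss s) B := by
  rw [boxCopy, if_pos h]
  rfl

theorem boxCopy_of_notMem {N : ℕ} {B : List Link} {i : ℕ} {ss : List ℕ} {a s : ℕ} (h : s ∉ ss) :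
    boxCopy N B i ss a s = [.flat a s] := by
  rw [boxCopy, if_neg h]

/-- The premises `s` among `ss` are replaced by shifted copies of `m`. -/
def graftBy (N : ℕ) (ss : List ℕ) (m : Multiset Edge) : Edge → Multiset Edge
  | .log a => {.log a}
  | .str s => if s ∈ ss then m.map (Edge.shift (offset N ss s)) else {.str s}

/-- The premises that are added for each edge when the copies of a box are dispatched. -/
def graftTgt (N : ℕ) (B : List Link) (i : ℕ) (ss : List ℕ) : Edge → Multiset Edge
  | .log _ => 0
  | .str s => if s ∈ ss then (Edge.log i ::ₘ tgt B).map (Edge.shift (offset N ss s)) else 0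

section graft

variable {N : ℕ} {B : List Link} {i : ℕ} {ss : List ℕ}

theorem graft_eq_flatMap (r : ℕ → ℕ → List Link) (L : List Link) :
    graft r L = L.flatMap (Link.graft r) := by
  induction L with
  | nil => simp [graft]
  | cons l L ih => simp [graft, ih]

theorem mem_graft {r : ℕ → ℕ → List Link} {L : List Link} {m : Link} :
    m ∈ graft r L ↔ ∃ l ∈ L, m ∈ l.graft r := by
  simp [graft_eq_flatMap]

@[simp] theorem graftBy_log (m : Multiset Edge) (a : ℕ) :
    graftBy N ss m (.log a) = {.log a} := rfl
@[simp] theorem graftTgt_log (a : ℕ) : graftTgt N B i ss (.log a) = 0 := rfl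

theorem graftBy_of_mem {m : Multiset Edge} {s : ℕ} (h : s ∈ ss) :
    graftBy N ss m (.str s) = m.map (Edge.shift (offset N ss s)) := if_pos h
theorem graftBy_of_notMem {m : Multiset Edge} {s : ℕ} (h : s ∉ ss) :
    graftBy N ss m (.str s) = {.str s} := if_neg h
theorem graftTgt_of_mem {s : ℕ} (h : s ∈ ss) :
    graftTgt N B i ss (.str s) = (Edge.log i ::ₘ tgt B).map (Edge.shift (offset N ss s)) :=
  if_pos h
theorem graftTgt_of_notMem {s : ℕ} (h : s ∉ ss) : graftTgt N B i ss (.str s) = 0 := if_neg h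

theorem Link.graft_of_ne {r : ℕ → ℕ → List Link} {l : Link} (h : ∀ a s, l ≠ .flat a s)
    (h' : ∀ B i c, l ≠ .bang B i c) : l.graft r = [l] := by
  cases l <;> simp_all [Link.graft]

theorem src_tgt_graft_of_forall {L : List Link}
    (h : ∀ l ∈ L, src (l.graft (boxCopy N B i ss)) = l.src.bind (graftBy N ss (src B)) ∧
      tgt (l.graft (boxCopy N B i ss)) = l.tgt + l.src.bind (graftTgt N B i ss)) :
    src (graft (boxCopy N B i ss) L) = (src L).bind (graftBy N ss (src B)) ∧
      tgt (graft (boxCopy N B i ss) L) = tgt L + (src L).bind (graftTgt N B i ss) := by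
  induction L with
  | nil => simp [graft]
  | cons l L ih =>
    obtain ⟨h₁, h₂⟩ := ih fun m hm => h m (by simp [hm])
    obtain ⟨h₃, h₄⟩ := h l (by simp)
    simp only [graft, src_append, tgt_append, src_cons, tgt_cons, h₁, h₂, h₃, h₄,
      Multiset.add_bind, true_and]
    abel

/-- The premise of a replaced `♭`-link remains, as first premise of the new cut. What is added is
its second premise, a copy of `i`, and the premises inside the copy of `B`; hence the additional
premises depend on `l.src` only. -/
theorem Link.src_tgt_graft (l : Link) :
    LLNet.src (l.graft (boxCopy N B i ss)) = l.src.bind (graftBy N ss (LLNet.src B)) ∧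
      LLNet.tgt (l.graft (boxCopy N B i ss)) = l.tgt + l.src.bind (graftTgt N B i ss) := by
  refine Link.ind (P := fun l => LLNet.src (l.graft (boxCopy N B i ss)) =
      l.src.bind (graftBy N ss (LLNet.src B)) ∧
      LLNet.tgt (l.graft (boxCopy N B i ss)) = l.tgt + l.src.bind (graftTgt N B i ss)) ?_ ?_ l
  · intro B₁ i₁ c₁ ih
    obtain ⟨h₁, h₂⟩ := src_tgt_graft_of_forall ih
    simp [Link.graft, h₁, h₂]
  · intro l hl
    cases l with
    | flat a s =>
      by_cases hs : s ∈ ss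
      · simp [Link.graft, boxCopy_of_mem hs, LLNet.src_rename, LLNet.tgt_rename,
          graftBy_of_mem hs, graftTgt_of_mem hs]
        exact ⟨rfl, Multiset.cons_swap _ _ _⟩
      · simp [Link.graft, boxCopy_of_notMem hs, graftBy_of_notMem hs, graftTgt_of_notMem hs]
    | bang B i c => exact absurd rfl (hl B i c)
    | _ => simp [Link.graft]

theorem src_graft (L : List Link) :
    src (graft (boxCopy N B i ss) L) = (src L).bind (graftBy N ss (src B)) :=
  (src_tgt_graft_of_forall fun l _ => l.src_tgt_graft).1

theorem tgt_graft (L : List Link) :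
    tgt (graft (boxCopy N B i ss) L) = tgt L + (src L).bind (graftTgt N B i ss) :=
  (src_tgt_graft_of_forall fun l _ => l.src_tgt_graft).2

/-- Modulo two everything internal to a copy cancels, including its main conclusion, which is now
cut; only copies of the structural conclusions `Y` remain visible. -/
theorem graftBy_src {Y : Multiset Edge} (hY : src B = tgt B + (.log i ::ₘ Y)) {e : Edge} :
    ∀ (χ : Edge → ZMod 2),
    ((graftBy N ss (src B) e).map χ).sum + ((graftTgt N B i ss e).map χ).sum =
      pull (graftBy N ss Y) χ e := by
  intro χ
  cases e with
  | log a => simp [pull]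
  | str s =>
    by_cases hs : s ∈ ss
    · rw [graftBy_of_mem hs, graftTgt_of_mem hs, pull, graftBy_of_mem hs, hY]
      simp only [Multiset.map_add, Multiset.map_cons, Multiset.sum_add, Multiset.sum_cons]
      generalize (Multiset.map χ (Multiset.map (Edge.shift (offset N ss s)) (tgt B))).sum = p
      generalize χ (Edge.shift (offset N ss s) (Edge.log i)) = q
      have h₁ : p + p = 0 := CharTwo.add_self_eq_zero _
      have h₂ : q + q = 0 := CharTwo.add_self_eq_zero _
      linear_combination h₁ + h₂
    · simp [graftBy_of_notMem hs, graftTgt_of_notMem hs, pull]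

theorem graftBy_src_eq {Y : Multiset Edge} (hY : src B = tgt B + (.log i ::ₘ Y)) (e : Edge) :
    graftBy N ss (src B) e = graftTgt N B i ss e + graftBy N ss Y e := by
  cases e with
  | log a => simp
  | str s =>
    by_cases hs : s ∈ ss
    · rw [graftBy_of_mem hs, graftTgt_of_mem hs, graftBy_of_mem hs, hY, ← Multiset.map_add]
      congr 1
      simp
    · simp [graftBy_of_notMem hs, graftTgt_of_notMem hs]

theorem bind_graftBy {Y m : Multiset Edge} (h : ∀ s ∈ ss, .str s ∉ m) :
    m.bind (graftBy N ss Y) = m := by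
  refine bind_eq_self ?_
  rintro (a | s) he
  · rfl
  · exact graftBy_of_notMem fun hs => h s hs he

/-- The lines `ss` have lost their `?`-link, so they are among the out-edges `X` as far as they
occur; each is replaced by the structural conclusions of its copy of the box. -/
theorem out_graft {Y : Multiset Edge} (hY : src B = tgt B + (.log i ::ₘ Y)) {L : List Link}
    (hL : ∀ s ∈ ss, .str s ∉ tgt L) {X : Multiset Edge} (hX : src L = tgt L + X) :
    src (graft (boxCopy N B i ss) L) =
      tgt (graft (boxCopy N B i ss) L) + X.bind (graftBy N ss Y) := by
  rw [src_graft, tgt_graft]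
  have h₁ : (src L).bind (graftBy N ss (src B)) =
      (src L).bind (graftTgt N B i ss) + (src L).bind (graftBy N ss Y) := by
    rw [← Multiset.bind_add]
    exact Multiset.bind_congr fun e _ => graftBy_src_eq hY e
  have h₂ : (src L).bind (graftBy N ss Y) = tgt L + X.bind (graftBy N ss Y) := by
    rw [hX, Multiset.add_bind, bind_graftBy hL]
  rw [h₁, h₂]
  abel

theorem lt_name_of_mem_graftBy {m : Multiset Edge} {e y : Edge}
    (he : e.name < N) (hy : y ∈ graftBy N ss m e) :
    (y = e ∧ ∀ s ∈ ss, e ≠ .str s) ∨ ∃ s ∈ ss, e = .str s ∧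
      ∃ x ∈ m, y = x.shift (offset N ss s) := by
  cases e with
  | log a => exact .inl ⟨by simpa using hy, by simp⟩
  | str s =>
    by_cases hs : s ∈ ss
    · rw [graftBy_of_mem hs] at hy
      obtain ⟨x, hx, rfl⟩ := Multiset.mem_map.1 hy
      exact .inr ⟨s, hs, rfl, x, hx, rfl⟩
    · rw [graftBy_of_notMem hs] at hy
      refine .inl ⟨by simpa using hy, ?_⟩
      rintro s' hs' h
      cases h
      exact hs hs'

/-- Division by `N` recovers the rank of the copy, which is at least one. Hence names of different
copies are distinct, and distinct from the old names, all below `N`. -/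
theorem offset_inj {s s' x x' : ℕ} (hs : s ∈ ss) (hs' : s' ∈ ss) (hx : x < N)
    (hx' : x' < N) (h : x + offset N ss s = x' + offset N ss s') : s = s' ∧ x = x' := by
  have h₁ : (x + offset N ss s) / N = ss.idxOf s + 1 := by
    rw [offset, Nat.add_mul_div_right _ _ (by omega), Nat.div_eq_of_lt hx]
    omega
  have h₂ : (x' + offset N ss s') / N = ss.idxOf s' + 1 := by
    rw [offset, Nat.add_mul_div_right _ _ (by omega), Nat.div_eq_of_lt hx']
    omega
  have h₃ : ss.idxOf s = ss.idxOf s' := by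
    rw [h, h₂] at h₁
    omega
  have h₄ := (List.idxOf_inj hs).1 h₃
  subst h₄
  exact ⟨rfl, by omega⟩

theorem le_offset (s : ℕ) : N ≤ offset N ss s := by
  rw [offset]
  nlinarith [Nat.zero_le (ss.idxOf s * N)]

theorem nodup_bind_graftBy {m M : Multiset Edge} (hm : ∀ e ∈ m, e.name < N) (hmn : m.Nodup)
    (hM : ∀ e ∈ M, e.name < N) (hMn : M.Nodup) : (M.bind (graftBy N ss m)).Nodup := by
  rw [Multiset.nodup_bind]
  refine ⟨?_, hMn.pairwise ?_⟩
  · rintro (a | s) _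
    · simp
    · by_cases hs : s ∈ ss
      · rw [graftBy_of_mem hs]
        exact hmn.map (Edge.shift_injective _)
      · simp [graftBy_of_notMem hs]
  · intro e he e' he' hne
    rw [Function.onFun, Multiset.disjoint_left]
    intro y hy hy'
    rcases lt_name_of_mem_graftBy (hM e he) hy with ⟨rfl, -⟩ | ⟨s, hs, rfl, x, hx, rfl⟩ <;>
      rcases lt_name_of_mem_graftBy (hM e' he') hy' with ⟨h, -⟩ | ⟨s', hs', rfl, x', hx', h⟩
    · exact hne h
    · have h₁ := hM _ he
      have h₂ := le_offset (N := N) (ss := ss) s'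
      rw [h, Edge.name_shift] at h₁
      omega
    · have h₁ := hM _ he'
      have h₂ := le_offset (N := N) (ss := ss) s
      rw [← h, Edge.name_shift] at h₁
      omega
    · have := congrArg Edge.name h
      rw [Edge.name_shift, Edge.name_shift] at this
      exact hne (congrArg Edge.str (offset_inj hs hs' (hm x hx) (hm x' hx') this).1)

theorem sum_flux (χ : Edge → ZMod 2) (L : List Link) :
    (L.map (flux χ)).sum = ((src L).map χ).sum + ((tgt L).map χ).sum := by
  induction L with
  | nil => simp
  | cons l L ih =>
    simp only [List.map_cons, List.sum_cons, ih, src_cons, tgt_cons, Multiset.map_add,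
      Multiset.sum_add, flux]
    ring

/-- The fluxes of all the links that replace `l` add up to the flux at `l` of the pull-back: a
`♭`-link with its grafted copy behaves as a vertex from `a` to the structural conclusions of the
copy. -/
theorem Flow.of_graft {Y : Multiset Edge} (hY : src B = tgt B + (.log i ::ₘ Y)) {L : List Link}
    (hL : ∀ s ∈ ss, .str s ∉ tgt L) {χ : Edge → ZMod 2}
    (h : Flow (graft (boxCopy N B i ss) L) χ) : Flow L (pull (graftBy N ss Y) χ) := by
  refine ⟨?_, ?_, ?_⟩
  · intro l hl
    have h₁ : ((l.graft (boxCopy N B i ss)).map (LLNet.flux χ)).sum = 0 := by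
      refine List.sum_eq_zero ?_
      simp only [List.mem_map, forall_exists_index, and_imp, forall_apply_eq_imp_iff₂]
      exact fun m hm => h.flux m (mem_graft.2 ⟨l, hl, hm⟩)
    rw [sum_flux, (l.src_tgt_graft).1, (l.src_tgt_graft).2, Multiset.map_add, Multiset.sum_add,
      sum_map_bind, sum_map_bind] at h₁
    rw [← h₁, LLNet.flux]
    have h₂ : (l.src.map (pull (graftBy N ss Y) χ)).sum =
        (l.src.map (pull (graftBy N ss (src B)) χ)).sum +
          (l.src.map (pull (graftTgt N B i ss) χ)).sum := by
      rw [← Multiset.sum_map_add]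
      exact congrArg _ (Multiset.map_congr rfl fun e _ => (graftBy_src hY χ).symm)
    have h₃ : (l.tgt.map (pull (graftBy N ss Y) χ)).sum = (l.tgt.map χ).sum := by
      rw [← sum_map_bind, bind_graftBy]
      exact fun s hs h' => hL s hs (mem_tgt.2 ⟨l, hl, h'⟩)
    rw [h₂, h₃]
    ring
  · intro a b c hl
    simpa [pull] using h.par a b c (mem_graft.2 ⟨_, hl, by simp [Link.graft]⟩)
  · intro s' c hl
    refine (h.why s' c (mem_graft.2 ⟨_, hl, by simp [Link.graft]⟩)).imp_of_mem ?_
    intro s t hs ht hst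
    have : ∀ s ∈ s', pull (graftBy N ss Y) χ (.str s) = χ (.str s) := by
      intro s hs
      rw [pull, graftBy_of_notMem]
      · simp
      · exact fun h' => hL s h' (mem_tgt.2 ⟨_, hl, by simp [hs]⟩)
    rw [this s hs, this t ht, hst]

/-- A flow vanishes on the premises of links if its pull-back does, and if it vanishes on the
structural conclusions of the copies of the box. -/
theorem Flow.prem_graft {Y : Multiset Edge} (hB : WF B) (hY : src B = tgt B + (.log i ::ₘ Y))
    {L : List Link} (hL : ∀ s ∈ ss, .str s ∉ tgt L) {χ : Edge → ZMod 2}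
    (h : Flow (graft (boxCopy N B i ss) L) χ)
    (h0 : ∀ l ∈ L, ∀ e ∈ l.prem, pull (graftBy N ss Y) χ e = 0)
    (hc : ∀ a s, .flat a s ∈ L → s ∈ ss → ∀ e ∈ Y, χ (e.shift (offset N ss s)) = 0) :
    ∀ m ∈ graft (boxCopy N B i ss) L, ∀ e ∈ m.prem, χ e = 0 := by
  intro m hm e he
  obtain ⟨l, hl, hml⟩ := mem_graft.1 hm
  by_cases hlf : ∃ a s, l = .flat a s ∧ s ∈ ss
  · obtain ⟨a, s, rfl, hs⟩ := hlf
    have hsub : ∀ m ∈ boxCopy N B i ss a s, m ∈ graft (boxCopy N B i ss) L := fun m hm =>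
      mem_graft.2 ⟨_, hl, by simpa [Link.graft] using hm⟩
    rw [boxCopy_of_mem hs] at hsub
    simp only [Link.graft, boxCopy_of_mem hs] at hml
    have ha : χ (.log a) = 0 := by simpa [pull] using h0 _ hl (.log a) (by simp [Link.prem])
    -- Evenness at the new cut. Then `χ` vanishes on all the out-edges of the copy, and correctness
    -- of `B` applies inside it.
    have hi : χ (.log (i + offset N ss s)) = 0 := by
      have := h.flux _ (hsub _ (List.mem_cons_self ..))
      simpa [LLNet.flux, ha] using this
    rcases List.mem_cons.1 hml with rfl | hml
    · simp only [Link.prem, List.mem_cons, List.not_mem_nil, or_false] at he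
      rcases he with rfl | rfl
      · exact ha
      · exact hi
    · have hf : Flow (rename (· + offset N ss s) (· + offset N ss s) B) χ :=
        ⟨fun l hl => h.flux l (hsub l (List.mem_cons_of_mem _ hl)),
        fun a b c hl => h.par a b c (hsub _ (List.mem_cons_of_mem _ hl)),
        fun ss c hl => h.why ss c (hsub _ (List.mem_cons_of_mem _ hl))⟩
      refine hB.correct.rename (add_left_injective _) (add_left_injective _) χ hf ?_ m hml e he
      intro e he he'
      rw [src_rename] at he
      rw [tgt_rename] at he'
      obtain ⟨x, hx, rfl⟩ := Multiset.mem_map.1 he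
      have hxt : x ∉ tgt B := fun h' => he' (Multiset.mem_map_of_mem _ h')
      have := (mem_out hB.src_nodup hY).2 ⟨hx, hxt⟩
      rcases Multiset.mem_cons.1 this with rfl | hxY
      · exact hi
      · exact hc a s hl hs x hxY
  · by_cases hlb : ∃ B' i' c', l = .bang B' i' c'
    · obtain ⟨B', i', c', rfl⟩ := hlb
      simp only [Link.graft, List.mem_singleton] at hml
      subst hml
      simp [Link.prem] at he
    · push Not at hlb
      have : m = l := by
        by_cases hf : ∃ a s, l = .flat a s
        · obtain ⟨a, s, rfl⟩ := hf
          have hs : s ∉ ss := fun hs => hlf ⟨a, s, rfl, hs⟩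
          simpa [Link.graft, boxCopy_of_notMem hs] using hml
        · push Not at hf
          simpa [Link.graft_of_ne hf hlb] using hml
      subst this
      have h1 := h0 m hl e he
      cases e with
      | log a => simpa [pull] using h1
      | str s =>
        have hs : s ∉ ss := fun hs => hL s hs (mem_tgt.2 ⟨m, hl, m.prem_subset_tgt he⟩)
        simpa [pull, graftBy_of_notMem hs] using h1

theorem graft_good {Y : Multiset Edge} (hbg : ∀ l ∈ B, l.Good) {L : List Link}
    (hY : src B = tgt B + (.log i ::ₘ Y)) (hYl : ∀ x, .log x ∉ Y)
    (hL : ∀ l ∈ L, l.Good)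
    (h : ∀ B' i' c', .bang B' i' c' ∈ L → WF B' ∧ (∀ s ∈ ss, .str s ∉ tgt B') ∧
      WF (graft (boxCopy N B i ss) B')) :
    ∀ m ∈ graft (boxCopy N B i ss) L, m.Good := by
  intro m hm
  obtain ⟨l, hl, hml⟩ := mem_graft.1 hm
  by_cases hlf : ∃ a s, l = .flat a s
  · obtain ⟨a, s, rfl⟩ := hlf
    by_cases hs : s ∈ ss
    · simp only [Link.graft, boxCopy_of_mem hs] at hml
      rcases List.mem_cons.1 hml with rfl | hml
      · simp [Link.Good]
      · rw [rename_eq_map] at hml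
        obtain ⟨l, hlB, rfl⟩ := List.mem_map.1 hml
        exact good_rename (add_left_injective _) (add_left_injective _) (hbg l hlB)
    · simp only [Link.graft, boxCopy_of_notMem hs, List.mem_singleton] at hml
      subst hml
      simp [Link.Good]
  · push Not at hlf
    by_cases hlb : ∃ B' i' c', l = .bang B' i' c'
    · obtain ⟨B', i', c', rfl⟩ := hlb
      simp only [Link.graft, List.mem_singleton] at hml
      subst hml
      obtain ⟨h₁, h₂, h₃⟩ := h _ _ _ hl
      obtain ⟨Y', hY', hYl'⟩ := exists_out_box h₁ (hL _ hl)
      refine good_bang_of_out h₃ (out_graft hY h₂ hY') (by simp) ?_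
      intro x hx
      obtain ⟨e, he, hx⟩ := Multiset.mem_bind.1 hx
      rcases Multiset.mem_cons.1 he with rfl | he
      · simpa using hx
      · cases e with
        | log y => exact absurd he (hYl' y)
        | str s =>
          by_cases hs : s ∈ ss
          · rw [graftBy_of_mem hs] at hx
            obtain ⟨y, hy, hxy⟩ := Multiset.mem_map.1 hx
            cases y with
            | log y => exact absurd hy (hYl y)
            | str y => simp at hxy
          · simp [graftBy_of_notMem hs] at hx
    · push Not at hlb
      rw [Link.graft_of_ne hlf hlb, List.mem_singleton] at hml
      exact hml ▸ hL l hl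

/-- Well-formedness of the boxes into which copies of a box are put. -/
theorem wf_graft_box {Y : Multiset Edge} (hB : WF B) (hBN : ∀ e ∈ src B, e.name < N)
    (hY : src B = tgt B + (.log i ::ₘ Y)) (hYl : ∀ x, .log x ∉ Y) {L : List Link} (h : WF L)
    (hLN : ∀ e ∈ src L, e.name < N) (hL : ∀ s ∈ ss, .str s ∉ tgt L) :
    WF (graft (boxCopy N B i ss) L) := by
  have key : ∀ L : List Link, WF L → (∀ e ∈ src L, e.name < N) → (∀ s ∈ ss, .str s ∉ tgt L) →
      (∀ l ∈ L, ∀ B' i' c', l = .bang B' i' c' → WF B' → (∀ e ∈ src B', e.name < N) →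
        (∀ s ∈ ss, .str s ∉ tgt B') → WF (graft (boxCopy N B i ss) B')) →
      WF (graft (boxCopy N B i ss) L) := by
    intro L h hLN hL ih
    obtain ⟨X, hX⟩ := h.exists_out
    have ho := out_graft (N := N) hY hL hX
    have hnd : (src (graft (boxCopy N B i ss) L)).Nodup := by
      rw [src_graft]
      exact nodup_bind_graftBy hBN hB.src_nodup hLN h.src_nodup
    refine WF.mk' hnd ho ?_ (graft_good hB.good hY hYl h.good ?_)
    · intro χ hχ hc
      have hX0 : ∀ e ∈ X, ∀ y ∈ graftBy N ss Y e, χ y = 0 := by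
        intro e he y hy
        have := (mem_out hnd ho).1 (Multiset.mem_bind.2 ⟨e, he, hy⟩)
        exact hc y this.1 this.2
      refine hχ.prem_graft hB hY hL ?_ ?_
      · refine h.correct _ (hχ.of_graft hY hL) fun e he he' => ?_
        refine Multiset.sum_eq_zero fun x hx => ?_
        obtain ⟨y, hy, rfl⟩ := Multiset.mem_map.1 hx
        exact hX0 e ((mem_out h.src_nodup hX).2 ⟨he, he'⟩) y hy
      · intro a s hl hs e he
        refine hX0 (.str s) ((mem_out h.src_nodup hX).2
          ⟨mem_src.2 ⟨_, hl, by simp⟩, hL s hs⟩) _ ?_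
        rw [graftBy_of_mem hs]
        exact Multiset.mem_map_of_mem _ he
    · intro B' i' c' hl
      have hs : ∀ s ∈ ss, .str s ∉ tgt B' := fun s hs h' =>
        hL s hs (mem_tgt.2 ⟨_, hl, by simp [h']⟩)
      exact ⟨h.box hl, hs, ih _ hl B' i' c' rfl (h.box hl)
        (fun e he => hLN e (mem_src.2 ⟨_, hl, by simp [he]⟩)) hs⟩
  refine key L h hLN hL fun l _ => ?_
  refine Link.ind (P := fun l => ∀ B' i' c', l = .bang B' i' c' → WF B' →
    (∀ e ∈ src B', e.name < N) → (∀ s ∈ ss, .str s ∉ tgt B') →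
      WF (graft (boxCopy N B i ss) B')) ?_ ?_ l
  · rintro B' i' c' ih _ _ _ ⟨⟩ h hN hs
    exact key B' h hN hs ih
  · rintro l hl B' i' c' rfl
    exact absurd rfl (hl B' i' c')

end graft

/-! ## Cut elimination preserves well-formedness -/

theorem Flow.tail {l : Link} {L : List Link} {χ : Edge → ZMod 2} (h : Flow (l :: L) χ) :
    Flow L χ :=
  ⟨fun m hm => h.flux m (List.mem_cons_of_mem _ hm),
    fun a b c hm => h.par a b c (List.mem_cons_of_mem _ hm),
    fun ss c hm => h.why ss c (List.mem_cons_of_mem _ hm)⟩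

theorem Flow.cons {l : Link} {L : List Link} {χ : Edge → ZMod 2} (h : Flow L χ)
    (h₁ : LLNet.flux χ l = 0) (h₂ : ∀ a b c, l = .par a b c → χ (.log a) * χ (.log b) = 0)
    (h₃ : ∀ ss c, l = .why ss c → ss.Pairwise fun s t => χ (.str s) * χ (.str t) = 0) :
    Flow (l :: L) χ := by
  refine ⟨?_, ?_, ?_⟩
  · intro m hm
    rcases List.mem_cons.1 hm with rfl | hm
    · exact h₁
    · exact h.flux m hm
  · intro a b c hm
    rcases List.mem_cons.1 hm with hm | hm
    · exact h₂ a b c hm.symm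
    · exact h.par a b c hm
  · intro ss c hm
    rcases List.mem_cons.1 hm with hm | hm
    · exact h₃ ss c hm.symm
    · exact h.why ss c hm

theorem Flow.congr {L : List Link} {χ ψ : Edge → ZMod 2} (h : Flow L χ)
    (hs : ∀ e ∈ src L, ψ e = χ e) (ht : ∀ e ∈ tgt L, ψ e = χ e) : Flow L ψ := by
  refine ⟨?_, ?_, ?_⟩
  · intro l hl
    rw [← h.flux l hl]
    exact flux_congr (fun e he => hs e (mem_src.2 ⟨l, hl, he⟩))
      (fun e he => ht e (mem_tgt.2 ⟨l, hl, he⟩))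
  · intro a b c hl
    rw [ht _ (mem_tgt.2 ⟨_, hl, by simp⟩), ht _ (mem_tgt.2 ⟨_, hl, by simp⟩)]
    exact h.par a b c hl
  · intro ss c hl
    refine (h.why ss c hl).imp_of_mem fun {s t} hs ht' hst => ?_
    rw [ht _ (mem_tgt.2 ⟨_, hl, by simp [hs]⟩), ht _ (mem_tgt.2 ⟨_, hl, by simp [ht']⟩)]
    exact hst

theorem rename_eq_self {f : ℕ → ℕ} {l : Link}
    (h : ∀ x, .log x ∈ l.src ∨ .log x ∈ l.tgt → f x = x) : l.rename f id = l := by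
  revert h
  refine Link.ind (P := fun l => (∀ x, .log x ∈ l.src ∨ .log x ∈ l.tgt → f x = x) →
    l.rename f id = l) ?_ ?_ l
  · intro B i c ih h
    have hB : rename f id B = B := by
      rw [rename_eq_map]
      conv_rhs => rw [← List.map_id B]
      refine List.map_congr_left fun l hl => ih l hl fun x hx => h x ?_
      rcases hx with hx | hx
      · exact .inl (by simp [mem_src.2 ⟨l, hl, hx⟩])
      · exact .inr (by simp [mem_tgt.2 ⟨l, hl, hx⟩])
    rw [Link.rename, hB, h i (by simp), h c (by simp)]
  · intro l hl h
    cases l <;> simp_all [Link.rename]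

theorem rename_list_eq_self {f : ℕ → ℕ} {L : List Link} (h : ∀ x, .log x ∈ src L → f x = x)
    (h' : ∀ x, .log x ∈ tgt L → f x = x) : rename f id L = L := by
  rw [rename_eq_map]
  conv_rhs => rw [← List.map_id L]
  refine List.map_congr_left fun l hl => rename_eq_self fun x hx => ?_
  rcases hx with hx | hx
  · exact h x (mem_src.2 ⟨l, hl, hx⟩)
  · exact h' x (mem_tgt.2 ⟨l, hl, hx⟩)

theorem src_ax_of_or {x : Link} {a c : ℕ} (hx : x = .ax a c ∨ x = .ax c a) :
    x.src = {.log a, .log c} := by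
  rcases hx with rfl | rfl
  · simp
  · exact (Link.src_ax _ _).trans (Multiset.pair_comm _ _)

theorem tgt_ax_of_or {x : Link} {a c : ℕ} (hx : x = .ax a c ∨ x = .ax c a) : x.tgt = 0 := by
  rcases hx with rfl | rfl <;> simp

theorem src_cut_of_or {x : Link} {a c : ℕ} (hx : x = .cut a c ∨ x = .cut c a) : x.src = 0 := by
  rcases hx with rfl | rfl <;> simp

theorem tgt_cut_of_or {x : Link} {a c : ℕ} (hx : x = .cut a c ∨ x = .cut c a) :
    x.tgt = {.log a, .log c} := by
  rcases hx with rfl | rfl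
  · simp
  · simp only [Link.tgt]
    exact Multiset.pair_comm _ _

theorem prem_cut_of_or {x : Link} {a c : ℕ} (hx : x = .cut a c ∨ x = .cut c a) :
    .log a ∈ x.prem := by
  rcases hx with rfl | rfl <;> simp [Link.prem]

-- The `ax` step

section ax

variable {x t : Link} {a b c : ℕ} {Γ : List Link}

/-- Otherwise the axiom and the cut would form a cycle: the indicator function of their two common
edges would be a flow, non-zero on a premise of the cut. -/
theorem WF.ne_of_ax (hx : x = .ax a c ∨ x = .ax c a) (ht : t = .cut a b ∨ t = .cut b a)
    (h : WF (x :: t :: Γ)) : b ≠ c := by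
  rintro rfl
  have hs := h.src_nodup
  have hT := h.tgt_nodup
  simp only [src_cons, tgt_cons, src_ax_of_or hx, src_cut_of_or ht, tgt_ax_of_or hx,
    tgt_cut_of_or ht, zero_add] at hs hT
  have hab : a ≠ b := by
    rintro rfl
    simp at hs
  have ha : .log a ∉ src Γ ∧ .log b ∉ src Γ := by
    simp at hs
    tauto
  have hb : .log a ∉ tgt Γ ∧ .log b ∉ tgt Γ := by
    simp at hT
    tauto
  let χ : Edge → ZMod 2 := fun e => if e = .log a ∨ e = .log b then 1 else 0
  have hΓ : Flow Γ χ := by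
    refine Flow.congr (χ := 0) ⟨?_, ?_, ?_⟩ ?_ ?_
    · intro l _
      simp [flux]
    · simp
    · intro ss c _
      exact List.pairwise_of_forall (by simp)
    · intro e he
      have : ¬ (e = .log a ∨ e = .log b) := by
        rintro (rfl | rfl)
        · exact ha.1 he
        · exact ha.2 he
      simp [χ, this]
    · intro e he
      have : ¬ (e = .log a ∨ e = .log b) := by
        rintro (rfl | rfl)
        · exact hb.1 he
        · exact hb.2 he
      simp [χ, this]
  have e2 : (1 + 1 : ZMod 2) = 0 := by decide
  have hf : Flow (x :: t :: Γ) χ := by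
    refine (hΓ.cons ?_ ?_ ?_).cons ?_ ?_ ?_
    · simp [flux, src_cut_of_or ht, tgt_cut_of_or ht, χ, e2]
    · rcases ht with rfl | rfl <;> simp
    · rcases ht with rfl | rfl <;> simp
    · simp [flux, src_ax_of_or hx, tgt_ax_of_or hx, χ, e2]
    · rcases hx with rfl | rfl <;> simp
    · rcases hx with rfl | rfl <;> simp
  have := h.correct χ hf ?_ t (by simp) (.log a) (prem_cut_of_or ht)
  · simp [χ] at this
  · intro e _ he'
    simp only [tgt_cons, tgt_ax_of_or hx, tgt_cut_of_or ht, zero_add, Multiset.mem_add] at he'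
    have : ¬ (e = .log a ∨ e = .log b) := by
      rintro (rfl | rfl) <;> simp at he'
    simp [χ, this]

/-- The renaming of the edges in an axiom step. -/
def axMap (b c : ℕ) (e : ℕ) : ℕ := if e = b then c else e

theorem axMap_of_ne {b c e : ℕ} (h : e ≠ b) : axMap b c e = e := if_neg h
@[simp] theorem axMap_self (b c : ℕ) : axMap b c b = c := if_pos rfl

/-- The edge `b` does not occur in the boxes. -/
theorem WF.rename_box (ht : t = .cut a b ∨ t = .cut b a) (h : WF (x :: t :: Γ)) {B : List Link}
    {i d : ℕ} (hl : .bang B i d ∈ Γ) :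
    (Link.bang B i d).rename (axMap b c) id = .bang B i (axMap b c d) := by
  have hT := h.tgt_nodup
  have hbt : .log b ∈ t.tgt := by simp [tgt_cut_of_or ht]
  have hb : .log b ∉ (Link.bang B i d).tgt := by
    intro hb
    have := h.eq_of_tgt (List.mem_cons_of_mem _ (List.mem_cons_of_mem _ hl))
      (List.mem_cons_of_mem _ (List.mem_cons_self ..)) hb hbt
    rcases ht with rfl | rfl <;> simp at this
  have hg := good_bang.1 (h.good _ (List.mem_cons_of_mem _ (List.mem_cons_of_mem _ hl)))
  simp only [Link.tgt, Multiset.mem_cons, not_or] at hb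
  have hbs : .log b ∉ src B := by
    intro hbs
    rcases hg.2.2.2.2.2 b hbs with rfl | h'
    · exact hb.1 rfl
    · exact hb.2 h'
  rw [Link.rename, rename_list_eq_self, axMap_of_ne]
  · rintro rfl
    exact hb.1 rfl
  · rintro y hy
    exact axMap_of_ne fun h' => hbs (h' ▸ hy)
  · rintro y hy
    exact axMap_of_ne fun h' => hb.2 (h' ▸ hy)

/-- A flow of the reduct extends to the net by giving the erased edges `a` and `b` the value at `c`:
the segment `b`, `a`, `c` has been contracted to one edge. -/
theorem wf_ax {N : ℕ} (hx : x = .ax a c ∨ x = .ax c a) (ht : t = .cut a b ∨ t = .cut b a)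
    (h : WF (x :: t :: Γ)) :
    WF (rename (axMap b c) id Γ) ∧
      StepRel N (x :: t :: Γ) (rename (axMap b c) id Γ) (fun s => [s]) := by
  have hbc := h.ne_of_ax hx ht
  have hs := h.src_nodup
  have hT := h.tgt_nodup
  simp only [src_cons, tgt_cons, src_ax_of_or hx, src_cut_of_or ht, tgt_ax_of_or hx,
    tgt_cut_of_or ht, zero_add] at hs hT
  have hc : .log c ∉ src Γ ∧ .log a ∉ src Γ ∧ a ≠ c := by
    simp at hs
    tauto
  have hb : .log a ∉ tgt Γ ∧ .log b ∉ tgt Γ ∧ a ≠ b := by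
    simp at hT
    tauto
  have hmap : ∀ e, e ≠ .log b → Edge.map (axMap b c) id e = e := by
    rintro (e | e) he
    · simp [axMap_of_ne (fun h' => he (congrArg Edge.log h'))]
    · rfl
  have hθ : ∀ X : Multiset Edge, X.bind (spread fun s => [s]) = X := fun X =>
    bind_spread_src (by simp)
  have hbX : ∀ X, src (x :: t :: Γ) = tgt (x :: t :: Γ) + X → .log b ∉ X := by
    intro X hX hb
    exact ((mem_out h.src_nodup hX).1 hb).2 (mem_tgt.2 ⟨t, by simp, by simp [tgt_cut_of_or ht]⟩)
  have hout : ∀ X, src (x :: t :: Γ) = tgt (x :: t :: Γ) + X →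
      src (rename (axMap b c) id Γ) = tgt (rename (axMap b c) id Γ) + X := by
    intro X hX
    have hXm : X.map (Edge.map (axMap b c) id) = X := by
      conv_rhs => rw [← Multiset.map_id X]
      exact Multiset.map_congr rfl fun e he => hmap e fun h' => hbX X hX (h' ▸ he)
    simp only [src_cons, tgt_cons, src_ax_of_or hx, src_cut_of_or ht, tgt_ax_of_or hx,
      tgt_cut_of_or ht, zero_add] at hX
    have h' := congrArg (Multiset.map (Edge.map (axMap b c) id)) hX
    simp only [Multiset.insert_eq_cons, Multiset.map_add, Multiset.map_cons,
      Multiset.map_singleton, hXm, Edge.map_log, axMap_self,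
      axMap_of_ne hb.2.2, axMap_of_ne hbc.symm] at h'
    rw [src_rename, tgt_rename]
    rw [add_assoc] at h'
    exact Multiset.add_right_inj.1 h'
  have hnd : (src (rename (axMap b c) id Γ)).Nodup := by
    rw [src_rename]
    -- The map is not injective, but it identifies `b` with `c` only, and `c` does not come from
    -- `Γ`, its source being the erased axiom.
    refine Multiset.Nodup.map_on ?_ (Multiset.nodup_add.1 hs).2.1
    intro e he e' he' hee
    by_cases h₁ : e = .log b <;> by_cases h₂ : e' = .log b
    · rw [h₁, h₂]
    · rw [hmap e' h₂, h₁] at hee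
      simp only [Edge.map_log, axMap_self] at hee
      exact absurd (hee ▸ he') hc.1
    · rw [hmap e h₁, h₂] at hee
      simp only [Edge.map_log, axMap_self] at hee
      exact absurd (hee ▸ he) hc.1
    · rwa [hmap e h₁, hmap e' h₂] at hee
  obtain ⟨X, hX⟩ := h.exists_out
  refine ⟨WF.mk' hnd (hout X hX) ?_ ?_, ?_, fun X hX => (hθ X).symm ▸ hout X hX, by simp⟩
  · intro χ hχ hχc
    let ψ : Edge → ZMod 2 := fun e =>
      if e = .log a then χ (.log c) else χ (Edge.map (axMap b c) id e)
    have hψ : ∀ e, e ≠ .log a → ψ e = χ (Edge.map (axMap b c) id e) := fun e he => if_neg he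
    have hψa : ψ (.log a) = χ (.log c) := if_pos rfl
    have hψb : ψ (.log b) = χ (.log c) := by
      rw [hψ _ (by simpa using hb.2.2.symm)]; simp
    have hψc : ψ (.log c) = χ (.log c) := by
      rw [hψ _ (by simpa using hc.2.2.symm), hmap _ (by simpa using hbc.symm)]
    have e2 : ∀ z : ZMod 2, z + z = 0 := CharTwo.add_self_eq_zero
    have hΓ : Flow Γ ψ := hχ.of_rename.congr
      (fun e he => hψ e fun h' => hc.2.1 (h' ▸ he)) (fun e he => hψ e fun h' => hb.1 (h' ▸ he))
    have hf : Flow (x :: t :: Γ) ψ := by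
      refine (hΓ.cons ?_ ?_ ?_).cons ?_ ?_ ?_
      · simp [flux, src_cut_of_or ht, tgt_cut_of_or ht, hψa, hψb, e2]
      · rcases ht with rfl | rfl <;> simp
      · rcases ht with rfl | rfl <;> simp
      · simp [flux, src_ax_of_or hx, tgt_ax_of_or hx, hψa, hψc, e2]
      · rcases hx with rfl | rfl <;> simp
      · rcases hx with rfl | rfl <;> simp
    have h0 := h.correct ψ hf ?_
    · intro l hl e he
      rw [rename_eq_map] at hl
      obtain ⟨l, hlΓ, rfl⟩ := List.mem_map.1 hl
      rw [Link.prem_rename] at he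
      obtain ⟨e, hel, rfl⟩ := List.mem_map.1 he
      rw [← hψ]
      · exact h0 l (by simp [hlΓ]) e hel
      · rintro rfl
        exact hb.1 (mem_tgt.2 ⟨l, hlΓ, l.prem_subset_tgt hel⟩)
    · intro e he he'
      have heX := (mem_out h.src_nodup hX).2 ⟨he, he'⟩
      have hea : e ≠ .log a := by
        rintro rfl
        exact he' (mem_tgt.2 ⟨t, by simp, by simp [tgt_cut_of_or ht]⟩)
      rw [hψ e hea, hmap e fun h' => hbX X hX (h' ▸ heX)]
      have := (mem_out hnd (hout X hX)).1 heX
      exact hχc e this.1 this.2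
  · intro l hl
    rw [rename_eq_map] at hl
    obtain ⟨l, hlΓ, rfl⟩ := List.mem_map.1 hl
    have hg := h.good l (by simp [hlΓ])
    by_cases hlb : ∃ B' i' c', l = .bang B' i' c'
    · obtain ⟨B', i', c', rfl⟩ := hlb
      rw [h.rename_box ht hlΓ]
      exact good_bang.2 (good_bang.1 hg)
    · push Not at hlb
      refine good_of_not_bang ?_
      cases l <;> simp_all [Link.rename]
  · intro e he
    left
    rw [src_rename] at he
    obtain ⟨y, hy, rfl⟩ := Multiset.mem_map.1 he
    simp only [src_cons, src_ax_of_or hx, src_cut_of_or ht, zero_add, Multiset.mem_add]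
    by_cases hyb : y = .log b
    · subst hyb
      simp
    · rw [hmap y hyb]
      exact .inr hy

end ax

-- The `1/⊥` and `⊗/⅋` steps

section multiplicative

variable {t : Link} {a₁ a₂ a b₁ b₂ b : ℕ} {Γ : List Link}

/-- The three erased links form a component of their own, on which a flow is extended by zero. -/
theorem wf_oneBot {N : ℕ} (ht : t = .cut a b ∨ t = .cut b a)
    (h : WF (.one a :: .bot b :: t :: Γ)) :
    WF Γ ∧ StepRel N (.one a :: .bot b :: t :: Γ) Γ (fun s => [s]) := by
  have hs := h.src_nodup
  have hT := h.tgt_nodup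
  simp only [src_cons, tgt_cons, src_cut_of_or ht, tgt_cut_of_or ht, zero_add,
    Link.src_one, Link.src_bot, Link.tgt] at hs hT
  have hθ : ∀ X : Multiset Edge, X.bind (spread fun s => [s]) = X := fun X =>
    bind_spread_src (by simp)
  have hout : ∀ X, src (.one a :: .bot b :: t :: Γ) = tgt (.one a :: .bot b :: t :: Γ) + X →
      src Γ = tgt Γ + X := by
    intro X hX
    simp only [src_cons, tgt_cons, src_cut_of_or ht, tgt_cut_of_or ht, zero_add,
      Link.src_one, Link.src_bot, Link.tgt] at hX
    ext y
    have := congrArg (Multiset.count y) hX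
    simp only [Multiset.insert_eq_cons, ← Multiset.singleton_add, Multiset.count_add] at this ⊢
    omega
  have hnd : (src Γ).Nodup := (Multiset.nodup_add.1 (Multiset.nodup_add.1 hs).2.1).2.1
  have ha : .log a ∉ src Γ ∧ .log b ∉ src Γ := by
    simp at hs
    tauto
  have hb : .log a ∉ tgt Γ ∧ .log b ∉ tgt Γ := by
    simp at hT
    tauto
  obtain ⟨X, hX⟩ := h.exists_out
  refine ⟨WF.mk' hnd (hout X hX) ?_ fun l hl => h.good l (by simp [hl]), ?_,
    fun X hX => (hθ X).symm ▸ hout X hX, by simp⟩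
  · intro χ hχ hc
    let ψ : Edge → ZMod 2 := fun e => if e = .log a ∨ e = .log b then 0 else χ e
    have hψs : ∀ e ∈ src Γ, ψ e = χ e := fun e he => if_neg (by
      rintro (rfl | rfl)
      · exact ha.1 he
      · exact ha.2 he)
    have hψt : ∀ e ∈ tgt Γ, ψ e = χ e := fun e he => if_neg (by
      rintro (rfl | rfl)
      · exact hb.1 he
      · exact hb.2 he)
    have hf : Flow (.one a :: .bot b :: t :: Γ) ψ := by
      refine (((hχ.congr hψs hψt).cons ?_ ?_ ?_).cons ?_ ?_ ?_).cons ?_ ?_ ?_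
      · simp [flux, src_cut_of_or ht, tgt_cut_of_or ht, ψ]
      · rcases ht with rfl | rfl <;> simp
      · rcases ht with rfl | rfl <;> simp
      all_goals simp [flux, ψ]
    have h0 := h.correct ψ hf ?_
    · intro l hl e he
      rw [← hψt e (mem_tgt.2 ⟨l, hl, l.prem_subset_tgt he⟩)]
      exact h0 l (by simp [hl]) e he
    · intro e he he'
      have heX := (mem_out h.src_nodup hX).2 ⟨he, he'⟩
      have := (mem_out hnd (hout X hX)).1 heX
      simp only [ψ]
      split_ifs
      · rfl
      · exact hc e this.1 this.2
  · intro e he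
    exact .inl (by simp [he])

/-- A flow of the reduct has equal values at `a₁`, `b₁` and at `a₂`, `b₂`. If it does not use both
premises of the `⅋`, it extends to the old net, with the common sum at `a` and `b`. If it uses both,
a path inside `Γ` starting from `a₁` is isolated: it ends in one of the three other premises, and
closes up to a forbidden cycle of the old net. -/
theorem wf_tensorPar {N : ℕ} (ht : t = .cut a b ∨ t = .cut b a)
    (h : WF (.tensor a₁ a₂ a :: .par b₁ b₂ b :: t :: Γ)) :
    WF (.cut a₁ b₁ :: .cut a₂ b₂ :: Γ) ∧
      StepRel N (.tensor a₁ a₂ a :: .par b₁ b₂ b :: t :: Γ) (.cut a₁ b₁ :: .cut a₂ b₂ :: Γ)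
        (fun s => [s]) := by
  have hs := h.src_nodup
  have hT := h.tgt_nodup
  simp only [src_cons, tgt_cons, src_cut_of_or ht, tgt_cut_of_or ht, zero_add,
    Link.src_tensor, Link.src_par, Link.tgt] at hs hT
  have hθ : ∀ X : Multiset Edge, X.bind (spread fun s => [s]) = X := fun X =>
    bind_spread_src (by simp)
  have hout' : ∀ X, src (.tensor a₁ a₂ a :: .par b₁ b₂ b :: t :: Γ) =
      tgt (.tensor a₁ a₂ a :: .par b₁ b₂ b :: t :: Γ) + X →
      src Γ = {.log a₁, .log b₁, .log a₂, .log b₂} + tgt Γ + X := by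
    intro X hX
    simp only [src_cons, tgt_cons, src_cut_of_or ht, tgt_cut_of_or ht, zero_add,
      Link.src_tensor, Link.src_par, Link.tgt] at hX
    ext y
    have := congrArg (Multiset.count y) hX
    simp only [Multiset.insert_eq_cons, ← Multiset.singleton_add, Multiset.count_add] at this ⊢
    omega
  have hout : ∀ X, src (.tensor a₁ a₂ a :: .par b₁ b₂ b :: t :: Γ) =
      tgt (.tensor a₁ a₂ a :: .par b₁ b₂ b :: t :: Γ) + X →
      src (.cut a₁ b₁ :: .cut a₂ b₂ :: Γ) = tgt (.cut a₁ b₁ :: .cut a₂ b₂ :: Γ) + X := by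
    intro X hX
    simp only [src_cons, Link.src_cut, zero_add, hout' X hX, tgt_cons, Link.tgt]
    ext y
    simp only [Multiset.insert_eq_cons, ← Multiset.singleton_add, Multiset.count_add]
    omega
  have hndΓ : (src Γ).Nodup := (Multiset.nodup_add.1 (Multiset.nodup_add.1 hs).2.1).2.1
  have hnd : (src (.cut a₁ b₁ :: .cut a₂ b₂ :: Γ)).Nodup := by simpa using hndΓ
  have ha : .log a ∉ src Γ ∧ .log b ∉ src Γ ∧ a ≠ b := by
    simp at hs
    tauto
  have hb : .log a ∉ tgt Γ ∧ .log b ∉ tgt Γ ∧ (tgt Γ).Nodup ∧ a₁ ≠ a₂ ∧ b₁ ≠ b₂ ∧ a₁ ≠ b₁ ∧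
      a₁ ≠ b₂ ∧ a₂ ≠ b₁ ∧ a₂ ≠ b₂ ∧ .log a₁ ∉ tgt Γ ∧ a₁ ≠ a ∧ a₁ ≠ b ∧ a₂ ≠ a ∧ a₂ ≠ b ∧
      b₁ ≠ a ∧ b₁ ≠ b ∧ b₂ ≠ a ∧ b₂ ≠ b := by
    simp at hT
    tauto
  obtain ⟨-, -, htΓ, n1, n2, n3, n4, n5, n6, hat, -⟩ := id hb
  have e2 : ∀ z : ZMod 2, z + z = 0 := CharTwo.add_self_eq_zero
  obtain ⟨X, hX⟩ := h.exists_out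
  have hXΓ := hout' X hX
  -- a flow of the rest that is balanced on the two sides of the cut extends to the net
  have ext : ∀ χ : Edge → ZMod 2, Flow Γ χ → χ (.log b₁) * χ (.log b₂) = 0 →
      χ (.log a₁) + χ (.log a₂) = χ (.log b₁) + χ (.log b₂) → (∀ e ∈ X, χ e = 0) →
      ∀ l, l = .tensor a₁ a₂ a ∨ l ∈ Γ → ∀ e ∈ l.prem, χ e = 0 := by
    intro χ hχ hp hab hc l hl e he
    let ψ : Edge → ZMod 2 := fun e =>
      if e = .log a ∨ e = .log b then χ (.log a₁) + χ (.log a₂) else χ e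
    have hψa : ψ (.log a) = χ (.log a₁) + χ (.log a₂) := if_pos (.inl rfl)
    have hψb : ψ (.log b) = χ (.log a₁) + χ (.log a₂) := if_pos (.inr rfl)
    have hψ : ∀ e, e ≠ .log a → e ≠ .log b → ψ e = χ e := fun e h₁ h₂ => if_neg (by tauto)
    have hψl : ∀ x, x ≠ a → x ≠ b → ψ (.log x) = χ (.log x) := fun x h₁ h₂ =>
      hψ _ (by simpa using h₁) (by simpa using h₂)
    obtain ⟨b1, b2, -, -, -, -, -, -, -, -, b3, b4, b5, b6, b7, b8, b9, b10⟩ := hb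
    have hf : Flow (.tensor a₁ a₂ a :: .par b₁ b₂ b :: t :: Γ) ψ := by
      refine (((hχ.congr ?_ ?_).cons ?_ ?_ ?_).cons ?_ ?_ ?_).cons ?_ ?_ ?_
      · exact fun e he => hψ e (fun h' => ha.1 (h' ▸ he)) (fun h' => ha.2.1 (h' ▸ he))
      · exact fun e he => hψ e (fun h' => b1 (h' ▸ he)) (fun h' => b2 (h' ▸ he))
      · simp [flux, src_cut_of_or ht, tgt_cut_of_or ht, hψa, hψb, e2]
      · rcases ht with rfl | rfl <;> simp
      · rcases ht with rfl | rfl <;> simp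
      · simp [flux, hψb, hψl b₁ b7 b8, hψl b₂ b9 b10, hab, e2]
      · rintro _ _ _ ⟨⟩
        rw [hψl b₁ b7 b8, hψl b₂ b9 b10, hp]
      · simp
      · simp [flux, hψa, hψl a₁ b3 b4, hψl a₂ b5 b6, e2]
      · simp
      · simp
    have h0 := h.correct ψ hf ?_
    · rcases hl with rfl | hl
      · have := h0 _ (List.mem_cons_self ..) e he
        simp only [Link.prem, List.mem_cons, List.not_mem_nil, or_false] at he
        rcases he with rfl | rfl
        · rwa [hψl a₁ b3 b4] at this
        · rwa [hψl a₂ b5 b6] at this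
      · have := h0 l (by simp [hl]) e he
        rwa [hψ e] at this
        · rintro rfl
          exact b1 (mem_tgt.2 ⟨l, hl, l.prem_subset_tgt he⟩)
        · rintro rfl
          exact b2 (mem_tgt.2 ⟨l, hl, l.prem_subset_tgt he⟩)
    · intro e he he'
      have heX := (mem_out h.src_nodup hX).2 ⟨he, he'⟩
      rw [hψ e]
      · exact hc e heX
      · rintro rfl
        exact he' (mem_tgt.2 ⟨t, by simp, by simp [tgt_cut_of_or ht]⟩)
      · rintro rfl
        exact he' (mem_tgt.2 ⟨t, by simp, by simp [tgt_cut_of_or ht]⟩)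
  refine ⟨WF.mk' hnd (hout X hX) ?_ ?_, ?_, fun X hX => (hθ X).symm ▸ hout X hX, by simp⟩
  · intro χ hχ hc
    have hc' : ∀ e ∈ X, χ e = 0 := fun e he => by
      have := (mem_out hnd (hout X hX)).1 he
      exact hc e this.1 this.2
    have h1 : χ (.log a₁) = χ (.log b₁) := by
      have := hχ.flux _ (List.mem_cons_self ..)
      simp only [flux, Link.src_cut, Link.tgt] at this
      simp at this
      exact CharTwo.add_eq_zero.1 this
    have h2 : χ (.log a₂) = χ (.log b₂) := by
      have := hχ.tail.flux _ (List.mem_cons_self ..)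
      simp only [flux, Link.src_cut, Link.tgt] at this
      simp at this
      exact CharTwo.add_eq_zero.1 this
    -- This is the condition of a flow at the erased `⅋`, which the two new cuts do not impose.
    have hp : χ (.log b₁) * χ (.log b₂) = 0 := by
      by_contra hne
      have hb1 : χ (.log a₁) = 1 := by
        rw [h1]
        exact (zmod2_cases _).resolve_left fun h0 => hne (by rw [h0, zero_mul])
      have hopen : IsOpen Γ (.log a₁) := .inl ⟨by rw [hXΓ]; simp, hat⟩
      obtain ⟨ψ, v, hψ, hle, hva, hv, hψa, hψv, hψ0⟩ :=
        exists_path_flow hndΓ htΓ hχ.tail.tail.flux hopen hb1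
      have hψΓ : Flow Γ ψ := by
        have hm : ∀ e e', χ e * χ e' = 0 → ψ e * ψ e' = 0 := by
          intro e e' hee
          rcases mul_eq_zero.1 hee with h' | h'
          · rw [hle e h', zero_mul]
          · rw [hle e' h', mul_zero]
        exact ⟨hψ, fun a b c hl => hm _ _ (hχ.tail.tail.par a b c hl),
          fun ss c hl => (hχ.tail.tail.why ss c hl).imp fun {s t} h' => hm _ _ h'⟩
      have hvX : v ∉ X := by
        intro hvX
        rw [hle v (hc' v hvX)] at hψv
        exact absurd hψv (by decide)
      -- The open edges of `Γ` are the premises of the two erased links and the out-edges of the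
      -- net; the flow vanishes on the latter.
      have hv4 : v = .log b₁ ∨ v = .log a₂ ∨ v = .log b₂ := by
        rcases hv with ⟨hv1, hv2⟩ | ⟨hv1, hv2⟩
        · rw [hXΓ] at hv1
          simp only [Multiset.insert_eq_cons, Multiset.mem_add, Multiset.mem_cons,
            Multiset.mem_singleton] at hv1
          rcases hv1 with ((h' | h' | h' | h') | h') | h'
          · exact absurd h' hva
          · exact .inl h'
          · exact .inr (.inl h')
          · exact .inr (.inr h')
          · exact absurd h' hv2
          · exact absurd h' hvX
        · exact absurd (by rw [hXΓ]; simp [hv2]) hv1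
      have hz : ∀ y, y ∈ ({.log b₁, .log a₂, .log b₂} : Multiset Edge) → y ≠ v → ψ y = 0 := by
        intro y hy hyv
        refine hψ0 y ?_ hyv ?_
        · rintro rfl
          simp only [Multiset.insert_eq_cons, Multiset.mem_cons, Multiset.mem_singleton,
            Edge.log.injEq] at hy
          rcases hy with h' | h' | h'
          · exact n3 h'
          · exact n1 h'
          · exact n4 h'
        · rintro ⟨-, hy'⟩
          have := Multiset.nodup_add.1 (hXΓ ▸ hndΓ)
          have := (Multiset.nodup_add.1 this.1).2.2
          refine Multiset.disjoint_left.1 this ?_ hy'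
          simp only [Multiset.insert_eq_cons, Multiset.mem_cons, Multiset.mem_singleton] at hy ⊢
          exact .inr hy
      have hne1 : (Edge.log b₁ ≠ Edge.log a₂) ∧ (Edge.log b₁ ≠ Edge.log b₂) ∧
          (Edge.log a₂ ≠ Edge.log b₂) := by
        simpa using ⟨n5.symm, n2, n6⟩
      -- A path ending in `a₂` closes up at the `⊗`; one ending in `b₁` or `b₂` closes up through
      -- `⊗`, cut and `⅋`. In either case at most one premise of the `⅋` is used, yet the value at
      -- `a₁` is one.
      have := ext ψ hψΓ ?_ ?_ (fun e he => hle e (hc' e he)) _ (.inl rfl) (.log a₁)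
        (by simp [Link.prem])
      · rw [hψa] at this
        exact absurd this (by decide)
      · rcases hv4 with rfl | rfl | rfl
        · rw [hz (.log b₂) (by simp) hne1.2.1.symm, mul_zero]
        · rw [hz (.log b₂) (by simp) hne1.2.2.symm, mul_zero]
        · rw [hz (.log b₁) (by simp) hne1.2.1, zero_mul]
      · rcases hv4 with rfl | rfl | rfl
        · rw [hz (.log b₂) (by simp) hne1.2.1.symm, hz (.log a₂) (by simp) hne1.1.symm, hψa, hψv]
        · rw [hz (.log b₂) (by simp) hne1.2.2.symm, hz (.log b₁) (by simp) hne1.1, hψa, hψv]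
          decide
        · rw [hz (.log b₁) (by simp) hne1.2.1, hz (.log a₂) (by simp) hne1.2.2, hψa, hψv]
          decide
    have h0 := ext χ hχ.tail.tail hp (by rw [h1, h2]) hc'
    intro l hl e he
    rcases List.mem_cons.1 hl with rfl | hl
    · simp only [Link.prem, List.mem_cons, List.not_mem_nil, or_false] at he
      have := h0 _ (.inl rfl) (.log a₁) (by simp [Link.prem])
      rcases he with rfl | rfl
      · exact this
      · rw [← h1, this]
    rcases List.mem_cons.1 hl with rfl | hl
    · simp only [Link.prem, List.mem_cons, List.not_mem_nil, or_false] at he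
      have := h0 _ (.inl rfl) (.log a₂) (by simp [Link.prem])
      rcases he with rfl | rfl
      · exact this
      · rw [← h2, this]
    · exact h0 l (.inr hl) e he
  · intro l hl
    rcases List.mem_cons.1 hl with rfl | hl
    · simp [Link.Good]
    rcases List.mem_cons.1 hl with rfl | hl
    · simp [Link.Good]
    · exact h.good l (by simp [hl])
  · intro e he
    exact .inl (by simpa using Or.inr (Or.inr (Or.inr (by simpa using he))))

end multiplicative

theorem sum_map_eq_of_mem {m : Multiset Edge} (hm : m.Nodup) {χ : Edge → ZMod 2} {p : Edge}
    (hp : p ∈ m) (h : ∀ e ∈ m, e ≠ p → χ e = 0) : (m.map χ).sum = χ p := by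
  obtain ⟨m, rfl⟩ := Multiset.exists_cons_of_mem hp
  rw [Multiset.map_cons, Multiset.sum_cons, Multiset.sum_eq_zero, add_zero]
  intro x hx
  obtain ⟨e, he, rfl⟩ := Multiset.mem_map.1 hx
  exact h e (Multiset.mem_cons_of_mem he) fun h' => (Multiset.nodup_cons.1 hm).1 (h' ▸ he)

theorem sum_map_eq_of_mem₂ {m : Multiset Edge} (hm : m.Nodup) {χ : Edge → ZMod 2} {p q : Edge}
    (hp : p ∈ m) (hq : q ∈ m) (hpq : q ≠ p) (h : ∀ e ∈ m, e ≠ p → e ≠ q → χ e = 0) :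
    (m.map χ).sum = χ p + χ q := by
  obtain ⟨m, rfl⟩ := Multiset.exists_cons_of_mem hp
  rw [Multiset.map_cons, Multiset.sum_cons, sum_map_eq_of_mem (Multiset.nodup_cons.1 hm).2
    ((Multiset.mem_cons.1 hq).resolve_left hpq)]
  exact fun e he heq => h e (Multiset.mem_cons_of_mem he)
    (fun h' => (Multiset.nodup_cons.1 hm).1 (h' ▸ he)) heq

theorem map_idxOf_eq_range {ss : List ℕ} (h : ss.Nodup) :
    ss.map ss.idxOf = List.range ss.length := by
  refine List.ext_getElem (by simp) fun n h₁ h₂ => ?_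
  simp [h.idxOf_getElem]

theorem Link.exists_why {l : Link} {s : ℕ} (h : .str s ∈ l.prem) : ∃ ss c, l = .why ss c := by
  cases l <;> simp_all [Link.prem]

theorem bang_mem_map_expand {θ : ℕ → List ℕ} {L B : List Link} {i c : ℕ} :
    .bang B i c ∈ L.map (Link.expand θ) ↔ .bang B i c ∈ L := by
  rw [List.mem_map]
  constructor
  · rintro ⟨l, hl, h⟩
    cases l <;> simp_all [Link.expand]
  · exact fun h => ⟨_, h, rfl⟩

-- The `!/?` step

section bangWhy

variable {N : ℕ} {B Γ : List Link} {t : Link} {i a b : ℕ} {ss : List ℕ} {Y : Multiset Edge}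

theorem auxCopies_of_notMem {k s : ℕ} (h : .str s ∉ src B) : auxCopies N B k s = [s] := by
  rw [auxCopies, if_neg]
  exact fun h' => h (sources_subset_src (List.mem_filter.1 h').1)

/-- Indexes the copies by the premises of the `?`-link instead of their ranks, which is the form
that matches `graftBy`. -/
theorem auxCopies_of_mem (hB : WF B) (hY : src B = tgt B + (.log i ::ₘ Y)) (hss : ss.Nodup)
    {s : ℕ} (h : .str s ∈ Y) :
    auxCopies N B ss.length s = ss.map fun s' => s + offset N ss s' := by
  rw [auxCopies, if_pos, ← map_idxOf_eq_range hss, List.map_map]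
  · rfl
  · exact (mem_conclusions hB).2 ((mem_out hB.src_nodup hY).1 (Multiset.mem_cons_of_mem h))

theorem spread_auxCopies_of_mem (hB : WF B) (hY : src B = tgt B + (.log i ::ₘ Y))
    (hYl : ∀ x, .log x ∉ Y) (hss : ss.Nodup) {e : Edge} (h : e ∈ Y) :
    spread (auxCopies N B ss.length) e = (ss.map fun s => e.shift (offset N ss s) : List Edge) := by
  cases e with
  | log x => exact absurd h (hYl x)
  | str s =>
    rw [spread, auxCopies_of_mem hB hY hss h, List.map_map]
    rfl

/-- All but one of these facts are bookkeeping on repetition-free multisets. The exception is that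
no premise of the `?`-link comes from the box cut against it, which would have to be put inside
itself: this is excluded by correctness. -/
theorem WF.bangWhy_facts (ht : t = .cut a b ∨ t = .cut b a)
    (h : WF (.bang B i a :: .why ss b :: t :: Γ)) (hY : src B = tgt B + (.log i ::ₘ Y)) :
    ss.Nodup ∧ (∀ s ∈ ss, .str s ∉ src B) ∧ (∀ s ∈ ss, .str s ∈ src Γ) ∧
      (∀ s ∈ ss, .str s ∉ tgt Γ) ∧ .log a ∉ src Γ ∧ .log b ∉ src Γ ∧ .log a ∉ tgt Γ ∧
      .log b ∉ tgt Γ ∧ Disjoint (src B) (src Γ) ∧ a ≠ b ∧ .log a ∉ src B ∧ .log b ∉ src B := by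
  have hs := h.src_nodup
  have hT := h.tgt_nodup
  simp only [src_cons, tgt_cons, src_cut_of_or ht, tgt_cut_of_or ht, zero_add,
    Link.src_bang, Link.src_why, Link.tgt] at hs hT
  have hB := h.box (List.mem_cons_self ..)
  have hssn : ss.Nodup := by
    have := (Multiset.nodup_add.1 (Multiset.nodup_add.1 hT).2.1).1
    rw [Multiset.coe_nodup] at this
    exact this.of_map
  have h1 : .log a ∉ src Γ ∧ .log b ∉ src Γ ∧ Disjoint (src B) (src Γ) ∧ a ≠ b ∧
      .log a ∉ src B ∧ .log b ∉ src B := by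
    simp [Multiset.nodup_add] at hs
    tauto
  have h2 : .log a ∉ tgt Γ ∧ .log b ∉ tgt Γ := by
    simp [Multiset.nodup_add] at hT
    tauto
  have h3 : ∀ s ∈ ss, .str s ∉ tgt Γ := by
    intro s hs' h'
    have hd := (Multiset.nodup_add.1 (Multiset.nodup_add.1 hT).2.1).2.2
    exact absurd (by simp [h']) (Multiset.disjoint_left.1 hd
      (by simpa using hs' : Edge.str s ∈ ((ss.map .str : List Edge) : Multiset Edge)))
  have h4 : ∀ s ∈ ss, .str s ∉ tgt B := by
    intro s hs' h'
    exact absurd (by simp [hs']) (Multiset.disjoint_left.1 (Multiset.nodup_add.1 hT).2.2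
      (Multiset.mem_cons_of_mem h'))
  have h5 : ∀ s ∈ ss, .str s ∉ src B := by
    intro s hss hsB
    have hsY : .str s ∈ Y := by
      have := (mem_out hB.src_nodup hY).2 ⟨hsB, h4 s hss⟩
      simpa using this
    have hsΓ : .str s ∉ src Γ := Multiset.disjoint_left.1 h1.2.2.1 hsB
    -- The cycle that leaves the box by `a`, passes through the cut to the `?`-link by `b`, and
    -- returns to the box by `s`.
    let χ : Edge → ZMod 2 := fun e => if e = .log a ∨ e = .log b ∨ e = .str s then 1 else 0
    have hχ0 : ∀ e, e ≠ .log a → e ≠ .log b → e ≠ .str s → χ e = 0 := fun e _ _ _ =>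
      if_neg (by tauto)
    have hΓ : Flow Γ χ := by
      refine Flow.congr (χ := 0) ⟨?_, ?_, ?_⟩ ?_ ?_
      · intro l _
        simp [flux]
      · simp
      · intro ss c _
        exact List.pairwise_of_forall (by simp)
      · refine fun e he => hχ0 e ?_ ?_ ?_ <;> rintro rfl
        · exact h1.1 he
        · exact h1.2.1 he
        · exact hsΓ he
      · refine fun e he => hχ0 e ?_ ?_ ?_ <;> rintro rfl
        · exact h2.1 he
        · exact h2.2 he
        · exact h3 s hss he
    have hYn : (Edge.log i ::ₘ Y).Nodup := (Multiset.nodup_add.1 (hY ▸ hB.src_nodup)).2.1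
    have hYs : ∀ e, e ∈ Edge.log i ::ₘ Y → e ∈ src B := fun e he => by
      rw [hY]
      exact Multiset.mem_add.2 (.inr he)
    have hia : χ (.log i) = 0 := by
      have hi := hYs _ (Multiset.mem_cons_self ..)
      refine hχ0 _ ?_ ?_ (by simp) <;> intro h'
      · exact h1.2.2.2.2.1 (h' ▸ hi)
      · exact h1.2.2.2.2.2 (h' ▸ hi)
    have hf : Flow (.bang B i a :: .why ss b :: t :: Γ) χ := by
      refine ((hΓ.cons ?_ ?_ ?_).cons ?_ ?_ ?_).cons ?_ ?_ ?_
      · simp [flux, src_cut_of_or ht, tgt_cut_of_or ht, χ]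
        decide
      · rcases ht with rfl | rfl <;> simp
      · rcases ht with rfl | rfl <;> simp
      · have hsn : ((ss.map Edge.str : List Edge) : Multiset Edge).Nodup := by
          rw [Multiset.coe_nodup]
          exact hssn.map (fun _ _ => by simp)
        rw [flux, Link.src_why, Link.tgt, sum_map_eq_of_mem hsn (p := .str s) (by simpa using hss)]
        · simp [χ]
          decide
        · intro e he hes
          refine hχ0 e ?_ ?_ hes <;> rintro rfl <;> simp at he
      · simp
      · rintro ss' c ⟨⟩
        refine hssn.imp_of_mem fun {s₁ s₂} hs₁ hs₂ hne => ?_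
        by_cases e₁ : s₁ = s
        · rw [hχ0 (.str s₂) (by simp) (by simp) (by simpa using fun h' => hne (e₁.trans h'.symm)),
            mul_zero]
        · rw [hχ0 (.str s₁) (by simp) (by simp) (by simpa using e₁), zero_mul]
      · rw [flux_bang hY, Multiset.map_cons, Multiset.sum_cons, hia,
          sum_map_eq_of_mem (Multiset.nodup_cons.1 hYn).2 hsY]
        · simp [χ]
          decide
        · intro e he hes
          have := hYs e (Multiset.mem_cons_of_mem he)
          refine hχ0 e ?_ ?_ hes <;> rintro rfl
          · exact h1.2.2.2.2.1 this
          · exact h1.2.2.2.2.2 this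
      · simp
      · simp
    have := h.correct χ hf ?_ t (by simp) (.log a) (prem_cut_of_or ht)
    · simp [χ] at this
    · intro e _ he
      refine hχ0 e ?_ ?_ ?_ <;> rintro rfl <;> apply he
      · simp [tgt_cut_of_or ht]
      · simp [tgt_cut_of_or ht]
      · simp [hss]
  refine ⟨hssn, h5, ?_, h3, h1.1, h1.2.1, h2.1, h2.2, h1.2.2.1, h1.2.2.2⟩
  intro s hs'
  have := h.subset (a := Edge.str s) (by simp [hs'])
  simp only [src_cons, Link.src_bang, Link.src_why, src_cut_of_or ht, Multiset.mem_add,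
    Multiset.mem_cons, Multiset.mem_singleton, reduceCtorEq, false_or, Multiset.notMem_zero] at this
  exact this.resolve_left (h5 s hs')

theorem bangWhy_out (ht : t = .cut a b ∨ t = .cut b a) (hY : src B = tgt B + (.log i ::ₘ Y))
    {X : Multiset Edge} (hX : src (.bang B i a :: .why ss b :: t :: Γ) =
      tgt (.bang B i a :: .why ss b :: t :: Γ) + X) :
    Y + src Γ = ((ss.map .str : List Edge) : Multiset Edge) + tgt Γ + X := by
  simp only [src_cons, tgt_cons, src_cut_of_or ht, tgt_cut_of_or ht, zero_add,
    Link.src_bang, Link.src_why, Link.tgt, hY] at hX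
  ext y
  have := congrArg (Multiset.count y) hX
  simp only [Multiset.insert_eq_cons, ← Multiset.singleton_add, Multiset.count_add] at this ⊢
  omega

/-- A flow of the reduct is pulled back in two stages, first by contracting the copies, then by
merging the copies of each auxiliary line. The result is a flow of `Γ`; paths in `Γ` that return to
the erased box or to the erased `?`-link close up to cycles of the old net, so it vanishes on the
lines of the box. From this its vanishing on each single copy is recovered. -/
theorem wf_bangWhy (ht : t = .cut a b ∨ t = .cut b a)
    (h : WF (.bang B i a :: .why ss b :: t :: Γ))
    (hN : ∀ e ∈ src (.bang B i a :: .why ss b :: t :: Γ), e.name < N) :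
    WF (graft (boxCopy N B i ss) (Γ.map (Link.expand (auxCopies N B ss.length)))) ∧
      StepRel N (.bang B i a :: .why ss b :: t :: Γ)
        (graft (boxCopy N B i ss) (Γ.map (Link.expand (auxCopies N B ss.length))))
        (auxCopies N B ss.length) := by
  have hB := h.box (List.mem_cons_self ..)
  obtain ⟨Y, hY, hYl⟩ := exists_out_box hB (h.good _ (List.mem_cons_self ..))
  obtain ⟨hss, hsB, hsΓ, hsT, haΓ, hbΓ, haT, hbT, hdis, hab, haB, hbB⟩ := h.bangWhy_facts ht hY
  have hΓg : ∀ l ∈ Γ, l.Good := fun l hl => h.good l (by simp [hl])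
  have hndL := h.src_nodup
  have hndT := h.tgt_nodup
  have hndΓ : (src Γ).Nodup := by
    simp only [src_cons, Multiset.nodup_add] at hndL
    exact hndL.2.1.2.1.2.1
  have htΓn : (tgt Γ).Nodup := by
    simp only [tgt_cons, Multiset.nodup_add] at hndT
    exact hndT.2.1.2.1.2.1
  have hBN : ∀ e ∈ src B, e.name < N := fun e he => hN e (by simp [he])
  have hΓN : ∀ e ∈ src Γ, e.name < N := fun e he => hN e (by simp [he])
  have hYB : ∀ e ∈ Y, e ∈ src B := fun e he => by
    rw [hY]
    simp [he]
  have hYn : Y.Nodup :=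
    (Multiset.nodup_cons.1 (Multiset.nodup_add.1 (hY ▸ hB.src_nodup)).2.1).2
  set θ := auxCopies N B ss.length with hθdef
  have hθ : ∀ s, .str s ∉ src B → θ s = [s] := fun s hs => auxCopies_of_notMem hs
  have hθΓ : ∀ s, .str s ∈ src Γ → θ s = [s] := fun s hs =>
    hθ s fun h' => Multiset.disjoint_left.1 hdis h' hs
  have hθY : ∀ e ∈ Y, spread θ e = (ss.map fun s => e.shift (offset N ss s) : List Edge) :=
    fun e he => spread_auxCopies_of_mem hB hY hYl hss he
  have htΓ' := tgt_expand hΓg hθΓ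
  -- the images of the edges are not among the premises of the erased link
  have hnotss : ∀ e, (∀ s ∈ ss, e ≠ .str s) → ∀ y ∈ spread θ e, ∀ s ∈ ss, y ≠ .str s := by
    intro e he y hy s hs hys
    subst hys
    cases e with
    | log x => simp at hy
    | str x =>
      by_cases hx : .str x ∈ Y
      · rw [hθY _ hx] at hy
        simp only [Multiset.mem_coe, List.mem_map] at hy
        obtain ⟨s', hs', hy⟩ := hy
        have h₁ := congrArg Edge.name hy
        have h₂ := hΓN _ (hsΓ s hs)
        have h₃ := le_offset (N := N) (ss := ss) s'
        rw [Edge.name_shift] at h₁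
        change x + offset N ss s' = s at h₁
        change s < N at h₂
        omega
      · have : θ x = [x] := by
          rw [hθdef, auxCopies, if_neg]
          intro h'
          have := (mem_out hB.src_nodup hY).2 ((mem_conclusions hB).1 h')
          exact hx (by simpa using this)
        rw [spread_of_eq this, Multiset.mem_singleton] at hy
        exact he s hs hy.symm
  have hL : ∀ s ∈ ss, .str s ∉ tgt (Γ.map (Link.expand θ)) := by
    intro s hs h'
    rw [htΓ'] at h'
    obtain ⟨e, he, hy⟩ := Multiset.mem_bind.1 h'
    exact hnotss e (fun s' hs' h' => hsT s' hs' (h' ▸ he)) _ hy s hs rfl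
  have hss'n : ((ss.map .str : List Edge) : Multiset Edge).Nodup := by
    rw [Multiset.coe_nodup]
    exact hss.map fun _ _ => by simp
  have hss'Γ : ((ss.map .str : List Edge) : Multiset Edge) ≤ src Γ := by
    refine (Multiset.le_iff_subset hss'n).2 fun e he => ?_
    simp only [Multiset.mem_coe, List.mem_map] at he
    obtain ⟨s, hs, rfl⟩ := he
    exact hsΓ s hs
  obtain ⟨R, hR⟩ := Multiset.le_iff_exists_add.1 hss'Γ
  have hRss : ∀ s ∈ ss, .str s ∉ R := by
    intro s hs hsR
    exact Multiset.disjoint_left.1 (Multiset.nodup_add.1 (hR ▸ hndΓ)).2.2 (by simpa using hs) hsR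
  -- The same copies of structural conclusions, listed copy by copy on the left and conclusion by
  -- conclusion on the right.
  have hYR : ((ss.map .str : List Edge) : Multiset Edge).bind (graftBy N ss Y) =
      Y.bind (spread θ) := by
    have h₁ : Y.bind (spread θ) = Y.bind fun e =>
        (ss : Multiset ℕ).map fun s => e.shift (offset N ss s) :=
      Multiset.bind_congr fun e he => by rw [hθY e he]; simp
    rw [h₁, Multiset.bind_map_comm, ← Multiset.map_coe, Multiset.bind_map]
    exact Multiset.bind_congr fun s hs => graftBy_of_mem hs
  have hout : ∀ X, src (.bang B i a :: .why ss b :: t :: Γ) =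
      tgt (.bang B i a :: .why ss b :: t :: Γ) + X →
      src (graft (boxCopy N B i ss) (Γ.map (Link.expand θ))) =
        tgt (graft (boxCopy N B i ss) (Γ.map (Link.expand θ))) + X.bind (spread θ) := by
    intro X hX
    have h₀ := bangWhy_out ht hY hX
    have h₁ : Y + R = tgt Γ + X := by
      rw [hR] at h₀
      ext y
      have := congrArg (Multiset.count y) h₀
      simp only [Multiset.count_add] at this ⊢
      omega
    have h₂ := congrArg (Multiset.bind · (spread θ)) h₁
    simp only [Multiset.add_bind] at h₂
    rw [bind_spread_src (m := R) fun s hs => hθΓ s (by rw [hR]; simp [hs])] at h₂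
    have h₃ : (src Γ).bind (graftBy N ss Y) = (tgt Γ).bind (spread θ) + X.bind (spread θ) := by
      rw [hR, Multiset.add_bind, hYR, bind_graftBy hRss, h₂]
    have h₄ : (src Γ).bind (graftBy N ss (src B)) =
        (src Γ).bind (graftTgt N B i ss) + (src Γ).bind (graftBy N ss Y) := by
      rw [← Multiset.bind_add]
      exact Multiset.bind_congr fun e _ => graftBy_src_eq hY e
    rw [src_graft, tgt_graft, src_expand, htΓ', h₄, h₃]
    abel
  have hnd : (src (graft (boxCopy N B i ss) (Γ.map (Link.expand θ)))).Nodup := by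
    rw [src_graft, src_expand]
    exact nodup_bind_graftBy hBN hB.src_nodup hΓN hndΓ
  obtain ⟨X, hX⟩ := h.exists_out
  have hXout := bangWhy_out ht hY hX
  have hXmem : ∀ e ∈ X, e ∉ tgt (.bang B i a :: .why ss b :: t :: Γ) := fun e he =>
    ((mem_out h.src_nodup hX).1 he).2
  -- `z` is the value given to both premises of the erased cut; the hypotheses are evenness at the
  -- box and at the `?`-link.
  have ext : ∀ (ψ : Edge → ZMod 2) (z : ZMod 2), Flow Γ ψ → z + (Y.map ψ).sum = 0 →
      z + (((ss.map .str : List Edge) : Multiset Edge).map ψ).sum = 0 →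
      (ss.Pairwise fun s s' => ψ (.str s) * ψ (.str s') = 0) → (∀ e ∈ X, ψ e = 0) →
      ∀ l ∈ Γ, ∀ e ∈ l.prem, ψ e = 0 := by
    intro ψ z hψ hzY hzs hp hψX l hl e he
    let φ : Edge → ZMod 2 := fun e => if e = .log a ∨ e = .log b then z else ψ e
    have hφa : φ (.log a) = z := if_pos (.inl rfl)
    have hφb : φ (.log b) = z := if_pos (.inr rfl)
    have hφ : ∀ e, e ≠ .log a → e ≠ .log b → φ e = ψ e := fun e h₁ h₂ => if_neg (by tauto)
    have hφs : ∀ s, φ (.str s) = ψ (.str s) := fun s => hφ _ (by simp) (by simp)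
    have hφB : ∀ e ∈ src B, φ e = ψ e := fun e he =>
      hφ e (fun h' => haB (h' ▸ he)) (fun h' => hbB (h' ▸ he))
    have e2 : ∀ z : ZMod 2, z + z = 0 := CharTwo.add_self_eq_zero
    have hf : Flow (.bang B i a :: .why ss b :: t :: Γ) φ := by
      refine (((hψ.congr ?_ ?_).cons ?_ ?_ ?_).cons ?_ ?_ ?_).cons ?_ ?_ ?_
      · exact fun e he => hφ e (fun h' => haΓ (h' ▸ he)) (fun h' => hbΓ (h' ▸ he))
      · exact fun e he => hφ e (fun h' => haT (h' ▸ he)) (fun h' => hbT (h' ▸ he))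
      · simp [flux, src_cut_of_or ht, tgt_cut_of_or ht, hφa, hφb, e2]
      · rcases ht with rfl | rfl <;> simp
      · rcases ht with rfl | rfl <;> simp
      · rw [flux, Link.src_why, Link.tgt, Multiset.map_singleton, Multiset.sum_singleton, hφb,
          ← hzs]
        congr 2
        refine Multiset.map_congr rfl fun e he => ?_
        simp only [Multiset.mem_coe, List.mem_map] at he
        obtain ⟨s, -, rfl⟩ := he
        exact hφs s
      · simp
      · rintro ss' c ⟨⟩
        exact hp.imp fun {s s'} h' => by rw [hφs, hφs, h']
      · rw [flux_bang hY, Multiset.map_cons, Multiset.sum_cons, hφa,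
          Multiset.map_congr rfl fun e he => hφB e (hYB e he)]
        linear_combination hzY + e2 (φ (.log i))
      · simp
      · simp
    have h0 := h.correct φ hf ?_ l (by simp [hl]) e he
    · rwa [hφ e] at h0
      · rintro rfl
        exact haT (mem_tgt.2 ⟨l, hl, l.prem_subset_tgt he⟩)
      · rintro rfl
        exact hbT (mem_tgt.2 ⟨l, hl, l.prem_subset_tgt he⟩)
    · intro e he he'
      have heX := (mem_out h.src_nodup hX).2 ⟨he, he'⟩
      rw [hφ e]
      · exact hψX e heX
      · rintro rfl
        exact he' (by simp [tgt_cut_of_or ht])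
      · rintro rfl
        exact he' (by simp [tgt_cut_of_or ht])
  refine ⟨WF.mk' hnd (hout X hX) ?_ ?_, ?_, hout, ?_⟩
  · intro χ hχ hc
    set χ₁ := pull (graftBy N ss Y) χ with hχ₁
    have hf₁ : Flow (Γ.map (Link.expand θ)) χ₁ := hχ.of_graft hY hL
    have hf₂ : Flow Γ (pull (spread θ) χ₁) := hf₁.of_expand hΓg hθΓ
    have hX0 : ∀ e ∈ X, ∀ y ∈ spread θ e, χ y = 0 := by
      intro e he y hy
      have := (mem_out hnd (hout X hX)).1 (Multiset.mem_bind.2 ⟨e, he, hy⟩)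
      exact hc y this.1 this.2
    have hχχ₁ : ∀ y, (∀ s ∈ ss, y ≠ .str s) → χ₁ y = χ y := by
      intro y hy
      cases y with
      | log x => simp [hχ₁, pull]
      | str x =>
        have : x ∉ ss := fun h' => hy x h' rfl
        simp [hχ₁, pull, graftBy_of_notMem this]
    have hYss : ∀ e ∈ Y, ∀ s ∈ ss, e ≠ .str s := fun e he s hs h' => hsB s hs (h' ▸ hYB e he)
    have hX2 : ∀ e ∈ X, pull (spread θ) χ₁ e = 0 := by
      intro e he
      refine Multiset.sum_eq_zero fun x hx => ?_
      obtain ⟨y, hy, rfl⟩ := Multiset.mem_map.1 hx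
      rw [hχχ₁ y, hX0 e he y hy]
      refine hnotss e (fun s hs h' => ?_) y hy
      exact hXmem e he (by simp [h', hs])
    -- A line of the box cannot be consumed in another box, since a box consumes only what it
    -- produces.
    have hYcases : ∀ e ∈ Y, e ∉ X → ∃ l ∈ Γ, e ∈ l.prem := by
      intro e he heX
      have heΓ : e ∈ tgt Γ := by
        have : e ∈ Y + src Γ := Multiset.mem_add.2 (.inl he)
        rw [hXout] at this
        simp only [Multiset.mem_add, Multiset.mem_coe, List.mem_map] at this
        rcases this with (⟨s, hs, h'⟩ | h') | h'
        · exact absurd h'.symm (hYss e he s hs)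
        · exact h'
        · exact absurd h' heX
      obtain ⟨l, hl, hel⟩ := mem_tgt.1 heΓ
      refine ⟨l, hl, ?_⟩
      by_cases hlb : ∃ B' i' c', l = .bang B' i' c'
      · obtain ⟨B', i', c', rfl⟩ := hlb
        have := tgt_bang_subset h (by simp [hl]) hel
        exact absurd (mem_src.2 ⟨_, hl, by simp [this]⟩)
          (Multiset.disjoint_left.1 hdis (hYB e he))
      · push Not at hlb
        rwa [Link.tgt_eq_prem hlb] at hel
    -- The sum of `χ` over all the copies of `e`. If it were one, a path in `Γ` would start from
    -- `e`.
    have hY0 : ∀ e ∈ Y, pull (spread θ) χ₁ e = 0 := by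
      intro e he
      by_contra hne
      have he1 := (zmod2_cases _).resolve_left hne
      have heX : e ∉ X := fun h' => hne (hX2 e h')
      obtain ⟨l, hl, hel⟩ := hYcases e he heX
      have heΓ : e ∉ src Γ := Multiset.disjoint_left.1 hdis (hYB e he)
      obtain ⟨ψ, v, hψ, hle, hve, hv, hψe, hψv, hψ0⟩ := exists_path_flow hndΓ htΓn hf₂.flux
        (.inr ⟨heΓ, mem_tgt.2 ⟨l, hl, l.prem_subset_tgt hel⟩⟩) he1
      have hm : ∀ e e', pull (spread θ) χ₁ e * pull (spread θ) χ₁ e' = 0 → ψ e * ψ e' = 0 := by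
        intro e e' hee
        rcases mul_eq_zero.1 hee with h' | h'
        · rw [hle e h', zero_mul]
        · rw [hle e' h', mul_zero]
      have hψΓ : Flow Γ ψ :=
        ⟨hψ, fun a b c hl => hm _ _ (hf₂.par a b c hl),
          fun ss c hl => (hf₂.why ss c hl).imp fun {s t} h' => hm _ _ h'⟩
      have hvX : v ∉ X := by
        intro hvX
        rw [hle v (hX2 v hvX)] at hψv
        exact absurd hψv (by decide)
      have hψs : ∀ s ∈ ss, .str s ≠ v → ψ (.str s) = 0 := fun s hs hsv =>
        hψ0 _ (fun h' => hYss e he s hs h'.symm) hsv fun h' => hsT s hs h'.2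
      have hψY : ∀ y ∈ Y, y ≠ e → y ≠ v → ψ y = 0 := fun y hy hye hyv =>
        hψ0 _ hye hyv fun h' => Multiset.disjoint_left.1 hdis (hYB y hy) h'.1
      have hpw : ss.Pairwise fun s s' => ψ (.str s) * ψ (.str s') = 0 := by
        refine hss.imp_of_mem fun {s s'} hs hs' hne => ?_
        by_cases hsv : .str s = v
        · rw [hψs s' hs' (by rw [← hsv]; simpa using hne.symm), mul_zero]
        · rw [hψs s hs hsv, zero_mul]
      have hcontra : ∀ z : ZMod 2, z + (Y.map ψ).sum = 0 →
          z + (((ss.map .str : List Edge) : Multiset Edge).map ψ).sum = 0 → False := by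
        intro z h₁ h₂
        have := ext ψ z hψΓ h₁ h₂ hpw (fun e he => hle e (hX2 e he)) l hl e hel
        rw [hψe] at this
        exact absurd this (by decide)
      -- The path ends in a premise of the `?`-link, and the cycle closes through `?`, cut and box
      -- (`z = 1`); or it ends in another line of the box and closes there (`z = 0`).
      rcases hv with ⟨hv1, hv2⟩ | ⟨hv1, hv2⟩
      · have hvs : v ∈ ((ss.map .str : List Edge) : Multiset Edge) := by
          have : v ∈ Y + src Γ := Multiset.mem_add.2 (.inr hv1)
          rw [hXout] at this
          simp only [Multiset.mem_add] at this
          tauto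
        refine hcontra 1 ?_ ?_
        · rw [sum_map_eq_of_mem hYn he, hψe]
          · decide
          · refine fun y hy hye => hψY y hy hye ?_
            rintro rfl
            exact Multiset.disjoint_left.1 hdis (hYB _ hy) hv1
        · rw [sum_map_eq_of_mem hss'n hvs, hψv]
          · decide
          · intro y hy hyv
            simp only [Multiset.mem_coe, List.mem_map] at hy
            obtain ⟨s, hs, rfl⟩ := hy
            exact hψs s hs hyv
      · have hvY : v ∈ Y := by
          have : v ∈ Y + src Γ := by
            rw [hXout]
            simp [hv2]
          exact (Multiset.mem_add.1 this).resolve_right hv1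
        refine hcontra 0 ?_ ?_
        · rw [sum_map_eq_of_mem₂ hYn he hvY hve hψY, hψe, hψv]
          decide
        · rw [zero_add]
          refine Multiset.sum_eq_zero fun x hx => ?_
          obtain ⟨y, hy, rfl⟩ := Multiset.mem_map.1 hx
          simp only [Multiset.mem_coe, List.mem_map] at hy
          obtain ⟨s, hs, rfl⟩ := hy
          exact hψs s hs fun h' => hYss v hvY s hs h'.symm
    -- Either `e` is an out-edge, and so are its copies; or all its copies are premises of one
    -- `?`-link, at most one of which is non-zero, so that their vanishing sum forces each to
    -- vanish.
    have hcopy : ∀ s ∈ ss, ∀ e ∈ Y, χ (e.shift (offset N ss s)) = 0 := by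
      intro s hs e he
      have hmem : e.shift (offset N ss s) ∈ spread θ e := by
        rw [hθY e he]
        simp only [Multiset.mem_coe, List.mem_map]
        exact ⟨s, hs, rfl⟩
      by_cases heX : e ∈ X
      · exact hX0 e heX _ hmem
      · obtain ⟨l, hl, hel⟩ := hYcases e he heX
        rw [← hχχ₁ _ (hnotss e (hYss e he) _ hmem)]
        cases e with
        | log x => exact absurd he (hYl x)
        | str x =>
          obtain ⟨ss', c, rfl⟩ := Link.exists_why hel
          have hpw := hf₁.why _ c (List.mem_map_of_mem (f := Link.expand θ) hl)
          rw [List.pairwise_flatMap] at hpw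
          have hx : x ∈ ss' := by simpa [Link.prem] using hel
          have hsum := hY0 _ he
          rw [pull_spread_str] at hsum
          simp only [spread, Multiset.mem_coe, List.mem_map] at hmem
          obtain ⟨y, hy, hy'⟩ := hmem
          rw [← hy']
          exact eq_zero_of_sum_eq_zero (f := fun y => χ₁ (.str y)) (hpw.1 x hx) hsum y hy
    have hs0 : ∀ s ∈ ss, pull (spread θ) χ₁ (.str s) = 0 := by
      intro s hs
      rw [pull_spread_str, hθ s (hsB s hs)]
      simp only [List.map_cons, List.map_nil, List.sum_cons, List.sum_nil, add_zero]
      rw [hχ₁, pull, graftBy_of_mem hs, Multiset.map_map]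
      refine Multiset.sum_eq_zero fun x hx => ?_
      obtain ⟨y, hy, rfl⟩ := Multiset.mem_map.1 hx
      exact hcopy s hs y hy
    have h0 := ext (pull (spread θ) χ₁) 0 hf₂ ?_ ?_ ?_ hX2
    · refine hχ.prem_graft hB hY hL ?_ fun a s _ hs e he => hcopy s hs e he
      intro l hl e he
      obtain ⟨l, hlΓ, rfl⟩ := List.mem_map.1 hl
      refine hf₁.prem_expand hlΓ (h0 l hlΓ) ?_ e he
      rintro s ⟨a, rfl⟩
      exact hθΓ s (mem_src.2 ⟨_, hlΓ, by simp⟩)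
    · rw [zero_add]
      refine Multiset.sum_eq_zero fun x hx => ?_
      obtain ⟨y, hy, rfl⟩ := Multiset.mem_map.1 hx
      exact hY0 y hy
    · rw [zero_add]
      refine Multiset.sum_eq_zero fun x hx => ?_
      obtain ⟨y, hy, rfl⟩ := Multiset.mem_map.1 hx
      simp only [Multiset.mem_coe, List.mem_map] at hy
      obtain ⟨s, hs, rfl⟩ := hy
      exact hs0 s hs
    · refine hss.imp_of_mem fun {s s'} hs hs' _ => ?_
      rw [hs0 s hs, zero_mul]
  · refine graft_good hB.good hY hYl (fun l hl => ?_) ?_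
    · obtain ⟨l, hlΓ, rfl⟩ := List.mem_map.1 hl
      exact (hΓg l hlΓ).expand θ
    · intro B' i' c' hl
      have hlΓ := bang_mem_map_expand.1 hl
      have hB' := h.box (B := B') (i := i') (c := c') (by simp [hlΓ])
      have hs' : ∀ s ∈ ss, .str s ∉ tgt B' := fun s hs h' =>
        hsT s hs (mem_tgt.2 ⟨_, hlΓ, by simp [h']⟩)
      exact ⟨hB', hs', wf_graft_box hB hBN hY hYl hB'
        (fun e he => hΓN e (mem_src.2 ⟨_, hlΓ, by simp [he]⟩)) hs'⟩
  · intro y hy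
    rw [src_graft, src_expand] at hy
    obtain ⟨e, he, hy⟩ := Multiset.mem_bind.1 hy
    rcases lt_name_of_mem_graftBy (hΓN e he) hy with ⟨rfl, -⟩ | ⟨s, hs, rfl, x, hx, rfl⟩
    · exact .inl (by simp [he])
    · right
      rw [Edge.name_shift]
      have := le_offset (N := N) (ss := ss) s
      omega
  · intro s hs
    exact hθ s fun h' => hs (by simp [h'])

end bangWhy

/-- Cut elimination preserves well-formedness. -/
theorem wf_step {N : ℕ} {L L' : List Link} {θ : ℕ → List ℕ} (hst : CutStep N L L' θ) (h : WF L)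
    (hN : ∀ e ∈ src L, e.name < N) : WF L' ∧ StepRel N L L' θ := by
  induction hst with
  | ax hx ht hL =>
    obtain ⟨h₁, h₂⟩ := wf_ax (N := N) hx ht (h.perm hL)
    exact ⟨h₁, h₂.perm hL⟩
  | tensorPar ht hL =>
    obtain ⟨h₁, h₂⟩ := wf_tensorPar (N := N) ht (h.perm hL)
    exact ⟨h₁, h₂.perm hL⟩
  | oneBot ht hL =>
    obtain ⟨h₁, h₂⟩ := wf_oneBot (N := N) ht (h.perm hL)
    exact ⟨h₁, h₂.perm hL⟩
  | bangWhy ht hL =>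
    obtain ⟨h₁, h₂⟩ := wf_bangWhy ht (h.perm hL) (src_perm hL ▸ hN)
    exact ⟨h₁, h₂.perm hL⟩
  | box hL _ ih =>
    have h' := h.perm hL
    have hN' := hN
    rw [src_perm hL] at hN'
    obtain ⟨h₁, h₂⟩ := ih (h'.box (List.mem_cons_self ..)) fun e he => hN' e (by simp [he])
    obtain ⟨h₃, h₄⟩ := wf_box h' hN' h₁ h₂
    exact ⟨h₃, h₄.perm hL⟩

/-! ## Experiments of which only the labels and the size are recorded -/

/-- The data of an experiment: the points of the logical edges, the multisets of points of the
structural edges, and the size. -/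
structure Pt (A : Type u) : Type u where
  lab : ℕ → D A
  str : ℕ → Multiset (D A)
  size : ℕ

section Ex

variable {A : Type u}

mutual
/-- `l.Ex st v U W n`: the link `l` satisfies the conditions on experiments with respect to the
labels `v` of the logical edges and `U` of the structural premises; `W` collects the points of its
`♭`-links (of all depths), and `n` is its size.  If `st` is `false`, then the `?`-links with
premises may perform additional weakenings. -/
def Link.Ex (st : Bool) : Link → (ℕ → D A) → (ℕ → Multiset (D A)) → (ℕ → Multiset (D A)) → ℕ → Prop
  | .ax a b, v, _, W, n => v a = (v b).neg ∧ W = 0 ∧ n = 1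
  | .cut a b, v, _, W, n => v a = (v b).neg ∧ W = 0 ∧ n = 1
  | .tensor a b c, v, _, W, n => v c = D.pair true (v a) (v b) ∧ W = 0 ∧ n = 1
  | .par a b c, v, _, W, n => v c = D.pair false (v a) (v b) ∧ W = 0 ∧ n = 1
  | .one c, v, _, W, n => v c = D.atom true none ∧ W = 0 ∧ n = 1
  | .bot c, v, _, W, n => v c = D.atom false none ∧ W = 0 ∧ n = 1
  | .flat a s, v, _, W, n => W = Pi.single s {v a} ∧ n = 1
  | .why ss c, v, U, W, n => (∃ μ, v c = D.bag false μ ∧ (ss.map U).sum ≤ μ ∧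
      (st = true → ss ≠ [] → μ = (ss.map U).sum)) ∧ W = 0 ∧ n = 1
  | .bang B i c, v, _, W, n => ∃ fs : Multiset (Pt A), fs ≠ 0 ∧
      (∀ f ∈ fs, Ex st B f.lab f.str f.str f.size) ∧ v c = D.bag true (fs.map fun f => f.lab i) ∧
      W = (fs.map Pt.str).sum ∧ n = 1 + (fs.map Pt.size).sum
/-- The conjunction of the conditions `Link.Ex`. -/
def Ex (st : Bool) : List Link → (ℕ → D A) → (ℕ → Multiset (D A)) → (ℕ → Multiset (D A)) → ℕ → Prop
  | [], _, _, W, n => W = 0 ∧ n = 0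
  | l :: L, v, U, W, n => ∃ W₁ W₂ n₁ n₂, W = W₁ + W₂ ∧ n = n₁ + n₂ ∧
      l.Ex st v U W₁ n₁ ∧ Ex st L v U W₂ n₂
end

/-- `f` is an experiment of `B`. -/
def Pt.Of (st : Bool) (B : List Link) (f : Pt A) : Prop := Ex st B f.lab f.str f.str f.size

variable {st : Bool} {v v' : ℕ → D A} {U U' W : ℕ → Multiset (D A)} {n : ℕ}

theorem ex_bang {B : List Link} {i c : ℕ} : (Link.bang B i c).Ex st v U W n ↔
    ∃ fs : Multiset (Pt A), fs ≠ 0 ∧ (∀ f ∈ fs, f.Of st B) ∧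
      v c = D.bag true (fs.map fun f => f.lab i) ∧
      W = (fs.map Pt.str).sum ∧ n = 1 + (fs.map Pt.size).sum := by
  simp only [Link.Ex, Pt.Of]

theorem ex_nil : Ex st [] v U W n ↔ W = 0 ∧ n = 0 := by simp only [Ex]

theorem ex_cons {l : Link} {L : List Link} : Ex st (l :: L) v U W n ↔
    ∃ W₁ W₂ n₁ n₂, W = W₁ + W₂ ∧ n = n₁ + n₂ ∧ l.Ex st v U W₁ n₁ ∧ Ex st L v U W₂ n₂ := by
  simp only [Ex]

theorem ex_append {L L' : List Link} : Ex st (L ++ L') v U W n ↔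
    ∃ W₁ W₂ n₁ n₂, W = W₁ + W₂ ∧ n = n₁ + n₂ ∧ Ex st L v U W₁ n₁ ∧ Ex st L' v U W₂ n₂ := by
  induction L generalizing W n with
  | nil =>
    simp only [List.nil_append, ex_nil]
    constructor
    · exact fun h => ⟨0, W, 0, n, by simp, by simp, ⟨rfl, rfl⟩, h⟩
    · rintro ⟨_, _, _, _, rfl, rfl, ⟨rfl, rfl⟩, h⟩
      simpa using h
  | cons l L ih =>
    simp only [List.cons_append, ex_cons, ih]
    constructor
    · rintro ⟨W₁, _, n₁, _, rfl, rfl, h, W₂, W₃, n₂, n₃, rfl, rfl, h', h''⟩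
      exact ⟨W₁ + W₂, W₃, n₁ + n₂, n₃, by rw [add_assoc], by rw [add_assoc],
        ⟨W₁, W₂, n₁, n₂, rfl, rfl, h, h'⟩, h''⟩
    · rintro ⟨_, W₃, _, n₃, rfl, rfl, ⟨W₁, W₂, n₁, n₂, rfl, rfl, h, h'⟩, h''⟩
      exact ⟨W₁, W₂ + W₃, n₁, n₂ + n₃, by rw [add_assoc], by rw [add_assoc], h, W₂, W₃, n₂, n₃,
        rfl, rfl, h', h''⟩

theorem ex_perm {L L' : List Link} (h : L.Perm L') : Ex st L v U W n ↔ Ex st L' v U W n := by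
  have key : ∀ {L L' : List Link}, L.Perm L' → ∀ {W n}, Ex st L v U W n → Ex st L' v U W n := by
    intro L L' h
    induction h with
    | nil => exact id
    | cons l _ ih =>
      intro W n
      rw [ex_cons, ex_cons]
      rintro ⟨W₁, W₂, n₁, n₂, h₁, h₂, h₃, h₄⟩
      exact ⟨W₁, W₂, n₁, n₂, h₁, h₂, h₃, ih h₄⟩
    | swap l m L =>
      intro W n
      simp only [ex_cons]
      rintro ⟨W₁, _, n₁, _, rfl, rfl, h₁, W₂, W₃, n₂, n₃, rfl, rfl, h₂, h₃⟩
      exact ⟨W₂, W₁ + W₃, n₂, n₁ + n₃, by abel, by omega, h₂, W₁, W₃, n₁, n₃, rfl, rfl, h₁, h₃⟩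
    | trans _ _ h k => exact fun h' => k (h h')
  exact ⟨key h, key h.symm⟩

/-- The points of the `♭`-links add up along the list, so a transformation made link by link
transports experiments as soon as it acts additively on these points; renaming, translation and
expansion of `?`-links are of this kind. -/
theorem Ex.map (φ : (ℕ → Multiset (D A)) →+ (ℕ → Multiset (D A))) {k : Link → Link} {L : List Link}
    (hk : ∀ l ∈ L, ∀ W n, l.Ex st v U W n → (k l).Ex st v' U' (φ W) n) (h : Ex st L v U W n) :
    Ex st (L.map k) v' U' (φ W) n := by
  induction L generalizing W n with
  | nil =>
    rw [ex_nil] at h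
    obtain ⟨rfl, rfl⟩ := h
    exact ex_nil.2 ⟨map_zero φ, rfl⟩
  | cons l L ih =>
    rw [ex_cons] at h
    obtain ⟨W₁, W₂, n₁, n₂, rfl, rfl, h₃, h₄⟩ := h
    exact ex_cons.2 ⟨φ W₁, φ W₂, n₁, n₂, map_add φ _ _, rfl, hk l (by simp) _ _ h₃,
      ih (fun m hm => hk m (by simp [hm])) h₄⟩

theorem Ex.of_map (φ : (ℕ → Multiset (D A)) →+ (ℕ → Multiset (D A))) {k : Link → Link}
    {L : List Link} (hk : ∀ l ∈ L, ∀ W n, (k l).Ex st v U W n → l.Ex st v' U' (φ W) n)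
    (h : Ex st (L.map k) v U W n) : Ex st L v' U' (φ W) n := by
  induction L generalizing W n with
  | nil =>
    rw [List.map_nil, ex_nil] at h
    obtain ⟨rfl, rfl⟩ := h
    exact ex_nil.2 ⟨map_zero φ, rfl⟩
  | cons l L ih =>
    rw [List.map_cons, ex_cons] at h
    obtain ⟨W₁, W₂, n₁, n₂, rfl, rfl, h₃, h₄⟩ := h
    exact ex_cons.2 ⟨φ W₁, φ W₂, n₁, n₂, map_add φ _ _, rfl, hk l (by simp) _ _ h₃,
      ih (fun m hm => hk m (by simp [hm])) h₄⟩

theorem Link.Ex.congr {l : Link} (h : l.Ex st v U W n)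
    (hv : ∀ x, .log x ∈ l.src ∨ .log x ∈ l.tgt → v' x = v x)
    (hU : ∀ s, .str s ∈ l.tgt → U' s = U s) : l.Ex st v' U' W n := by
  cases l with
  | why ss c =>
    have : ss.map U' = ss.map U := List.map_congr_left fun s hs => hU s (by simp [hs])
    simp only [Link.Ex] at h ⊢
    rw [this, hv c (by simp)]
    exact h
  | bang B i c =>
    rw [ex_bang] at h ⊢
    rw [hv c (by simp)]
    exact h
  | _ =>
    simp only [Link.Ex] at h ⊢
    simp_all

theorem Ex.congr {L : List Link} (h : LLNet.Ex st L v U W n)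
    (hv : ∀ x, .log x ∈ src L ∨ .log x ∈ tgt L → v' x = v x)
    (hU : ∀ s, .str s ∈ tgt L → U' s = U s) : LLNet.Ex st L v' U' W n := by
  have := h.map (AddMonoidHom.id _) (k := id) (v' := v') (U' := U')
    fun l hl W n h' => h'.congr (fun x hx => hv x ?_) fun s hs => hU s (mem_tgt.2 ⟨l, hl, hs⟩)
  · simpa using this
  · exact hx.imp (fun h => mem_src.2 ⟨l, hl, h⟩) (fun h => mem_tgt.2 ⟨l, hl, h⟩)

-- The structural edges that receive points

theorem sum_str_apply (fs : Multiset (Pt A)) (s : ℕ) :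
    (fs.map Pt.str).sum s = (fs.map fun f => f.str s).sum := by
  induction fs using Multiset.induction_on with
  | empty => simp
  | cons f fs ih => simp [ih]

theorem Ex.eq_zero_of_forall {L : List Link} {s : ℕ}
    (hl : ∀ l ∈ L, ∀ {v : ℕ → D A} {U W n}, l.Ex st v U W n → .str s ∉ l.src → W s = 0)
    (h : LLNet.Ex st L v U W n) (hs : .str s ∉ src L) : W s = 0 := by
  induction L generalizing W n with
  | nil => rw [(ex_nil.1 h).1]; rfl
  | cons l L ih =>
    obtain ⟨W₁, W₂, n₁, n₂, rfl, rfl, h₁, h₂⟩ := ex_cons.1 h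
    simp only [src_cons, Multiset.mem_add, not_or] at hs
    rw [Pi.add_apply, hl l (by simp) h₁ hs.1, ih (fun m hm => hl m (by simp [hm])) h₂ hs.2, add_zero]

theorem Link.Ex.eq_zero {l : Link} {s : ℕ} (h : l.Ex st v U W n) (hs : .str s ∉ l.src) :
    W s = 0 := by
  revert h hs
  refine Link.ind (P := fun l => ∀ {v : ℕ → D A} {U W n}, l.Ex st v U W n → .str s ∉ l.src →
    W s = 0) ?_ ?_ l
  · intro B i c ih v U W n h hs
    obtain ⟨fs, -, hf, -, rfl, -⟩ := ex_bang.1 h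
    rw [sum_str_apply]
    refine Multiset.sum_eq_zero fun x hx => ?_
    obtain ⟨f, hfs, rfl⟩ := Multiset.mem_map.1 hx
    exact Ex.eq_zero_of_forall ih (hf f hfs) (by simpa using hs)
  · intro l hl v U W n h hs
    cases l with
    | bang B i c => exact absurd rfl (hl B i c)
    | flat a s' =>
      simp only [Link.Ex] at h
      rw [h.1, Pi.single_eq_of_ne]
      simpa using hs
    | _ =>
      simp only [Link.Ex] at h
      simp [h.2.1]

theorem Ex.eq_zero {L : List Link} {s : ℕ} (h : LLNet.Ex st L v U W n) (hs : .str s ∉ src L) :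
    W s = 0 :=
  Ex.eq_zero_of_forall (fun _ _ _ _ _ _ h' => h'.eq_zero) h hs

theorem Ex.ne_zero_of_forall {L : List Link} {s : ℕ}
    (hl : ∀ l ∈ L, ∀ {v : ℕ → D A} {U W n}, l.Ex st v U W n → .str s ∈ l.src → W s ≠ 0)
    (h : LLNet.Ex st L v U W n) (hs : .str s ∈ src L) : W s ≠ 0 := by
  induction L generalizing W n with
  | nil => simp at hs
  | cons l L ih =>
    obtain ⟨W₁, W₂, n₁, n₂, rfl, rfl, h₁, h₂⟩ := ex_cons.1 h
    simp only [src_cons, Multiset.mem_add] at hs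
    rw [Pi.add_apply]
    intro h0
    rw [add_eq_zero] at h0
    rcases hs with hs | hs
    · exact hl l (by simp) h₁ hs h0.1
    · exact ih (fun m hm => hl m (by simp [hm])) h₂ hs h0.2

/-- Each box has at least one experiment, so every `♭`-link, however deep, contributes a point. -/
theorem Link.Ex.ne_zero {l : Link} {s : ℕ} (h : l.Ex st v U W n) (hs : .str s ∈ l.src) :
    W s ≠ 0 := by
  revert h hs
  refine Link.ind (P := fun l => ∀ {v : ℕ → D A} {U W n}, l.Ex st v U W n → .str s ∈ l.src →
    W s ≠ 0) ?_ ?_ l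
  · intro B i c ih v U W n h hs
    obtain ⟨fs, h0, hf, -, rfl, -⟩ := ex_bang.1 h
    obtain ⟨f, hfs⟩ := Multiset.exists_mem_of_ne_zero h0
    rw [sum_str_apply]
    intro h'
    have := Multiset.sum_eq_zero_iff.1 h' _ (Multiset.mem_map_of_mem (fun f => f.str s) hfs)
    exact Ex.ne_zero_of_forall ih (hf f hfs) (by simpa using hs) this
  · intro l hl v U W n h hs
    cases l with
    | bang B i c => exact absurd rfl (hl B i c)
    | flat a s' =>
      simp only [Link.Ex] at h
      simp only [Link.src_flat, Multiset.mem_singleton, Edge.str.injEq] at hs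
      subst hs
      simp [h.1]
    | _ => simp at hs

/-- Every structural edge receives some point. -/
theorem Ex.ne_zero {L : List Link} {s : ℕ} (h : LLNet.Ex st L v U W n) (hs : .str s ∈ src L) :
    W s ≠ 0 :=
  Ex.ne_zero_of_forall (fun _ _ _ _ _ _ h' => h'.ne_zero) h hs

/-- Precomposition with a function. -/
def compHom (A : Type u) (g : ℕ → ℕ) : (ℕ → Multiset (D A)) →+ (ℕ → Multiset (D A)) where
  toFun W := W ∘ g
  map_zero' := rfl
  map_add' _ _ := rfl

theorem Link.Ex.of_rename {f g : ℕ → ℕ} (hg : g.Injective) {l : Link}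
    (h : (l.rename f g).Ex st v U W n) : l.Ex st (v ∘ f) (U ∘ g) (W ∘ g) n := by
  revert h
  refine Link.ind (P := fun l => ∀ {v : ℕ → D A} {U W n}, (l.rename f g).Ex st v U W n →
    l.Ex st (v ∘ f) (U ∘ g) (W ∘ g) n) ?_ ?_ l
  · intro B i c ih v U W n h
    rw [Link.rename] at h
    obtain ⟨fs, h0, hf, hc, rfl, rfl⟩ := ex_bang.1 h
    refine ex_bang.2 ⟨fs.map fun p => ⟨p.lab ∘ f, p.str ∘ g, p.size⟩, by simpa using h0, ?_, ?_, ?_, ?_⟩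
    · intro p hp
      obtain ⟨p, hp', rfl⟩ := Multiset.mem_map.1 hp
      have := hf p hp'
      rw [Pt.Of, rename_eq_map] at this
      exact this.of_map (compHom A g) fun l hl W n h' => ih l hl h'
    · simpa [Function.comp_def] using hc
    · funext s
      rw [Function.comp_apply, sum_str_apply, sum_str_apply, Multiset.map_map]
      rfl
    · rw [Multiset.map_map]
      rfl
  · intro l hl v U W n h
    cases l with
    | bang B i c => exact absurd rfl (hl B i c)
    | flat a s =>
      simp only [Link.rename, Link.Ex] at h ⊢
      refine ⟨?_, h.2⟩
      rw [h.1]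
      funext x
      simp [Pi.single_apply, hg.eq_iff]
    | why ss c =>
      simp only [Link.rename, Link.Ex, List.map_map] at h ⊢
      obtain ⟨⟨μ, h₁, h₂, h₃⟩, rfl, h₄⟩ := h
      exact ⟨⟨μ, h₁, h₂, fun h h' => h₃ h (by simpa using h')⟩, rfl, h₄⟩
    | _ =>
      simp only [Link.rename, Link.Ex] at h ⊢
      obtain ⟨h₁, rfl, h₂⟩ := h
      exact ⟨h₁, rfl, h₂⟩

theorem Ex.of_rename {f g : ℕ → ℕ} (hg : g.Injective) {L : List Link}
    (h : LLNet.Ex st (rename f g L) v U W n) : LLNet.Ex st L (v ∘ f) (U ∘ g) (W ∘ g) n := by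
  rw [rename_eq_map] at h
  exact h.of_map (compHom A g) fun l _ W n h' => h'.of_rename hg

/-- Translation by `K`. -/
def shiftHom (A : Type u) (K : ℕ) : (ℕ → Multiset (D A)) →+ (ℕ → Multiset (D A)) where
  toFun W y := if K ≤ y then W (y - K) else 0
  map_zero' := by funext y; simp
  map_add' W W' := by
    funext y
    simp only [Pi.add_apply]
    split_ifs <;> simp

theorem shiftHom_apply (K : ℕ) (W : ℕ → Multiset (D A)) (y : ℕ) :
    shiftHom A K W y = if K ≤ y then W (y - K) else 0 := rfl

/-- Inside boxes labels are moved by truncated subtraction of `K`. This does no harm, as the renamed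
links only use names `x + K`. -/
theorem Link.Ex.shift {K : ℕ} {l : Link} (h : l.Ex st (fun x => v (x + K)) (fun s => U (s + K)) W n) :
    (l.rename (· + K) (· + K)).Ex st v U (shiftHom A K W) n := by
  revert h
  refine Link.ind (P := fun l => ∀ {v : ℕ → D A} {U W n},
    l.Ex st (fun x => v (x + K)) (fun s => U (s + K)) W n →
    (l.rename (· + K) (· + K)).Ex st v U (shiftHom A K W) n) ?_ ?_ l
  · intro B i c ih v U W n h
    rw [Link.rename]
    obtain ⟨fs, h0, hf, hc, rfl, rfl⟩ := ex_bang.1 h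
    refine ex_bang.2 ⟨fs.map fun p => ⟨fun x => p.lab (x - K), shiftHom A K p.str, p.size⟩,
      by simpa using h0, ?_, ?_, ?_, ?_⟩
    · intro p hp
      obtain ⟨p, hp', rfl⟩ := Multiset.mem_map.1 hp
      rw [Pt.Of, rename_eq_map]
      refine Ex.map (v := p.lab) (U := p.str) (shiftHom A K) (fun l hl W n h' => ih l hl ?_) (hf p hp')
      simpa [shiftHom_apply] using h'
    · simpa [Function.comp_def] using hc
    · rw [map_multiset_sum, Multiset.map_map, Multiset.map_map]
      rfl
    · rw [Multiset.map_map]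
      rfl
  · intro l hl v U W n h
    cases l with
    | bang B i c => exact absurd rfl (hl B i c)
    | flat a s =>
      simp only [Link.rename, Link.Ex] at h ⊢
      refine ⟨?_, h.2⟩
      rw [h.1]
      funext x
      simp only [shiftHom_apply, Pi.single_apply]
      split_ifs <;> first | rfl | omega
    | why ss c =>
      simp only [Link.rename, Link.Ex, List.map_map] at h ⊢
      obtain ⟨⟨μ, h₁, h₂, h₃⟩, rfl, h₄⟩ := h
      exact ⟨⟨μ, h₁, h₂, fun h h' => h₃ h (by simpa using h')⟩, map_zero _, h₄⟩
    | _ =>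
      simp only [Link.rename, Link.Ex] at h ⊢
      obtain ⟨h₁, rfl, h₂⟩ := h
      exact ⟨h₁, map_zero _, h₂⟩

theorem Ex.shift {K : ℕ} {L : List Link}
    (h : LLNet.Ex st L (fun x => v (x + K)) (fun s => U (s + K)) W n) :
    LLNet.Ex st (rename (· + K) (· + K) L) v U (shiftHom A K W) n := by
  rw [rename_eq_map]
  exact h.map (shiftHom A K) fun l _ W n h' => h'.shift

end Ex

/-! ## Experiments and the dispatching of copies of a box -/

section Dispatch

variable {A : Type u} {st : Bool} {N : ℕ} {B : List Link} {i : ℕ} {ss : List ℕ}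

theorem exists_of_map_eq_add {α β : Type*} {g : α → β} {m : Multiset α} {p q : Multiset β}
    (h : m.map g = p + q) : ∃ m₁ m₂, m = m₁ + m₂ ∧ m₁.map g = p ∧ m₂.map g = q := by
  classical
  induction p using Multiset.induction_on generalizing m with
  | empty => exact ⟨0, m, by simp, rfl, by simpa using h⟩
  | cons b p ih =>
    rw [Multiset.cons_add] at h
    obtain ⟨a, ha, rfl, hm⟩ := (Multiset.map_eq_cons g m (p + q) b).2 h
    obtain ⟨m₁, m₂, h₁, rfl, rfl⟩ := ih hm
    exact ⟨a ::ₘ m₁, m₂, by rw [Multiset.cons_add, ← h₁, Multiset.cons_erase ha], by simp, rfl⟩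

/-- Restriction to the complement of `ss`. -/
def cutHom (A : Type u) (ss : List ℕ) : (ℕ → Multiset (D A)) →+ (ℕ → Multiset (D A)) where
  toFun W y := if y ∈ ss then 0 else W y
  map_zero' := by funext y; simp
  map_add' W W' := by
    funext y
    simp only [Pi.add_apply]
    split_ifs <;> simp

theorem cutHom_apply (W : ℕ → Multiset (D A)) (y : ℕ) :
    cutHom A ss W y = if y ∈ ss then 0 else W y := rfl

/-- Restriction to `ss`. -/
def keepHom (A : Type u) (ss : List ℕ) : (ℕ → Multiset (D A)) →+ (ℕ → Multiset (D A)) where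
  toFun W y := if y ∈ ss then W y else 0
  map_zero' := by funext y; simp
  map_add' W W' := by
    funext y
    simp only [Pi.add_apply]
    split_ifs <;> simp

theorem keepHom_apply (W : ℕ → Multiset (D A)) (y : ℕ) :
    keepHom A ss W y = if y ∈ ss then W y else 0 := rfl

/-- The points of the copies `F s` of the box. -/
def copiesHom (A : Type u) (N : ℕ) (ss : List ℕ) :
    (ℕ → Multiset (Pt A)) →+ (ℕ → Multiset (D A)) where
  toFun F := (ss.map fun s => ((F s).map fun f => shiftHom A (offset N ss s) f.str).sum).sum
  map_zero' := by simp
  map_add' F G := by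
    simp only [Pi.add_apply, Multiset.map_add, Multiset.sum_add]
    exact List.sum_map_add

theorem copiesHom_def (F : ℕ → Multiset (Pt A)) : copiesHom A N ss F =
    (ss.map fun s => ((F s).map fun f => shiftHom A (offset N ss s) f.str).sum).sum := rfl

/-- The size of the copies `F s` of the box. -/
def sizeHom (A : Type u) (ss : List ℕ) : (ℕ → Multiset (Pt A)) →+ ℕ where
  toFun F := (ss.map fun s => ((F s).map Pt.size).sum).sum
  map_zero' := by simp
  map_add' F G := by
    simp only [Pi.add_apply, Multiset.map_add, Multiset.sum_add]
    exact List.sum_map_add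

theorem sizeHom_def (F : ℕ → Multiset (Pt A)) :
    sizeHom A ss F = (ss.map fun s => ((F s).map Pt.size).sum).sum := rfl

/-- The points dual to those of the main conclusion `i` of the copies `F s`. -/
def mainHom (A : Type u) (i : ℕ) : (ℕ → Multiset (Pt A)) →+ (ℕ → Multiset (D A)) where
  toFun F s := (F s).map fun f => (f.lab i).neg
  map_zero' := by funext; simp
  map_add' F G := by funext; simp

theorem mainHom_apply (F : ℕ → Multiset (Pt A)) (s : ℕ) :
    mainHom A i F s = (F s).map fun f => (f.lab i).neg := rfl

theorem exists_add_of_mainHom {F : ℕ → Multiset (Pt A)} {V V' : ℕ → Multiset (D A)}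
    (h : mainHom A i F = V + V') :
    ∃ F₁ F₂, F = F₁ + F₂ ∧ mainHom A i F₁ = V ∧ mainHom A i F₂ = V' := by
  have := fun s => exists_of_map_eq_add (congrFun h s)
  choose F₁ F₂ h₁ h₂ h₃ using this
  exact ⟨F₁, F₂, funext h₁, funext h₂, funext h₃⟩

/-- When the target `♭`-links lie in a box with experiments `fs`, the copies `F` are shared out
between these experiments, each getting what its own points require. -/
theorem exists_sum_of_mainHom {F : ℕ → Multiset (Pt A)} {fs : Multiset (Pt A)}
    (h : mainHom A i F = keepHom A ss (fs.map Pt.str).sum) :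
    ∃ ps : Multiset (Pt A × (ℕ → Multiset (Pt A))), ps.map Prod.fst = fs ∧
      (ps.map Prod.snd).sum = F ∧ ∀ p ∈ ps, mainHom A i p.2 = keepHom A ss p.1.str := by
  induction fs using Multiset.induction_on generalizing F with
  | empty =>
    refine ⟨0, rfl, ?_, by simp⟩
    rw [Multiset.map_zero, Multiset.sum_zero]
    funext s
    have := congrFun h s
    simp only [Multiset.map_zero, Multiset.sum_zero, map_zero, mainHom_apply, Pi.zero_apply,
      Multiset.map_eq_zero] at this
    exact this.symm
  | cons f fs ih =>
    rw [Multiset.map_cons, Multiset.sum_cons, map_add] at h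
    obtain ⟨F₁, F₂, rfl, h₁, h₂⟩ := exists_add_of_mainHom h
    obtain ⟨ps, rfl, rfl, h₃⟩ := ih h₂
    refine ⟨(f, F₁) ::ₘ ps, by simp, by simp, ?_⟩
    intro p hp
    rcases Multiset.mem_cons.1 hp with rfl | hp
    · exact h₁
    · exact h₃ p hp

theorem mem_of_mem_sum {fs : Multiset (ℕ → Multiset (Pt A))} {s : ℕ} {f : Pt A} {F} (hF : F ∈ fs)
    (hf : f ∈ F s) : f ∈ fs.sum s := by
  obtain ⟨fs, rfl⟩ := Multiset.exists_cons_of_mem hF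
  simp [hf]

theorem sum_map_of_nodup {M : Type*} [AddCommMonoid M] {k : ℕ → M} {s : ℕ} (hs : s ∈ ss)
    (hss : ss.Nodup) (hk : ∀ s', s' ≠ s → s' ∈ ss → k s' = 0) : (ss.map k).sum = k s := by
  rw [List.sum_map_eq_nsmul_single s k hk, List.count_eq_one_of_mem hss hs, one_smul]

theorem copiesHom_single {s : ℕ} {f : Pt A} (hs : s ∈ ss) (hss : ss.Nodup) :
    copiesHom A N ss (Pi.single s {f}) = shiftHom A (offset N ss s) f.str := by
  rw [copiesHom_def, sum_map_of_nodup hs hss]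
  · simp
  · intro s' h _
    rw [Pi.single_eq_of_ne h]
    simp

theorem sizeHom_single {s : ℕ} {f : Pt A} (hs : s ∈ ss) (hss : ss.Nodup) :
    sizeHom A ss (Pi.single s {f}) = f.size := by
  rw [sizeHom_def, sum_map_of_nodup hs hss]
  · simp
  · intro s' h _
    rw [Pi.single_eq_of_ne h]
    simp

theorem copiesHom_apply (F : ℕ → Multiset (Pt A)) (y : ℕ) : copiesHom A N ss F y =
    (ss.map fun s => ((F s).map fun f => shiftHom A (offset N ss s) f.str y).sum).sum := by
  have e : ∀ m : Multiset (ℕ → Multiset (D A)), m.sum y = (m.map fun W => W y).sum := fun m =>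
    map_multiset_sum (Pi.evalAddMonoidHom (fun _ : ℕ => Multiset (D A)) y) m
  have e' : ∀ m : List (ℕ → Multiset (D A)), m.sum y = (m.map fun W => W y).sum := fun m =>
    map_list_sum (Pi.evalAddMonoidHom (fun _ : ℕ => Multiset (D A)) y) m
  rw [copiesHom_def, e', List.map_map]
  congr 1
  refine List.map_congr_left fun s _ => ?_
  rw [Function.comp_apply, e, Multiset.map_map]
  rfl

theorem copiesHom_of_lt {F : ℕ → Multiset (Pt A)} {y : ℕ} (hy : y < N) :
    copiesHom A N ss F y = 0 := by
  rw [copiesHom_apply]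
  refine List.sum_eq_zero ?_
  simp only [List.mem_map, forall_exists_index, and_imp, forall_apply_eq_imp_iff₂]
  intro s _
  refine Multiset.sum_eq_zero ?_
  simp only [Multiset.mem_map, forall_exists_index, and_imp, forall_apply_eq_imp_iff₂]
  intro f _
  rw [shiftHom_apply, if_neg]
  have := le_offset (N := N) (ss := ss) s
  omega

theorem copiesHom_offset {F : ℕ → Multiset (Pt A)} (hF : ∀ s, ∀ f ∈ F s, f.Of st B)
    (hB : ∀ e ∈ src B, e.name < N) (hss : ss.Nodup) {s t : ℕ} (hs : s ∈ ss) (ht : t < N) :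
    copiesHom A N ss F (t + offset N ss s) = ((F s).map fun f => f.str t).sum := by
  rw [copiesHom_apply]
  rw [sum_map_of_nodup hs hss]
  · congr 1
    refine Multiset.map_congr rfl fun f _ => ?_
    rw [shiftHom_apply, if_pos (Nat.le_add_left _ _), Nat.add_sub_cancel]
  · intro s' h hs'
    refine Multiset.sum_eq_zero ?_
    simp only [Multiset.mem_map, forall_exists_index, and_imp, forall_apply_eq_imp_iff₂]
    intro f hf
    rw [shiftHom_apply]
    split_ifs with h'
    · refine Ex.eq_zero (hF s' f hf) fun h'' => h ?_
      exact (offset_inj hs' hs (hB _ h'') ht (by simp only [Edge.name]; omega)).1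
    · rfl

/-- Only premises `s` with a single experiment are treated: this is the situation of a `♭`-link of
the current level. Copies put deeper get their labels in the experiments of the box that contains
them. -/
theorem exists_lab {ss : List ℕ} (v : ℕ → D A) (F : ℕ → Multiset (Pt A)) : ∃ v' : ℕ → D A,
    (∀ x < N, v' x = v x) ∧ ∀ s ∈ ss, ∀ f, F s = {f} → ∀ x < N, v' (x + offset N ss s) = f.lab x := by
  have key : ∀ y, ∃ d : D A, (y < N → d = v y) ∧
      ∀ s ∈ ss, ∀ f, F s = {f} → ∀ x < N, y = x + offset N ss s → d = f.lab x := by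
    intro y
    by_cases h : ∃ s x f, s ∈ ss ∧ F s = {f} ∧ x < N ∧ y = x + offset N ss s
    · obtain ⟨s, x, f, hs, hf, hx, rfl⟩ := h
      refine ⟨f.lab x, fun h => ?_, ?_⟩
      · have := le_offset (N := N) (ss := ss) s
        omega
      · intro s' hs' f' hf' x' hx' h
        obtain ⟨rfl, rfl⟩ := offset_inj hs hs' hx hx' h
        rw [hf, Multiset.singleton_inj] at hf'
        rw [hf']
    · exact ⟨v y, fun _ => rfl, fun s hs f hf x hx hy => absurd ⟨s, x, f, hs, hf, hx, hy⟩ h⟩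
  choose v' h₁ h₂ using key
  exact ⟨v', h₁, fun s hs f hf x hx => h₂ _ s hs f hf x hx rfl⟩

theorem Ex.str_flat {v : ℕ → D A} {U W : ℕ → Multiset (D A)} {n : ℕ} {L : List Link}
    (h : LLNet.Ex st L v U W n) (hL : (src L).Nodup) {a s : ℕ} (hl : .flat a s ∈ L) :
    W s = {v a} := by
  obtain ⟨L₁, L₂, rfl⟩ := List.append_of_mem hl
  have hp : (L₁ ++ .flat a s :: L₂).Perm (.flat a s :: (L₁ ++ L₂)) := List.perm_middle
  rw [src_perm hp, src_cons, Link.src_flat, Multiset.singleton_add, Multiset.nodup_cons] at hL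
  obtain ⟨W₁, W₂, n₁, n₂, rfl, -, h₁, h₂⟩ := ex_cons.1 ((ex_perm hp).1 h)
  rw [Pi.add_apply, h₂.eq_zero hL.1, (by simpa only [Link.Ex] using h₁ : W₁ = _ ∧ _).1]
  simp

end Dispatch

-- Experiments of a structure into which copies of a box have been put

section Graft

variable {A : Type u} {st : Bool} {N : ℕ} {B : List Link} {i : ℕ} {ss : List ℕ}

/-- The experiments of a link extend to the links that result from dispatching experiments of
`B`. -/
def Link.Graftable (A : Type u) (st : Bool) (N : ℕ) (B : List Link) (i : ℕ) (ss : List ℕ)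
    (l : Link) : Prop :=
  ∀ ⦃v : ℕ → D A⦄ ⦃U W : ℕ → Multiset (D A)⦄ ⦃n : ℕ⦄ (F : ℕ → Multiset (Pt A)), l.Ex st v U W n →
    l.src.Nodup → (∀ e ∈ l.src, e.name < N) →
    (∀ B' i' c', l = .bang B' i' c' → i' < N ∧ ∀ e ∈ LLNet.tgt B', e.name < N ∧ ∀ s ∈ ss, e ≠ .str s) →
    mainHom A i F = keepHom A ss W → (∀ s, ∀ f ∈ F s, f.Of st B) →
    (∀ a s, l = .flat a s → s ∈ ss → ∀ f ∈ F s, ∀ x < N,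
      v (x + offset N ss s) = f.lab x ∧ U (x + offset N ss s) = f.str x) →
    LLNet.Ex st (l.graft (boxCopy N B i ss)) v U (cutHom A ss W + copiesHom A N ss F)
      (n + sizeHom A ss F)

/-- The matching of `F` with the points `W` splits along the decomposition of `W` over the links, so
each link can be dealt with using its own share. -/
theorem Ex.graft_of_forall {L : List Link} (hL : ∀ l ∈ L, l.Graftable A st N B i ss)
    {v : ℕ → D A} {U W : ℕ → Multiset (D A)} {n : ℕ} (F : ℕ → Multiset (Pt A))
    (h : LLNet.Ex st L v U W n) (hnd : (src L).Nodup) (hs : ∀ e ∈ src L, e.name < N)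
    (ht : ∀ B' i' c', .bang B' i' c' ∈ L → i' < N ∧
      ∀ e ∈ tgt B', e.name < N ∧ ∀ s ∈ ss, e ≠ .str s)
    (hF : mainHom A i F = keepHom A ss W) (hFB : ∀ s, ∀ f ∈ F s, f.Of st B)
    (hv : ∀ a s, .flat a s ∈ L → s ∈ ss → ∀ f ∈ F s, ∀ x < N,
      v (x + offset N ss s) = f.lab x ∧ U (x + offset N ss s) = f.str x) :
    LLNet.Ex st (graft (boxCopy N B i ss) L) v U (cutHom A ss W + copiesHom A N ss F)
      (n + sizeHom A ss F) := by
  induction L generalizing W n F with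
  | nil =>
    obtain ⟨rfl, rfl⟩ := ex_nil.1 h
    have : F = 0 := by
      funext s
      have := congrFun hF s
      rw [map_zero, mainHom_apply] at this
      exact Multiset.map_eq_zero.1 this
    subst this
    simpa [graft] using ex_nil.2 ⟨rfl, rfl⟩
  | cons l L ih =>
    obtain ⟨W₁, W₂, n₁, n₂, rfl, rfl, h₁, h₂⟩ := ex_cons.1 h
    rw [map_add] at hF
    obtain ⟨F₁, F₂, rfl, hF₁, hF₂⟩ := exists_add_of_mainHom hF
    rw [src_cons] at hnd
    simp only [src_cons, Multiset.mem_add] at hs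
    rw [graft]
    refine ex_append.2 ⟨cutHom A ss W₁ + copiesHom A N ss F₁, cutHom A ss W₂ + copiesHom A N ss F₂,
      n₁ + sizeHom A ss F₁, n₂ + sizeHom A ss F₂, ?_, ?_,
      hL l (by simp) F₁ h₁ (Multiset.nodup_of_le (Multiset.le_add_right _ _) hnd)
        (fun e he => hs e (.inl he)) (fun B' i' c' hl => ht B' i' c' (by simp [hl])) hF₁ (fun s f hf => hFB s f (by simp [hf])) ?_,
      ih (fun m hm => hL m (by simp [hm])) F₂ h₂
        (Multiset.nodup_of_le (Multiset.le_add_left _ _) hnd) (fun e he => hs e (.inr he))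
        (fun B' i' c' hl => ht B' i' c' (by simp [hl])) hF₂
        (fun s f hf => hFB s f (by simp [hf])) ?_⟩
    · simp only [map_add]
      abel
    · simp only [map_add]
      omega
    · rintro a s rfl hs f hf
      exact hv a s (by simp) hs f (by simp [hf])
    · intro a s hl hs f hf
      exact hv a s (by simp [hl]) hs f (by simp [hf])

/-- Takes as labels of the structural premises the very points that result from the grafting, as an
experiment requires. A `♭`-link of this level has one point, hence one experiment to receive, whose
lines live at names used by no one else. -/
theorem Ex.graft_of_lab (hBs : ∀ e ∈ src B, e.name < N) (hsn : ss.Nodup)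
    {L : List Link} (hL : ∀ l ∈ L, l.Graftable A st N B i ss)
    {v : ℕ → D A} {W : ℕ → Multiset (D A)} {n : ℕ} (F : ℕ → Multiset (Pt A))
    (h : LLNet.Ex st L v (cutHom A ss W + copiesHom A N ss F) W n) (hnd : (src L).Nodup)
    (hs : ∀ e ∈ src L, e.name < N) (ht : ∀ B' i' c', .bang B' i' c' ∈ L → i' < N ∧
      ∀ e ∈ tgt B', e.name < N ∧ ∀ s ∈ ss, e ≠ .str s)
    (hF : mainHom A i F = keepHom A ss W) (hFB : ∀ s, ∀ f ∈ F s, f.Of st B)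
    (hv : ∀ s ∈ ss, ∀ f, F s = {f} → ∀ x < N, v (x + offset N ss s) = f.lab x) :
    LLNet.Ex st (graft (boxCopy N B i ss) L) v (cutHom A ss W + copiesHom A N ss F)
      (cutHom A ss W + copiesHom A N ss F) (n + sizeHom A ss F) := by
  refine Ex.graft_of_forall hL F h hnd hs ht hF hFB ?_
  intro a s hl hs' f hf x hx
  have hW := h.str_flat hnd hl
  have := congrFun hF s
  rw [mainHom_apply, keepHom_apply, if_pos hs', hW] at this
  obtain ⟨f', hf', -⟩ := Multiset.map_eq_singleton.1 this
  rw [hf', Multiset.mem_singleton] at hf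
  subst hf
  refine ⟨hv s hs' f hf' x hx, ?_⟩
  rw [Pi.add_apply, copiesHom_offset hFB hBs hsn hs' hx, hf', cutHom_apply,
    h.eq_zero fun h' => ?_]
  · simp
  · have := hs _ h'
    have := le_offset (N := N) (ss := ss) s
    simp only [Edge.name] at *
    omega

theorem Link.graftable (hBs : ∀ e ∈ LLNet.src B, e.name < N)
    (hBt : ∀ e ∈ LLNet.tgt B, e.name < N) (hsn : ss.Nodup) (hi : i < N) (l : Link) : l.Graftable A st N B i ss := by
  refine Link.ind (P := Link.Graftable A st N B i ss) ?_ ?_ l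
  · intro B₁ i₁ c₁ ih v U W n F h hnd hs ht hF hFB _
    obtain ⟨fs, h0, hf, hc, rfl, rfl⟩ := ex_bang.1 h
    -- Each experiment of the enclosing box is paired with its share of the copies, and is
    -- relabelled separately.
    obtain ⟨ps, rfl, rfl, hps⟩ := exists_sum_of_mainHom hF
    simp only [Link.src_bang, Multiset.mem_cons, forall_eq_or_imp, Multiset.nodup_cons] at hnd hs
    obtain ⟨hi₁, ht⟩ := ht B₁ i₁ c₁ rfl
    have key : ∀ p : Pt A × (ℕ → Multiset (Pt A)), ∃ v', p ∈ ps → (∀ x < N, v' x = p.1.lab x) ∧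
        LLNet.Ex st (LLNet.graft (boxCopy N B i ss) B₁) v'
          (cutHom A ss p.1.str + copiesHom A N ss p.2) (cutHom A ss p.1.str + copiesHom A N ss p.2)
          (p.1.size + sizeHom A ss p.2) := by
      intro p
      by_cases hp : p ∈ ps
      · obtain ⟨v', h₁, h₂⟩ := exists_lab (N := N) (ss := ss) p.1.lab p.2
        refine ⟨v', fun _ => ⟨h₁, Ex.graft_of_lab hBs hsn ih p.2
          ((hf p.1 (Multiset.mem_map_of_mem _ hp)).congr (fun x hx => h₁ x ?_) fun s hs' => ?_)
          hnd.2 hs.2 (fun B' i' c' hl => ?_) (hps p hp)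
          (fun s f hf' => hFB s f (mem_of_mem_sum (Multiset.mem_map_of_mem _ hp) hf')) h₂⟩⟩
        · exact hx.elim (hs.2 _) fun hx => (ht _ hx).1
        · have : s < N := (ht _ hs').1
          rw [Pi.add_apply, copiesHom_of_lt this, cutHom_apply,
            if_neg fun h' => (ht _ hs').2 s h' rfl, add_zero]
        · exact ⟨(ht (.log i') (mem_tgt.2 ⟨_, hl, by simp [Link.tgt]⟩)).1,
            fun e he => ht e (mem_tgt.2 ⟨_, hl, by simp [Link.tgt, he]⟩)⟩
      · exact ⟨p.1.lab, fun h => absurd h hp⟩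
    choose v' hv' using key
    rw [Link.graft]
    refine ex_cons.2 ⟨_, 0, _, 0, (add_zero _).symm, (add_zero _).symm, ex_bang.2
      ⟨ps.map fun p => ⟨v' p, cutHom A ss p.1.str + copiesHom A N ss p.2,
        p.1.size + sizeHom A ss p.2⟩, by simpa using h0, ?_, ?_, ?_, ?_⟩, ex_nil.2 ⟨rfl, rfl⟩⟩
    · intro f hf'
      obtain ⟨p, hp, rfl⟩ := Multiset.mem_map.1 hf'
      exact (hv' p hp).2
    · rw [hc, Multiset.map_map, Multiset.map_map]
      congr 1
      exact Multiset.map_congr rfl fun p hp => ((hv' p hp).1 i₁ hi₁).symm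
    · simp only [Multiset.map_map, Function.comp_def, Multiset.sum_map_add, map_multiset_sum]
    · simp only [Multiset.map_map, Function.comp_def, Multiset.sum_map_add, map_multiset_sum,
        add_assoc]
  · intro l hl v U W n F h hnd hs ht hF hFB hv
    have key : W = 0 → LLNet.Ex st [l] v U (cutHom A ss W + copiesHom A N ss F)
        (n + sizeHom A ss F) := by
      rintro rfl
      have : F = 0 := by
        funext s
        have := congrFun hF s
        rw [map_zero, mainHom_apply] at this
        exact Multiset.map_eq_zero.1 this
      subst this
      refine ex_cons.2 ⟨0, 0, n, 0, by simp, by simp, h, ex_nil.2 ⟨rfl, rfl⟩⟩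
    cases l with
    | bang B i c => exact absurd rfl (hl B i c)
    | flat a s =>
      rw [Link.graft]
      simp only [Link.Ex] at h
      obtain ⟨rfl, rfl⟩ := h
      by_cases hs' : s ∈ ss
      · have h₁ : ∀ s', s' ≠ s → F s' = 0 := by
          intro s' hne
          have := congrFun hF s'
          rw [mainHom_apply, keepHom_apply, Pi.single_eq_of_ne hne, ite_self] at this
          exact Multiset.map_eq_zero.1 this
        have h₂ := congrFun hF s
        rw [mainHom_apply, keepHom_apply, if_pos hs', Pi.single_eq_same] at h₂
        -- The point of the `♭`-link selects one experiment `f`, whose main conclusion is dual to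
        -- the premise `a`: exactly what the new cut demands.
        obtain ⟨f, hf, hfa⟩ := Multiset.map_eq_singleton.1 h₂
        have h₃ : F = Pi.single s {f} := by
          funext s'
          by_cases hne : s' = s
          · subst hne
            rw [hf, Pi.single_eq_same]
          · rw [h₁ s' hne, Pi.single_eq_of_ne hne]
        have hf' : f ∈ F s := by simp [hf]
        have h₄ := hv a s rfl hs' f hf'
        rw [h₃, copiesHom_single hs' hsn, sizeHom_single hs' hsn, boxCopy_of_mem hs']
        -- The cut takes over the unit of size of the `♭`-link, so that the size grows by that of
        -- `f` and no more.
        refine ex_cons.2 ⟨0, _, 1, _, ?_, rfl, ?_, LLNet.Ex.shift ((hFB s f hf').congr ?_ ?_)⟩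
        · have : cutHom A ss (Pi.single s {v a}) = 0 := by
            funext y
            rw [cutHom_apply]
            split_ifs with hy
            · rfl
            · exact Pi.single_eq_of_ne (by rintro rfl; exact hy hs') _
          rw [this]
        · simp only [Link.Ex, and_self, and_true]
          rw [(h₄ i hi).1, hfa]
        · rintro x (hx | hx)
          · exact (h₄ x (hBs _ hx)).1
          · exact (h₄ x (hBt _ hx)).1
        · exact fun t ht => (h₄ t (hBt _ ht)).2
      · rw [boxCopy_of_notMem hs']
        have : F = 0 := by
          funext s'
          have := congrFun hF s'
          rw [mainHom_apply, keepHom_apply] at this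
          refine Multiset.map_eq_zero.1 (this.trans ?_)
          split_ifs with h'
          · rw [Pi.single_eq_of_ne]
            rintro rfl
            exact hs' h'
          · rfl
        subst this
        refine ex_cons.2 ⟨Pi.single s {v a}, 0, 1, 0, ?_, by simp, by simp [Link.Ex],
          ex_nil.2 ⟨rfl, rfl⟩⟩
        rw [map_zero, add_zero, add_zero]
        funext y
        rw [cutHom_apply]
        split_ifs with hy
        · rw [Pi.single_eq_of_ne]
          rintro rfl
          exact hs' hy
        · rfl
    | _ =>
      rw [Link.graft]
      refine key ?_
      simp only [Link.Ex] at h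
      exact h.2.1

end Graft

/-! ## Reduction of relaxed experiments -/

section Reduce

variable {A : Type u} {st : Bool} {v v' : ℕ → D A} {U U' W : ℕ → Multiset (D A)} {n : ℕ}

/-- A relaxed `?`-link keeps its label even if its premises lose points or disappear, which happens
when a box is erased. -/
theorem Ex.expand {L : List Link} {θ : ℕ → List ℕ} (h : LLNet.Ex false L v U W n)
    (hθ : ∀ ss c, .why ss c ∈ L → ∀ s ∈ ss, ((θ s).map U').sum ≤ U s) :
    LLNet.Ex false (L.map (Link.expand θ)) v U' W n := by
  refine h.map (AddMonoidHom.id _) fun l hl W n h' => ?_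
  by_cases hw : ∃ ss c, l = .why ss c
  · obtain ⟨ss, c, rfl⟩ := hw
    simp only [Link.expand, Link.Ex, Bool.false_eq_true, false_implies, and_true] at h' ⊢
    obtain ⟨⟨μ, h₁, h₂⟩, h₃⟩ := h'
    refine ⟨⟨μ, h₁, le_trans ?_ h₂⟩, h₃⟩
    have : ((ss.flatMap θ).map U').sum = (ss.map fun s => ((θ s).map U').sum).sum := by
      simp only [List.flatMap, List.map_flatten, List.sum_flatten, List.map_map, Function.comp_def]
    rw [this]
    exact List.sum_le_sum fun s hs => hθ ss c hl s hs
  · push Not at hw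
    rw [Link.expand_of_ne hw]
    cases l with
    | why ss c => exact absurd rfl (hw ss c)
    | _ => simpa only [Link.Ex, AddMonoidHom.id_apply] using h'

theorem Ex.rename_ax {x t : Link} {a b c : ℕ} {Γ : List Link}
    (ht : t = .cut a b ∨ t = .cut b a) (h : WF (x :: t :: Γ)) (hv : ∀ d, v' (axMap b c d) = v d) (he : LLNet.Ex st Γ v U W n) :
    LLNet.Ex st (rename (axMap b c) id Γ) v' U W n := by
  rw [rename_eq_map]
  refine he.map (AddMonoidHom.id _) fun l hl W n h' => ?_
  cases l with
  | bang B i d =>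
    rw [h.rename_box ht hl, ex_bang, hv]
    exact ex_bang.1 h'
  | _ => simpa only [Link.rename, Link.Ex, AddMonoidHom.id_apply, hv, List.map_id, id_eq] using h'

theorem ex_cons_of_iff {l : Link} {L : List Link} {P : Prop}
    (h : ∀ W n, l.Ex st v U W n ↔ P ∧ W = 0 ∧ n = 1) :
    Ex st (l :: L) v U W n ↔ ∃ m, n = m + 1 ∧ P ∧ Ex st L v U W m := by
  rw [ex_cons]
  constructor
  · rintro ⟨W₁, W₂, n₁, n₂, rfl, rfl, h₁, h₂⟩
    obtain ⟨hP, rfl, rfl⟩ := (h _ _).1 h₁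
    exact ⟨n₂, add_comm _ _, hP, by rwa [zero_add]⟩
  · rintro ⟨m, rfl, hP, h'⟩
    exact ⟨0, W, 1, m, (zero_add _).symm, add_comm _ _, (h _ _).2 ⟨hP, rfl, rfl⟩, h'⟩

theorem ex_cut {a b : ℕ} (W : ℕ → Multiset (D A)) (n : ℕ) :
    (Link.cut a b).Ex st v U W n ↔ v a = (v b).neg ∧ W = 0 ∧ n = 1 := by
  simp only [Link.Ex]

theorem ex_tensor {a b c : ℕ} (W : ℕ → Multiset (D A)) (n : ℕ) :
    (Link.tensor a b c).Ex st v U W n ↔ v c = D.pair true (v a) (v b) ∧ W = 0 ∧ n = 1 := by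
  simp only [Link.Ex]

theorem ex_par {a b c : ℕ} (W : ℕ → Multiset (D A)) (n : ℕ) :
    (Link.par a b c).Ex st v U W n ↔ v c = D.pair false (v a) (v b) ∧ W = 0 ∧ n = 1 := by
  simp only [Link.Ex]

theorem ex_one {c : ℕ} (W : ℕ → Multiset (D A)) (n : ℕ) :
    (Link.one c).Ex st v U W n ↔ v c = D.atom true none ∧ W = 0 ∧ n = 1 := by
  simp only [Link.Ex]

theorem ex_bot {c : ℕ} (W : ℕ → Multiset (D A)) (n : ℕ) :
    (Link.bot c).Ex st v U W n ↔ v c = D.atom false none ∧ W = 0 ∧ n = 1 := by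
  simp only [Link.Ex]

theorem ex_why {ss : List ℕ} {c : ℕ} (W : ℕ → Multiset (D A)) (n : ℕ) :
    (Link.why ss c).Ex st v U W n ↔ (∃ μ, v c = D.bag false μ ∧ (ss.map U).sum ≤ μ ∧
      (st = true → ss ≠ [] → μ = (ss.map U).sum)) ∧ W = 0 ∧ n = 1 := by
  simp only [Link.Ex]

theorem ex_cut_of_or {t : Link} {a b : ℕ} (ht : t = .cut a b ∨ t = .cut b a)
    (W : ℕ → Multiset (D A)) (n : ℕ) : t.Ex st v U W n ↔ v a = (v b).neg ∧ W = 0 ∧ n = 1 := by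
  rcases ht with rfl | rfl
  · simp only [Link.Ex]
  · simp only [Link.Ex, D.eq_neg_comm (x := v b)]

theorem ex_ax_of_or {t : Link} {a b : ℕ} (ht : t = .ax a b ∨ t = .ax b a)
    (W : ℕ → Multiset (D A)) (n : ℕ) : t.Ex st v U W n ↔ v a = (v b).neg ∧ W = 0 ∧ n = 1 := by
  rcases ht with rfl | rfl
  · simp only [Link.Ex]
  · simp only [Link.Ex, D.eq_neg_comm (x := v b)]

/-- Deals out the experiments of a box to the premises of the `?`-link according to the points that
each premise carries. -/
theorem exists_split {α β : Type*} {g : α → β} {ss : List ℕ} (hss : ss.Nodup)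
    {V : ℕ → Multiset β} {G : Multiset α} (h : G.map g = (ss.map V).sum) :
    ∃ F : ℕ → Multiset α, (∀ s, (F s).map g = if s ∈ ss then V s else 0) ∧ (ss.map F).sum = G := by
  induction ss generalizing G with
  | nil =>
    simp only [List.map_nil, List.sum_nil, Multiset.map_eq_zero] at h
    exact ⟨fun _ => 0, by simp, by simp [h]⟩
  | cons s ss ih =>
    rw [List.nodup_cons] at hss
    rw [List.map_cons, List.sum_cons] at h
    obtain ⟨G₁, G₂, rfl, h₁, h₂⟩ := exists_of_map_eq_add h
    obtain ⟨F, h₃, h₄⟩ := ih hss.2 h₂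
    refine ⟨Function.update F s G₁, fun s' => ?_, ?_⟩
    · by_cases hs : s' = s
      · subst hs
        simpa using h₁
      · simp [hs, h₃]
    · rw [List.map_cons, List.sum_cons, Function.update_self, ← h₄]
      congr 2
      refine List.map_congr_left fun s' hs' => Function.update_of_ne ?_ _ _
      rintro rfl
      exact hss.1 hs'

variable {N : ℕ}

/-- `L'`, a reduct of `L`, has a smaller experiment. -/
def Reducible (A : Type u) (L L' : List Link) (θ : ℕ → List ℕ) : Prop :=
  ∀ ⦃v : ℕ → D A⦄ ⦃W : ℕ → Multiset (D A)⦄ ⦃n : ℕ⦄, Ex false L v W W n →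
    ∃ v' W' n', Ex false L' v' W' W' n' ∧ n' < n ∧
      (∀ x, .log x ∈ src L → .log x ∉ tgt L → v' x = v x) ∧
      ∀ s, .str s ∈ src L → .str s ∉ tgt L → ((θ s).map W').sum ≤ W s

theorem Reducible.perm {L L₁ L' : List Link} {θ : ℕ → List ℕ} (hp : L.Perm L₁)
    (h : Reducible A L₁ L' θ) : Reducible A L L' θ := by
  intro v W n he
  rw [src_perm hp, tgt_perm hp]
  exact h ((ex_perm hp).1 he)

/-- `b` and `c` are both dual to `a`, so they already carry the same label and identifying them
changes nothing. -/
theorem reducible_ax {x t : Link} {a b c : ℕ} {Γ : List Link}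
    (ht : t = .cut a b ∨ t = .cut b a) (hx : x = .ax a c ∨ x = .ax c a)
    (h : WF (x :: t :: Γ)) :
    Reducible A (x :: t :: Γ) (rename (axMap b c) id Γ) fun s => [s] := by
  intro v W n he
  obtain ⟨n₁, rfl, h₁, he⟩ := (ex_cons_of_iff (ex_ax_of_or hx)).1 he
  obtain ⟨n₂, rfl, h₂, he⟩ := (ex_cons_of_iff (ex_cut_of_or ht)).1 he
  refine ⟨v, W, n₂, he.rename_ax ht h fun d => ?_, by omega, fun _ _ _ => rfl, by simp⟩
  by_cases hd : d = b
  · rw [hd, axMap_self, ← D.neg_inj, ← h₁, h₂]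
  · rw [axMap_of_ne hd]

/-- Duality of the pairs is duality of their components. Three links give way to two, whence the
smaller size. -/
theorem reducible_tensorPar {t : Link} {a₁ a₂ a b₁ b₂ b : ℕ} {Γ : List Link}
    (ht : t = .cut a b ∨ t = .cut b a) :
    Reducible A (.tensor a₁ a₂ a :: .par b₁ b₂ b :: t :: Γ) (.cut a₁ b₁ :: .cut a₂ b₂ :: Γ)
      fun s => [s] := by
  intro v W n he
  obtain ⟨n₁, rfl, h₁, he⟩ := (ex_cons_of_iff ex_tensor).1 he
  obtain ⟨n₂, rfl, h₂, he⟩ := (ex_cons_of_iff ex_par).1 he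
  obtain ⟨n₃, rfl, h₃, he⟩ := (ex_cons_of_iff (ex_cut_of_or ht)).1 he
  rw [h₁, h₂, D.neg_pair] at h₃
  obtain ⟨h₄, h₅⟩ := D.pair_inj h₃
  exact ⟨v, W, n₃ + 1 + 1, (ex_cons_of_iff ex_cut).2 ⟨_, rfl, h₄,
    (ex_cons_of_iff ex_cut).2 ⟨_, rfl, h₅, he⟩⟩, by omega, fun _ _ _ => rfl, by simp⟩

theorem reducible_oneBot {t : Link} {a b : ℕ} {Γ : List Link}
    (ht : t = .cut a b ∨ t = .cut b a) :
    Reducible A (.one a :: .bot b :: t :: Γ) Γ fun s => [s] := by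
  intro v W n he
  obtain ⟨n₁, rfl, h₁, he⟩ := (ex_cons_of_iff ex_one).1 he
  obtain ⟨n₂, rfl, h₂, he⟩ := (ex_cons_of_iff ex_bot).1 he
  obtain ⟨n₃, rfl, h₃, he⟩ := (ex_cons_of_iff (ex_cut_of_or ht)).1 he
  exact ⟨v, W, n₃, he, by omega, fun _ _ _ => rfl, by simp⟩

/-- The cut identifies the multiset of the `?`-link with the duals of the main conclusions of the
experiments of the box. These experiments are moved to the `♭`-links without being duplicated, and
the three links of the redex disappear, so the size drops. -/
theorem reducible_bangWhy {t : Link} {i a b : ℕ} {B Γ : List Link} {ss : List ℕ}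
    (ht : t = .cut a b ∨ t = .cut b a) (h : WF (.bang B i a :: .why ss b :: t :: Γ))
    (hN : ∀ e ∈ src (.bang B i a :: .why ss b :: t :: Γ), e.name < N) :
    Reducible A (.bang B i a :: .why ss b :: t :: Γ)
      (graft (boxCopy N B i ss) (Γ.map (Link.expand (auxCopies N B ss.length))))
      (auxCopies N B ss.length) := by
  intro v W n he
  have hB : WF B := h.box (List.mem_cons_self ..)
  obtain ⟨Y, hY, hYl⟩ := exists_out_box hB (h.good _ (List.mem_cons_self ..))
  obtain ⟨hssn, hssB, hssΓ, hsst, -, -, -, -, hBΓ, -, -, -⟩ := h.bangWhy_facts ht hY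
  obtain ⟨W₁, WΓ, n₁, _, rfl, rfl, h₁, he⟩ := ex_cons.1 he
  obtain ⟨n₂, rfl, ⟨μ, h₂, hμ, -⟩, he⟩ := (ex_cons_of_iff ex_why).1 he
  obtain ⟨n₃, rfl, h₃, hΓ⟩ := (ex_cons_of_iff (ex_cut_of_or ht)).1 he
  obtain ⟨fs, hfs0, hfs, h₄, rfl, rfl⟩ := ex_bang.1 h₁
  have hN₁ : (∀ e ∈ src B, e.name < N) ∧ ∀ e ∈ src Γ, e.name < N :=
    ⟨fun e he => hN e (by simp [he]), fun e he => hN e (by simp [he])⟩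
  have hsub := h.subset
  have hNt : (∀ e ∈ tgt B, e.name < N) ∧ ∀ e ∈ tgt Γ, e.name < N :=
    ⟨fun e he => hN e (hsub (by simp [Link.tgt, he])), fun e he => hN e (hsub (by simp [he]))⟩
  have hi : i < N := by
    have : Edge.log i ∈ src B := by rw [hY]; simp
    exact hN₁.1 _ this
  have hWs : ∀ s ∈ ss, ((fs.map Pt.str).sum + WΓ) s = WΓ s := by
    intro s hs
    rw [Pi.add_apply, h₁.eq_zero (by simpa using hssB s hs), zero_add]
  rw [List.map_congr_left hWs] at hμ
  obtain ⟨μ', rfl⟩ := Multiset.le_iff_exists_add.1 hμ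
  have hfm : fs.map (fun f => (f.lab i).neg) = (ss.map WΓ).sum + μ' := by
    rw [h₄, h₂, D.neg_bag] at h₃
    have := congrArg (Multiset.map D.neg) (D.bag_inj h₃)
    simpa [Multiset.map_map, Function.comp_def, D.neg_neg] using this
  -- The experiments in `G'` face points that come from no premise of the `?`-link; they are
  -- discarded. Without premises this is all of them.
  obtain ⟨G, G', rfl, hG, -⟩ := exists_of_map_eq_add hfm
  obtain ⟨F, hF, rfl⟩ := exists_split hssn hG
  have hF' : mainHom A i F = keepHom A ss WΓ := by
    funext s
    rw [mainHom_apply, keepHom_apply, hF]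
  have hFB : ∀ s, ∀ f ∈ F s, f.Of false B := by
    intro s f hf
    have hs : s ∈ ss := by
      by_contra hs
      have := hF s
      rw [if_neg hs, Multiset.map_eq_zero] at this
      simp [this] at hf
    refine hfs f (Multiset.mem_add.2 (.inl ?_))
    exact Multiset.mem_of_le (List.single_le_sum (fun _ _ => Multiset.zero_le _) _
      (List.mem_map_of_mem hs)) hf
  obtain ⟨v', hv₁, hv₂⟩ := exists_lab (N := N) (ss := ss) v F
  have hYB : ∀ {s}, .str s ∈ src B → .str s ∉ tgt B → .str s ∈ Y := by
    intro s hs hs'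
    simpa using (mem_out hB.src_nodup hY).2 ⟨hs, hs'⟩
  -- An auxiliary line of the box carried the points of all the experiments; its copies together
  -- carry those of the experiments that were kept. Other lines are unchanged.
  have hle : ∀ s, .str s ∈ src B ∨ .str s ∈ src Γ → .str s ∉ tgt B → s ∉ ss →
      ((auxCopies N B ss.length s).map (cutHom A ss WΓ + copiesHom A N ss F)).sum ≤
        (((ss.map F).sum + G').map Pt.str).sum s + WΓ s := by
    intro s hs hs' hss
    by_cases hsB : .str s ∈ src B
    · rw [auxCopies_of_mem hB hY hssn (hYB hsB hs')]
      have : ∀ s' ∈ ss, (cutHom A ss WΓ + copiesHom A N ss F) (s + offset N ss s') =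
          ((F s').map fun f => f.str s).sum := by
        intro s' hs'
        rw [Pi.add_apply, copiesHom_offset hFB hN₁.1 hssn hs' (show s < N from hN₁.1 _ hsB), cutHom_apply,
          hΓ.eq_zero, ite_self, zero_add]
        intro h'
        have := hN₁.2 _ h'
        have := le_offset (N := N) (ss := ss) s'
        simp only [Edge.name] at *
        omega
      rw [List.map_map, List.map_congr_left (f := _ ∘ _)
        (g := fun s' => ((F s').map fun f => f.str s).sum) this]
      refine le_trans ?_ (le_add_of_nonneg_right (Multiset.zero_le _))
      rw [sum_str_apply, Multiset.map_add, Multiset.sum_add]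
      refine le_trans (le_of_eq ?_) (le_add_of_nonneg_right (Multiset.zero_le _))
      clear * -
      induction ss with
      | nil => simp
      | cons s' ss ih => simp [ih]
    · have := hN₁.2 _ (hs.resolve_left hsB)
      rw [auxCopies_of_notMem hsB]
      simp [copiesHom_of_lt (show s < N from this), cutHom_apply, hss]
  have hdisj : ∀ e ∈ tgt Γ, e ∉ tgt B := by
    have hT := h.tgt_nodup
    rw [tgt_cons, Multiset.nodup_add] at hT
    intro e he he'
    exact (Multiset.disjoint_left.1 hT.2.2 : _ → e ∉ _) (by simp [Link.tgt, he']) (by simp [he])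
  have hmem : ∀ s, .str s ∈ src (.bang B i a :: .why ss b :: t :: Γ) →
      .str s ∈ src B ∨ .str s ∈ src Γ := by
    intro s hs
    simpa [src_cut_of_or ht] using hs
  refine ⟨v', cutHom A ss WΓ + copiesHom A N ss F, n₃ + sizeHom A ss F,
    Ex.graft_of_lab hN₁.1 hssn (fun l _ => l.graftable hN₁.1 hNt.1 hssn hi) F
      (Ex.expand (hΓ.congr (fun x hx => hv₁ x (hx.elim (hN₁.2 _) (hNt.2 _))) fun _ _ => rfl) ?_) ?_ ?_ ?_
      hF' hFB hv₂, ?_, ?_, ?_⟩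
  · intro ss' c hw s hs
    have hs' : .str s ∈ tgt Γ := mem_tgt.2 ⟨_, hw, by simp [hs]⟩
    exact hle s (hmem s (hsub (by simp [hs']))) (hdisj _ hs') fun h' => hsst s h' hs'
  · rw [src_expand]
    have := h.src_nodup
    simp only [src_cons, Multiset.nodup_add] at this
    exact this.2.1.2.1.2.1
  · rw [src_expand]
    exact hN₁.2
  · intro B' i' c' hl
    rw [bang_mem_map_expand] at hl
    have hl' : ∀ e ∈ (Link.bang B' i' c').tgt, e ∈ tgt Γ := fun e he => mem_tgt.2 ⟨_, hl, he⟩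
    simp only [Link.tgt, Multiset.mem_cons, forall_eq_or_imp] at hl'
    refine ⟨hNt.2 _ hl'.1, fun e he => ⟨hNt.2 _ (hl'.2 e he), ?_⟩⟩
    rintro s hs rfl
    exact hsst s hs (hl'.2 _ he)
  · have : sizeHom A ss F = ((ss.map F).sum.map Pt.size).sum := by
      rw [sizeHom_def]
      clear * -
      induction ss with
      | nil => simp
      | cons s' ss ih => simp [ih]
    rw [this, Multiset.map_add, Multiset.sum_add]
    omega
  · exact fun x hx _ => hv₁ x (hN _ hx)
  · intro s hs hs'
    simp only [tgt_cons, Link.tgt, Multiset.mem_add, Multiset.mem_cons, not_or] at hs'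
    exact hle s (hmem s hs) hs'.1.2 fun h' => hs'.2.1 (by simpa using h')

/-- Every experiment of the box is replaced by a smaller one with the same main conclusion. The
total becomes strictly smaller because there is at least one. -/
theorem reducible_box {B B' Γ : List Link} {i c : ℕ} {θ : ℕ → List ℕ}
    (h : WF (.bang B i c :: Γ)) (hN : ∀ e ∈ src (.bang B i c :: Γ), e.name < N)
    (hst : StepRel N B B' θ) (ih : Reducible A B B' θ) :
    Reducible A (.bang B i c :: Γ) (.bang B' i c :: Γ.map (Link.expand θ)) θ := by
  intro v W n he
  have hB : WF B := h.box (List.mem_cons_self ..)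
  obtain ⟨-, -, hBs, hib, hit, -⟩ := good_bang.1 (h.good _ (List.mem_cons_self ..))
  have hS := h.src_nodup
  have hT := h.tgt_nodup
  have hsub := h.subset
  rw [src_cons, Multiset.nodup_add] at hS
  rw [tgt_cons, Multiset.nodup_add] at hT
  have hBΓ : ∀ e ∈ src B, e ∉ src Γ := fun e he he' =>
    (Multiset.disjoint_left.1 hS.2.2 : _ → e ∉ _) (by simp [he]) he'
  have hBN : ∀ e ∈ src B, e.name < N := fun e he => hN e (by simp [he])
  have hΓN : ∀ e ∈ src Γ, e.name < N := fun e he => hN e (by simp [he])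
  obtain ⟨W₁, WΓ, n₁, n₂, rfl, rfl, h₁, hΓ⟩ := ex_cons.1 he
  obtain ⟨fs, hfs0, hfs, hc, rfl, rfl⟩ := ex_bang.1 h₁
  have key : ∀ f : Pt A, ∃ f' : Pt A, f ∈ fs → f'.Of false B' ∧ f'.size < f.size ∧
      f'.lab i = f.lab i ∧
      ∀ s, .str s ∈ src B → .str s ∉ tgt B → ((θ s).map f'.str).sum ≤ f.str s := by
    intro f
    by_cases hf : f ∈ fs
    · obtain ⟨v', W', n', h₁, h₂, h₃, h₄⟩ := ih (hfs f hf)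
      exact ⟨⟨v', W', n'⟩, fun _ => ⟨h₁, h₂, h₃ i hib hit, h₄⟩⟩
    · exact ⟨f, fun h => absurd h hf⟩
  choose f' hf' using key
  have hex : (Link.bang B' i c).Ex false v 0 ((fs.map f').map Pt.str).sum
      (1 + ((fs.map f').map Pt.size).sum) := by
    refine ex_bang.2 ⟨fs.map f', by simpa using hfs0, ?_, ?_, rfl, rfl⟩
    · intro f hf
      obtain ⟨g, hg, rfl⟩ := Multiset.mem_map.1 hf
      exact (hf' g hg).1
    · rw [hc, Multiset.map_map]
      congr 1
      exact Multiset.map_congr rfl fun f hf => (hf' f hf).2.2.1.symm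
  have hnew : ∀ s, .str s ∈ src B' → .str s ∉ src Γ := by
    intro s hs hs'
    rcases hst.fresh _ hs with h' | h'
    · exact hBΓ _ h' hs'
    · exact absurd (hΓN _ hs') (not_lt.2 h')
  obtain ⟨X, hX⟩ := hB.exists_out
  have hout : ∀ s, .str s ∈ src B → .str s ∉ tgt B → ∀ y ∈ θ s, .str y ∈ src B' := by
    intro s hs hs' y hy
    have : Edge.str s ∈ X := (mem_out hB.src_nodup hX).2 ⟨hs, hs'⟩
    rw [hst.out X hX]
    exact Multiset.mem_add.2 (.inr (Multiset.mem_bind.2 ⟨_, this, by simpa [spread] using hy⟩))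
  have hle : ∀ s, .str s ∈ src (.bang B i c :: Γ) → .str s ∉ tgt B →
      ((θ s).map (((fs.map f').map Pt.str).sum + WΓ)).sum ≤ (fs.map Pt.str).sum s + WΓ s := by
    intro s hs hs'
    by_cases hsB : .str s ∈ src B
    · have h₂ : (θ s).map (((fs.map f').map Pt.str).sum + WΓ) =
          (θ s).map fun y => (fs.map fun f => (f' f).str y).sum := by
        refine List.map_congr_left fun y hy => ?_
        rw [Pi.add_apply, hΓ.eq_zero (hnew y (hout s hsB hs' y hy)), add_zero, sum_str_apply,
          Multiset.map_map]
        rfl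
      have h₃ : ((θ s).map fun y => (fs.map fun f => (f' f).str y).sum).sum =
          (fs.map fun f => ((θ s).map (f' f).str).sum).sum := by
        induction θ s with
        | nil => simp
        | cons y l ih => simp [ih, Multiset.sum_map_add]
      rw [h₂, h₃, sum_str_apply]
      refine le_trans ?_ (le_add_of_nonneg_right (Multiset.zero_le _))
      exact Multiset.sum_map_le_sum_map _ _ fun f hf => (hf' f hf).2.2.2 s hsB hs'
    · have hsΓ : .str s ∈ src Γ := by simpa [hsB] using hs
      rw [hst.old s hsB, List.map_singleton, List.sum_singleton, Pi.add_apply,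
        hex.eq_zero (fun h' => hnew s (by simpa using h') hsΓ)]
      exact add_le_add_left (Multiset.zero_le _) _
  refine ⟨v, ((fs.map f').map Pt.str).sum + WΓ, 1 + ((fs.map f').map Pt.size).sum + n₂,
    ex_cons.2 ⟨_, _, _, _, rfl, rfl, ex_bang.2 (ex_bang.1 hex), hΓ.expand ?_⟩, ?_,
    fun _ _ _ => rfl, ?_⟩
  · intro ss c' hw s hs
    have hs' : .str s ∈ tgt Γ := mem_tgt.2 ⟨_, hw, by simp [hs]⟩
    refine hle s (hsub (by simp [hs'])) fun h' => ?_
    exact (Multiset.disjoint_left.1 hT.2.2 : _ → Edge.str s ∉ _) (by simp [Link.tgt, h']) hs'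
  · have : ((fs.map f').map Pt.size).sum < (fs.map Pt.size).sum := by
      rw [Multiset.map_map]
      exact Multiset.sum_lt_sum_of_nonempty hfs0 fun f hf => (hf' f hf).2.1
    omega
  · intro s hs hs'
    exact hle s hs fun h' => hs' (by simp [Link.tgt, h'])

theorem Ex.reduce {N : ℕ} {L L' : List Link} {θ : ℕ → List ℕ} (hst : CutStep N L L' θ) (h : WF L)
    (hN : ∀ e ∈ src L, e.name < N) : Reducible A L L' θ := by
  induction hst with
  | ax hx ht hL => exact (reducible_ax ht hx (h.perm hL)).perm hL
  | tensorPar ht hL => exact (reducible_tensorPar ht).perm hL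
  | oneBot ht hL => exact (reducible_oneBot ht).perm hL
  | bangWhy ht hL => exact (reducible_bangWhy ht (h.perm hL) (src_perm hL ▸ hN)).perm hL
  | box hL hB ih =>
    have h' := h.perm hL
    have hN' := hN
    rw [src_perm hL] at hN'
    have hb := h'.box (List.mem_cons_self ..)
    have hbN := fun e he => hN' e (mem_src.2 ⟨_, List.mem_cons_self .., by
      rw [Link.src_bang]; exact Multiset.mem_cons_of_mem he⟩)
    have h₂ := (wf_step hB hb hbN).2
    exact (reducible_box h' hN' h₂ (ih hb hbN)).perm hL

-- Experiments exclude clashes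

theorem Ex.exists_of_mem {L : List Link} {l : Link} (h : LLNet.Ex st L v U W n) (hl : l ∈ L) :
    ∃ W n, l.Ex st v U W n := by
  induction L generalizing W n with
  | nil => simp at hl
  | cons m L ih =>
    obtain ⟨W₁, W₂, n₁, n₂, -, -, h₁, h₂⟩ := ex_cons.1 h
    rcases List.mem_cons.1 hl with rfl | hl
    · exact ⟨_, _, h₁⟩
    · exact ih h₂ hl

/-- Non-emptiness of the multisets allows one to descend into any box. -/
theorem Ex.gstructIn {G L : List Link} (hG : GStructIn G L) (h : LLNet.Ex st L v U W n) :
    ∃ v U W n, LLNet.Ex (A := A) st G v U W n := by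
  induction hG generalizing v U W n with
  | ground => exact ⟨_, _, _, _, h⟩
  | box hl _ ih =>
    obtain ⟨W', n', h'⟩ := h.exists_of_mem hl
    obtain ⟨fs, h0, hf, -⟩ := ex_bang.1 h'
    obtain ⟨f, hfs⟩ := Multiset.exists_mem_of_ne_zero h0
    exact ih (hf f hfs)

/-- The shape of the point of the conclusion of a link other than an axiom. -/
def Link.shape : Link → Bool × Fin 3
  | .tensor _ _ _ => (true, 1)
  | .par _ _ _ => (false, 1)
  | .one _ => (true, 0)
  | .bot _ => (false, 0)
  | .bang _ _ _ => (true, 2)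
  | _ => (false, 2)

theorem Link.Ex.shape_eq {l : Link} {a : ℕ} (h : l.Ex st v U W n) (hl : ¬ l.IsAx)
    (ha : .log a ∈ l.concl) : (v a).shape = l.shape := by
  cases l with
  | ax a b => exact absurd trivial hl
  | cut a b => simp [Link.concl] at ha
  | flat a s => simp [Link.concl] at ha
  | bang B i c =>
    have : a = c := by simpa [Link.concl, Edge.isLog] using ha
    subst this
    obtain ⟨fs, -, -, h, -⟩ := ex_bang.1 h
    rw [h]
    rfl
  | why ss c =>
    have : a = c := by simpa [Link.concl] using ha
    subst this
    obtain ⟨⟨μ, h, -⟩, -⟩ := (ex_why _ _).1 h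
    rw [h]
    rfl
  | _ =>
    simp only [Link.concl, List.mem_singleton, Edge.log.injEq] at ha
    subst ha
    simp only [Link.Ex] at h
    rw [h.1]
    first | rfl | exact D.shape_pair ..

/-- A link other than an axiom determines the sign and the outermost constructor of its conclusion.
Across a cut the signs are opposite and the constructors equal, which leaves only the dual pairs of
links. -/
theorem Ex.not_hasClash {L : List Link} (h : LLNet.Ex st L v U W n) : ¬ HasClash L := by
  rintro ⟨G, hG, a, b, hc, l, hl, m, hm, ha, hb, hla, hma, hd⟩
  obtain ⟨v, U, W, n, h⟩ := h.gstructIn hG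
  obtain ⟨_, _, h₁⟩ := h.exists_of_mem hc
  obtain ⟨_, _, h₂⟩ := h.exists_of_mem hl
  obtain ⟨_, _, h₃⟩ := h.exists_of_mem hm
  have h₁ := congrArg D.shape ((ex_cut _ _).1 h₁).1
  rw [D.shape_neg, h₂.shape_eq hla ha, h₃.shape_eq hma hb] at h₁
  cases l <;> cases m <;> simp_all [Link.shape, Link.IsAx, Link.concl, Link.Dual]

end Reduce

/-! ## Expansion of strict experiments -/

/-- The steps in which no box is erased. -/
inductive NonErasing (N : ℕ) : List Link → List Link → (ℕ → List ℕ) → Prop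
  | ax {L Γ : List Link} {x t : Link} {a b c : ℕ}
      (hx : x = .ax a c ∨ x = .ax c a) (ht : t = .cut a b ∨ t = .cut b a)
      (hL : L.Perm (x :: t :: Γ)) : NonErasing N L (rename (axMap b c) id Γ) (fun s => [s])
  | tensorPar {L Γ : List Link} {t : Link} {a₁ a₂ a b₁ b₂ b : ℕ}
      (ht : t = .cut a b ∨ t = .cut b a)
      (hL : L.Perm (.tensor a₁ a₂ a :: .par b₁ b₂ b :: t :: Γ)) :
      NonErasing N L (.cut a₁ b₁ :: .cut a₂ b₂ :: Γ) (fun s => [s])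
  | oneBot {L Γ : List Link} {t : Link} {a b : ℕ} (ht : t = .cut a b ∨ t = .cut b a)
      (hL : L.Perm (.one a :: .bot b :: t :: Γ)) : NonErasing N L Γ (fun s => [s])
  | bangWhy {L Γ B : List Link} {t : Link} {i a b : ℕ} {ss : List ℕ}
      (ht : t = .cut a b ∨ t = .cut b a) (hss : ss ≠ [])
      (hL : L.Perm (.bang B i a :: .why ss b :: t :: Γ)) :
      NonErasing N L (graft (boxCopy N B i ss) (Γ.map (Link.expand (auxCopies N B ss.length))))
        (auxCopies N B ss.length)
  | box {L Γ B B' : List Link} {i c : ℕ} {θ : ℕ → List ℕ}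
      (hL : L.Perm (.bang B i c :: Γ)) (hB : NonErasing N B B' θ) :
      NonErasing N L (.bang B' i c :: Γ.map (Link.expand θ)) θ

theorem NonErasing.cutStep {N : ℕ} {L L' : List Link} {θ : ℕ → List ℕ} (h : NonErasing N L L' θ) :
    CutStep N L L' θ := by
  induction h with
  | ax hx ht hL => exact .ax hx ht hL
  | tensorPar ht hL => exact .tensorPar ht hL
  | oneBot ht hL => exact .oneBot ht hL
  | bangWhy ht _ hL => exact .bangWhy ht hL
  | box hL _ ih => exact .box hL ih

/-- No line disappears, so a `?`-link with premises keeps some. Its strict condition in the reduct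
can therefore be read back in the original structure. -/
theorem NonErasing.ne_nil {N : ℕ} {L L' : List Link} {θ : ℕ → List ℕ} (h : NonErasing N L L' θ)
    (s : ℕ) : θ s ≠ [] := by
  induction h with
  | bangWhy ht hss _ =>
    rw [auxCopies]
    split_ifs
    · simpa using hss
    · simp
  | box _ _ ih => exact ih
  | _ => simp

section Expand

variable {A : Type u} {st : Bool} {N : ℕ} {B : List Link} {i : ℕ} {ss : List ℕ}

/-- The experiments of the links that result from dispatching copies of `B` come from experiments
of `l` and of `B`. -/
def Link.Ungraftable (A : Type u) (st : Bool) (N : ℕ) (B : List Link) (i : ℕ) (ss : List ℕ)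
    (l : Link) : Prop :=
  ∀ ⦃v : ℕ → D A⦄ ⦃U W' : ℕ → Multiset (D A)⦄ ⦃n : ℕ⦄,
    LLNet.Ex st (l.graft (boxCopy N B i ss)) v U W' n →
    (LLNet.src (l.graft (boxCopy N B i ss))).Nodup →
    (∀ B' i' c', l = .bang B' i' c' → ∀ e ∈ LLNet.tgt B', e.name < N ∧ ∀ s ∈ ss, e ≠ .str s) →
    (∀ a s, l = .flat a s → s ∈ ss → ∀ t, .str t ∈ LLNet.tgt B →
      U (t + offset N ss s) = W' (t + offset N ss s)) →
    ∃ W F m, l.Ex st v U W m ∧ mainHom A i F = keepHom A ss W ∧ (∀ s, ∀ f ∈ F s, f.Of st B) ∧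
      W' = cutHom A ss W + copiesHom A N ss F

theorem str_mem_src_graft {L : List Link} {a s t : ℕ} (hs : s ∈ ss) (hl : .flat a s ∈ L)
    (ht : .str t ∈ src B) : .str (t + offset N ss s) ∈ src (graft (boxCopy N B i ss) L) := by
  rw [src_graft]
  refine Multiset.mem_bind.2 ⟨.str s, mem_src.2 ⟨_, hl, by simp⟩, ?_⟩
  rw [graftBy_of_mem hs]
  exact Multiset.mem_map.2 ⟨_, ht, rfl⟩

theorem Ex.ungraft_of_forall (hB : tgt B ⊆ src B) {L : List Link}
    (hL : ∀ l ∈ L, l.Ungraftable A st N B i ss)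
    {v : ℕ → D A} {U W' : ℕ → Multiset (D A)} {n : ℕ}
    (h : LLNet.Ex st (graft (boxCopy N B i ss) L) v U W' n)
    (hnd : (src (graft (boxCopy N B i ss) L)).Nodup)
    (ht : ∀ B' i' c', .bang B' i' c' ∈ L → ∀ e ∈ tgt B', e.name < N ∧ ∀ s ∈ ss, e ≠ .str s)
    (hU : ∀ a s, .flat a s ∈ L → s ∈ ss → ∀ t, .str t ∈ tgt B →
      U (t + offset N ss s) = W' (t + offset N ss s)) :
    ∃ W F m, LLNet.Ex st L v U W m ∧ mainHom A i F = keepHom A ss W ∧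
      (∀ s, ∀ f ∈ F s, f.Of st B) ∧ W' = cutHom A ss W + copiesHom A N ss F := by
  induction L generalizing W' n with
  | nil =>
    rw [graft, ex_nil] at h
    obtain ⟨rfl, rfl⟩ := h
    exact ⟨0, 0, 0, ex_nil.2 ⟨rfl, rfl⟩, by simp, by simp, by simp⟩
  | cons l L ih =>
    rw [graft] at h hnd
    obtain ⟨W₁', W₂', n₁, n₂, rfl, rfl, h₁, h₂⟩ := ex_append.1 h
    rw [src_append, Multiset.nodup_add] at hnd
    have hd : ∀ e, e ∈ _ → e ∉ _ := fun _ => Multiset.disjoint_left.1 hnd.2.2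
    obtain ⟨W₁, F₁, m₁, h₃, h₄, h₅, rfl⟩ := hL l (by simp) h₁ hnd.1
      (fun B' i' c' hl => ht B' i' c' (by simp [hl])) (by
        rintro a s rfl hs t ht
        rw [hU a s (by simp) hs t ht, Pi.add_apply, h₂.eq_zero, add_zero]
        refine hd _ ?_
        have := str_mem_src_graft (N := N) (i := i) hs (List.mem_singleton_self (Link.flat a s)) (hB ht)
        simpa [graft] using this)
    obtain ⟨W₂, F₂, m₂, h₆, h₇, h₈, rfl⟩ := ih (fun m hm => hL m (by simp [hm])) h₂ hnd.2.1
      (fun B' i' c' hl => ht B' i' c' (by simp [hl])) (by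
        intro a s hl hs t ht
        rw [hU a s (by simp [hl]) hs t ht, Pi.add_apply, h₁.eq_zero, zero_add]
        exact fun h' => hd _ h' (str_mem_src_graft hs hl (hB ht)))
    refine ⟨W₁ + W₂, F₁ + F₂, m₁ + m₂, ex_cons.2 ⟨_, _, _, _, rfl, rfl, h₃, h₆⟩, ?_, ?_, ?_⟩
    · rw [map_add, map_add, h₄, h₇]
    · intro s f hf
      rw [Pi.add_apply, Multiset.mem_add] at hf
      exact hf.elim (h₅ s f) (h₈ s f)
    · rw [map_add, map_add]
      abel

/-- The part of an experiment that lies on a grafted copy is, after renaming, an experiment of `B`,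
and the adjoining cut says that its main conclusion is dual to the premise of the former `♭`-link.
-/
theorem Link.ungraftable (hB : LLNet.tgt B ⊆ LLNet.src B) (hsn : ss.Nodup) (l : Link) :
    l.Ungraftable A st N B i ss := by
  refine Link.ind (P := Link.Ungraftable A st N B i ss) ?_ ?_ l
  · intro B₁ i₁ c₁ ih v U W' n h hnd ht _
    have ht := ht B₁ i₁ c₁ rfl
    simp only [Link.graft, src_cons, Link.src_bang, src_nil, add_zero, Multiset.nodup_cons] at hnd
    rw [Link.graft, ex_cons] at h
    obtain ⟨W₁, W₂, n₁, n₂, rfl, rfl, h, h'⟩ := h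
    obtain ⟨rfl, rfl⟩ := ex_nil.1 h'
    obtain ⟨fs, h0, hf, hc, rfl, rfl⟩ := ex_bang.1 h
    have key : ∀ f : Pt A, ∃ W F m, f ∈ fs → LLNet.Ex st B₁ f.lab W W m ∧
        mainHom A i F = keepHom A ss W ∧ (∀ s, ∀ f ∈ F s, f.Of st B) ∧
        f.str = cutHom A ss W + copiesHom A N ss F := by
      intro f
      by_cases hfs : f ∈ fs
      · obtain ⟨W, F, m, h₁, h₂, h₃, h₄⟩ := Ex.ungraft_of_forall hB ih (hf f hfs) hnd.2
          (fun B' i' c' hl e he => ht e (mem_tgt.2 ⟨_, hl, by simp [Link.tgt, he]⟩))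
          fun _ _ _ _ _ _ => rfl
        refine ⟨W, F, m, fun _ => ⟨h₁.congr (fun _ _ => rfl) fun s hs => ?_, h₂, h₃, h₄⟩⟩
        have : s < N := (ht _ hs).1
        rw [h₄, Pi.add_apply, copiesHom_of_lt this, cutHom_apply,
          if_neg fun h' => (ht _ hs).2 s h' rfl, add_zero]
      · exact ⟨0, 0, 0, fun h => absurd h hfs⟩
    choose W F m key using key
    refine ⟨(fs.map W).sum, (fs.map F).sum, 1 + (fs.map m).sum, ex_bang.2
      ⟨fs.map fun f => ⟨f.lab, W f, m f⟩, by simpa using h0, ?_, ?_, ?_, ?_⟩, ?_, ?_, ?_⟩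
    · intro p hp
      obtain ⟨f, hfs, rfl⟩ := Multiset.mem_map.1 hp
      exact (key f hfs).1
    · rw [hc, Multiset.map_map]
      rfl
    · rw [Multiset.map_map]
      rfl
    · rw [Multiset.map_map]
      rfl
    · rw [map_multiset_sum, map_multiset_sum, Multiset.map_map, Multiset.map_map]
      congr 1
      exact Multiset.map_congr rfl fun f hf => (key f hf).2.1
    · intro s p hp
      have e : (fs.map F).sum s = (fs.map fun f => F f s).sum := by
        rw [show (fs.map F).sum s = Pi.evalAddMonoidHom (fun _ : ℕ => Multiset (Pt A)) s (fs.map F).sum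
          from rfl, map_multiset_sum, Multiset.map_map]
        rfl
      rw [e] at hp
      obtain ⟨q, hq, hp⟩ := Multiset.mem_join.1 (show p ∈ (fs.map fun f => F f s).join from hp)
      obtain ⟨f, hf, rfl⟩ := Multiset.mem_map.1 hq
      exact (key f hf).2.2.1 s p hp
    · rw [add_zero, map_multiset_sum, map_multiset_sum, Multiset.map_map, Multiset.map_map,
        ← Multiset.sum_map_add]
      congr 1
      exact Multiset.map_congr rfl fun f hf => (key f hf).2.2.2
  · intro l hl v U W' n h hnd ht hU
    have key : LLNet.Ex st [l] v U W' n → (∀ W n, l.Ex st v U W n → keepHom A ss W = 0) →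
        (∀ W n, l.Ex st v U W n → cutHom A ss W = W) →
        ∃ W F m, l.Ex st v U W m ∧ mainHom A i F = keepHom A ss W ∧ (∀ s, ∀ f ∈ F s, f.Of st B) ∧
          W' = cutHom A ss W + copiesHom A N ss F := by
      intro h h0 h1
      obtain ⟨W₁, W₂, n₁, n₂, rfl, rfl, h₁, h₂⟩ := ex_cons.1 h
      obtain ⟨rfl, rfl⟩ := ex_nil.1 h₂
      exact ⟨W₁, 0, n₁, h₁, by rw [h0 _ _ h₁, map_zero], by simp, by rw [h1 _ _ h₁, map_zero]⟩
    cases l with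
    | bang B i c => exact absurd rfl (hl B i c)
    | flat a s =>
      rw [Link.graft] at h
      by_cases hs : s ∈ ss
      · have hU := hU a s rfl hs
        rw [boxCopy_of_mem hs] at h
        obtain ⟨m, -, h₁, h₂⟩ := (ex_cons_of_iff ex_cut).1 h
        have h₃ := LLNet.Ex.of_rename (add_left_injective _) h₂
        -- The `♭`-link gets back its single point, and the labels of the copy, translated back,
        -- form its single experiment.
        refine ⟨Pi.single s {v a}, Pi.single s {⟨v ∘ (· + offset N ss s),
          W' ∘ (· + offset N ss s), m⟩}, 1, by simp [Link.Ex], ?_, ?_, ?_⟩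
        · funext y
          rw [mainHom_apply, keepHom_apply]
          by_cases hy : y = s
          · subst hy
            simp [hs, h₁]
          · simp [Pi.single_eq_of_ne hy]
        · intro y f hf
          by_cases hy : y = s
          · subst hy
            rw [Pi.single_eq_same, Multiset.mem_singleton] at hf
            subst hf
            exact h₃.congr (fun _ _ => rfl) fun t ht => (hU t ht).symm
          · simp [Pi.single_eq_of_ne hy] at hf
        · rw [copiesHom_single hs hsn]
          funext y
          rw [Pi.add_apply, cutHom_apply, shiftHom_apply]
          have : (if y ∈ ss then 0 else (Pi.single s {v a} : ℕ → Multiset (D A)) y) = 0 := by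
            split_ifs with hy
            · rfl
            · exact Pi.single_eq_of_ne (by rintro rfl; exact hy hs) _
          rw [this, zero_add]
          split_ifs with hy
          · simp [Nat.sub_add_cancel hy]
          · refine h₂.eq_zero ?_
            rw [LLNet.src_rename]
            intro h'
            obtain ⟨x, -, hx⟩ := Multiset.mem_map.1 h'
            have := congrArg Edge.name hx
            cases x <;> simp [Edge.map, Edge.name] at this hx
            omega
      · rw [boxCopy_of_notMem hs] at h
        refine key h ?_ ?_
        · intro W n h'
          simp only [Link.Ex] at h'
          funext y
          rw [keepHom_apply, h'.1]
          split_ifs with hy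
          · have : y ≠ s := by rintro rfl; exact hs hy
            rw [Pi.single_eq_of_ne this]
            rfl
          · rfl
        · intro W n h'
          simp only [Link.Ex] at h'
          funext y
          rw [cutHom_apply, h'.1]
          split_ifs with hy
          · have : y ≠ s := by rintro rfl; exact hs hy
            rw [Pi.single_eq_of_ne this]
          · rfl
    | _ =>
      rw [Link.graft] at h
      refine key h ?_ ?_ <;>
      · intro W n h'
        simp only [Link.Ex] at h'
        rw [h'.2.1, map_zero]

/-- Strict experiments of `L'`, a reduct of `L`, come from strict experiments of `L`. -/
def Expandable (A : Type u) (L L' : List Link) (θ : ℕ → List ℕ) : Prop :=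
  ∀ ⦃v' : ℕ → D A⦄ ⦃W' : ℕ → Multiset (D A)⦄ ⦃n' : ℕ⦄, Ex true L' v' W' W' n' →
    ∃ v W n, Ex true L v W W n ∧
      (∀ x, .log x ∈ src L → .log x ∉ tgt L → v x = v' x) ∧
      ∀ s, .str s ∈ src L → .str s ∉ tgt L → W s = ((θ s).map W').sum

theorem Expandable.perm {L L₁ L' : List Link} {θ : ℕ → List ℕ} (hp : L.Perm L₁)
    (h : Expandable A L₁ L' θ) : Expandable A L L' θ := by
  intro v W n he
  obtain ⟨v, W, n, h₁, h₂⟩ := h he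
  rw [src_perm hp, tgt_perm hp]
  exact ⟨v, W, n, (ex_perm hp).2 h₁, h₂⟩

variable {v v' : ℕ → D A} {U U' W : ℕ → Multiset (D A)} {n : ℕ}

/-- The condition `h0` prevents a `?`-link with premises from having become a weakening, whose label
would be arbitrary. -/
theorem Ex.of_expand {L : List Link} {θ : ℕ → List ℕ}
    (h : LLNet.Ex true (L.map (Link.expand θ)) v U' W n) (h0 : ∀ s, θ s ≠ [])
    (hθ : ∀ ss c, .why ss c ∈ L → ∀ s ∈ ss, U s = ((θ s).map U').sum) :
    LLNet.Ex true L v U W n := by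
  induction L generalizing W n with
  | nil => exact ex_nil.2 (ex_nil.1 h)
  | cons l L ih =>
    obtain ⟨W₁, W₂, n₁, n₂, rfl, rfl, h₁, h₂⟩ := ex_cons.1 h
    refine ex_cons.2 ⟨W₁, W₂, n₁, n₂, rfl, rfl, ?_,
      ih h₂ fun ss c hl => hθ ss c (List.mem_cons_of_mem _ hl)⟩
    by_cases hw : ∃ ss c, l = .why ss c
    · obtain ⟨ss, c, rfl⟩ := hw
      obtain ⟨⟨μ, h₃, h₄, h₅⟩, h₆⟩ := (ex_why _ _).1 h₁
      have : ((ss.flatMap θ).map U').sum = (ss.map U).sum := by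
        rw [List.map_congr_left (hθ ss c (List.mem_cons_self ..))]
        simp only [List.flatMap, List.map_flatten, List.sum_flatten, List.map_map, Function.comp_def]
      rw [this] at h₄ h₅
      refine (ex_why _ _).2 ⟨⟨μ, h₃, h₄, fun h hss => h₅ h ?_⟩, h₆⟩
      obtain ⟨s, ss, rfl⟩ := List.exists_cons_of_ne_nil hss
      simp [h0]
    · push Not at hw
      rw [Link.expand_of_ne hw] at h₁
      cases l with
      | why ss c => exact absurd rfl (hw ss c)
      | _ => simpa only [Link.Ex] using h₁

theorem Ex.of_rename_ax {x t : Link} {a b c : ℕ} {Γ : List Link}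
    (ht : t = .cut a b ∨ t = .cut b a) (h : WF (x :: t :: Γ))
    (he : LLNet.Ex st (rename (axMap b c) id Γ) v' U W n) :
    LLNet.Ex st Γ (fun d => v' (axMap b c d)) U W n := by
  have key : ∀ Γ' ⊆ Γ, ∀ {W n}, LLNet.Ex st (rename (axMap b c) id Γ') v' U W n →
      LLNet.Ex st Γ' (fun d => v' (axMap b c d)) U W n := by
    intro Γ' hs
    induction Γ' with
    | nil =>
      intro W n he
      exact ex_nil.2 (ex_nil.1 (by simpa [rename] using he))
    | cons l Γ' ih =>
      intro W n he
      rw [rename] at he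
      obtain ⟨W₁, W₂, n₁, n₂, rfl, rfl, h₁, h₂⟩ := ex_cons.1 he
      refine ex_cons.2 ⟨W₁, W₂, n₁, n₂, rfl, rfl, ?_, ih (fun m hm => hs (by simp [hm])) h₂⟩
      have hl : l ∈ Γ := hs (by simp)
      cases l with
      | bang B i d =>
        rw [h.rename_box ht hl] at h₁
        exact ex_bang.2 (ex_bang.1 h₁)
      | _ => simpa only [Link.rename, Link.Ex, List.map_id, id_eq] using h₁
  exact key Γ (fun _ h => h) he

theorem expandable_ax {x t : Link} {a b c : ℕ} {Γ : List Link}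
    (ht : t = .cut a b ∨ t = .cut b a) (hx : x = .ax a c ∨ x = .ax c a)
    (h : WF (x :: t :: Γ)) :
    Expandable A (x :: t :: Γ) (rename (axMap b c) id Γ) fun s => [s] := by
  intro v' W n he
  have hbc := h.ne_of_ax hx ht
  have hS := h.src_nodup
  have hT := h.tgt_nodup
  have hsub := h.subset
  simp only [src_cons, tgt_cons, src_ax_of_or hx, tgt_ax_of_or hx, src_cut_of_or ht,
    tgt_cut_of_or ht, zero_add, Multiset.nodup_add] at hS hT
  have ha : .log a ∉ src Γ := fun h' =>
    (Multiset.disjoint_left.1 hS.2.2 : _ → Edge.log a ∉ _) (by simp) h'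
  have ha' : .log a ∉ tgt Γ := fun h' =>
    (Multiset.disjoint_left.1 hT.2.2 : _ → Edge.log a ∉ _) (by simp) h'
  have hab : a ≠ b := by
    rintro rfl
    simp at hT
  have hac : a ≠ c := by
    rintro rfl
    simp at hS
  -- The edge `b` regains the label of `c`, and `a` the dual one.
  refine ⟨fun d => if d = a then (v' c).neg else v' (axMap b c d), W, n + 1 + 1,
    (ex_cons_of_iff (ex_ax_of_or hx)).2 ⟨_, rfl, ?_,
    (ex_cons_of_iff (ex_cut_of_or ht)).2 ⟨_, rfl, ?_, ?_⟩⟩, ?_, by simp⟩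
  · simp [hac.symm, axMap_of_ne hbc.symm]
  · simp [hab.symm]
  · refine (he.of_rename_ax ht h).congr (fun y hy => if_neg ?_) fun _ _ => rfl
    rintro rfl
    exact hy.elim ha ha'
  · intro y _ hy
    have hya : y ≠ a := by
      rintro rfl
      exact hy (by simp [tgt_cut_of_or ht])
    have hyb : y ≠ b := by
      rintro rfl
      exact hy (by simp [tgt_cut_of_or ht])
    dsimp only
    rw [if_neg hya, axMap_of_ne hyb]

theorem expandable_tensorPar {t : Link} {a₁ a₂ a b₁ b₂ b : ℕ} {Γ : List Link}
    (ht : t = .cut a b ∨ t = .cut b a) (h : WF (.tensor a₁ a₂ a :: .par b₁ b₂ b :: t :: Γ)) :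
    Expandable A (.tensor a₁ a₂ a :: .par b₁ b₂ b :: t :: Γ) (.cut a₁ b₁ :: .cut a₂ b₂ :: Γ)
      fun s => [s] := by
  intro v' W n he
  obtain ⟨n₁, rfl, h₁, he⟩ := (ex_cons_of_iff ex_cut).1 he
  obtain ⟨n₂, rfl, h₂, he⟩ := (ex_cons_of_iff ex_cut).1 he
  have hS := h.src_nodup
  have hT := h.tgt_nodup
  simp [tgt_cut_of_or ht, src_cut_of_or ht] at hS hT
  set w : ℕ → D A := fun d => if d = a then D.pair true (v' a₁) (v' a₂) else
    if d = b then D.pair false (v' b₁) (v' b₂) else v' d with hw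
  have hw' : ∀ d, d ≠ a → d ≠ b → w d = v' d := fun d h h' => by simp [hw, h, h']
  have hwa : w a = D.pair true (v' a₁) (v' a₂) := by simp [hw]
  have hwb : w b = D.pair false (v' b₁) (v' b₂) := by
    have : b ≠ a := by grind
    simp [hw, this]
  refine ⟨w, W, n₂ + 1 + 1 + 1, (ex_cons_of_iff ex_tensor).2 ⟨_, rfl, ?_,
    (ex_cons_of_iff ex_par).2 ⟨_, rfl, ?_, (ex_cons_of_iff (ex_cut_of_or ht)).2 ⟨_, rfl, ?_,
      he.congr (fun y hy => hw' y ?_ ?_) fun _ _ => rfl⟩⟩⟩, ?_, by simp⟩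
  · rw [hwa, hw' a₁, hw' a₂] <;> grind
  · rw [hwb, hw' b₁, hw' b₂] <;> grind
  · rw [hwa, hwb, D.neg_pair, h₁, h₂]
    rfl
  · rintro rfl
    grind
  · rintro rfl
    grind
  · intro y _ hy
    simp [tgt_cut_of_or ht] at hy
    exact hw' y (by grind) (by grind)

theorem expandable_oneBot {t : Link} {a b : ℕ} {Γ : List Link}
    (ht : t = .cut a b ∨ t = .cut b a) (h : WF (.one a :: .bot b :: t :: Γ)) :
    Expandable A (.one a :: .bot b :: t :: Γ) Γ fun s => [s] := by
  intro v' W n he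
  have hS := h.src_nodup
  have hT := h.tgt_nodup
  simp [tgt_cut_of_or ht, src_cut_of_or ht] at hS hT
  set w : ℕ → D A := fun d => if d = a then D.atom true none else
    if d = b then D.atom false none else v' d with hw
  have hw' : ∀ d, d ≠ a → d ≠ b → w d = v' d := fun d h h' => by simp [hw, h, h']
  have hwa : w a = D.atom true none := by simp [hw]
  have hwb : w b = D.atom false none := by
    have : b ≠ a := by grind
    simp [hw, this]
  refine ⟨w, W, n + 1 + 1 + 1, (ex_cons_of_iff ex_one).2 ⟨_, rfl, hwa,
    (ex_cons_of_iff ex_bot).2 ⟨_, rfl, hwb, (ex_cons_of_iff (ex_cut_of_or ht)).2 ⟨_, rfl, ?_,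
      he.congr (fun y hy => hw' y ?_ ?_) fun _ _ => rfl⟩⟩⟩, ?_, by simp⟩
  · rw [hwa, hwb]
    rfl
  · rintro rfl
    grind
  · rintro rfl
    grind
  · intro y _ hy
    simp [tgt_cut_of_or ht] at hy
    exact hw' y (by grind) (by grind)

/-- The experiments found on all the copies are gathered into one multiset `G` of experiments of the
box. Their main conclusions are dual to the points of the premises of the `?`-link, so the cut can
be restored. -/
theorem expandable_bangWhy {t : Link} {a b : ℕ} {Γ : List Link}
    (ht : t = .cut a b ∨ t = .cut b a) (hss : ss ≠ [])
    (h : WF (.bang B i a :: .why ss b :: t :: Γ))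
    (hN : ∀ e ∈ src (.bang B i a :: .why ss b :: t :: Γ), e.name < N) :
    Expandable A (.bang B i a :: .why ss b :: t :: Γ)
      (graft (boxCopy N B i ss) (Γ.map (Link.expand (auxCopies N B ss.length))))
      (auxCopies N B ss.length) := by
  intro v' W' n' he
  have hB : WF B := h.box (List.mem_cons_self ..)
  obtain ⟨Y, hY, hYl⟩ := exists_out_box hB (h.good _ (List.mem_cons_self ..))
  obtain ⟨hssn, hssB, hssΓ, hsst, ha, hb, ha', hb', hBΓ, hab, -, -⟩ := h.bangWhy_facts ht hY
  have hN₁ : (∀ e ∈ src B, e.name < N) ∧ ∀ e ∈ src Γ, e.name < N :=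
    ⟨fun e he => hN e (by simp [he]), fun e he => hN e (by simp [he])⟩
  have hsub := h.subset
  have hNt : ∀ e ∈ tgt Γ, e.name < N := fun e he => hN e (hsub (by simp [he]))
  have hne : ∀ s, auxCopies N B ss.length s ≠ [] :=
    (NonErasing.bangWhy (i := i) (Γ := Γ) ht hss (.refl _)).ne_nil
  obtain ⟨WΓ, F, m, hΓ, hF, hFB, rfl⟩ := Ex.ungraft_of_forall hB.subset
    (fun l _ => l.ungraftable hB.subset hssn) he (wf_bangWhy ht h hN).1.src_nodup (by
      intro B' i' c' hl e he
      rw [bang_mem_map_expand] at hl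
      have : e ∈ tgt Γ := mem_tgt.2 ⟨_, hl, by simp [Link.tgt, he]⟩
      refine ⟨hNt _ this, ?_⟩
      rintro s hs rfl
      exact hsst s hs this) fun _ _ _ _ _ _ => rfl
  have hYB : ∀ {s}, .str s ∈ src B → .str s ∉ tgt B → .str s ∈ Y := by
    intro s hs hs'
    simpa using (mem_out hB.src_nodup hY).2 ⟨hs, hs'⟩
  have hW0 : ∀ s, .str s ∈ src B → WΓ s = 0 := fun s hs => hΓ.eq_zero (by
    rw [src_expand]
    exact Multiset.disjoint_left.1 hBΓ hs)
  have heq : ∀ s, .str s ∈ src B ∨ .str s ∈ src Γ → .str s ∉ tgt B → s ∉ ss →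
      (((ss.map F).sum.map Pt.str).sum + WΓ) s =
      ((auxCopies N B ss.length s).map (cutHom A ss WΓ + copiesHom A N ss F)).sum := by
    intro s hs hs' hss
    by_cases hsB : .str s ∈ src B
    · rw [auxCopies_of_mem hB hY hssn (hYB hsB hs')]
      have : ∀ s' ∈ ss, (cutHom A ss WΓ + copiesHom A N ss F) (s + offset N ss s') =
          ((F s').map fun f => f.str s).sum := by
        intro s' hs'
        rw [Pi.add_apply, copiesHom_offset hFB hN₁.1 hssn hs' (show s < N from hN₁.1 _ hsB), cutHom_apply,
          hΓ.eq_zero, ite_self, zero_add]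
        intro h'
        rw [src_expand] at h'
        have := hN₁.2 _ h'
        have := le_offset (N := N) (ss := ss) s'
        simp only [Edge.name] at *
        omega
      rw [List.map_map, List.map_congr_left (f := _ ∘ _)
        (g := fun s' => ((F s').map fun f => f.str s).sum) this, Pi.add_apply, hW0 s hsB, add_zero,
        sum_str_apply]
      clear * -
      induction ss with
      | nil => simp
      | cons s' ss ih => simp [ih]
    · have := hN₁.2 _ (hs.resolve_left hsB)
      rw [auxCopies_of_notMem hsB]
      have h0 : ((ss.map F).sum.map Pt.str).sum s = 0 := by
        rw [sum_str_apply]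
        refine Multiset.sum_eq_zero ?_
        simp only [Multiset.mem_map, forall_exists_index, and_imp, forall_apply_eq_imp_iff₂]
        intro f hf
        obtain ⟨s', hs'⟩ : ∃ s', f ∈ F s' := by
          clear * - hf
          induction ss with
          | nil => simp at hf
          | cons s' ss ih =>
            rw [List.map_cons, List.sum_cons, Multiset.mem_add] at hf
            exact hf.elim (fun h => ⟨_, h⟩) ih
        exact (hFB s' f hs').eq_zero hsB
      simp [copiesHom_of_lt (show s < N from this), cutHom_apply, hss, h0]
  have hdisj : ∀ e ∈ tgt Γ, e ∉ tgt B := by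
    have hT := h.tgt_nodup
    rw [tgt_cons, Multiset.nodup_add] at hT
    intro e he he'
    exact (Multiset.disjoint_left.1 hT.2.2 : _ → e ∉ _) (by simp [Link.tgt, he']) (by simp [he])
  have hmem : ∀ s, .str s ∈ src (.bang B i a :: .why ss b :: t :: Γ) →
      .str s ∈ src B ∨ .str s ∈ src Γ := by
    intro s hs
    simpa [src_cut_of_or ht] using hs
  set G := (ss.map F).sum with hG
  have hGB : ∀ f ∈ G, f.Of true B := by
    intro f hf
    obtain ⟨s', hs'⟩ : ∃ s', f ∈ F s' := by
      clear * - hf hG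
      rw [hG] at hf
      clear hG
      induction ss with
      | nil => simp at hf
      | cons s' ss ih =>
        rw [List.map_cons, List.sum_cons, Multiset.mem_add] at hf
        exact hf.elim (fun h => ⟨_, h⟩) ih
    exact hFB s' f hs'
  have hGm : G.map (fun f => (f.lab i).neg) = (ss.map WΓ).sum := by
    have : ∀ s ∈ ss, WΓ s = (F s).map fun f => (f.lab i).neg := by
      intro s hs
      have := congrFun hF s
      rw [mainHom_apply, keepHom_apply, if_pos hs] at this
      exact this.symm
    rw [List.map_congr_left this, hG]
    clear * -
    induction ss with
    | nil => simp
    | cons s' ss ih => simp [ih]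
  -- The `?`-link has a premise, its `♭`-link has been given a point, and each point comes with an
  -- experiment of the box. Without premises `G` would be empty.
  have hG0 : G ≠ 0 := by
    obtain ⟨s, ss', hs⟩ := List.exists_cons_of_ne_nil hss
    have hs' : s ∈ ss := by simp [hs]
    have := hΓ.ne_zero (s := s) (by rw [src_expand]; exact hssΓ s hs')
    intro h0
    rw [h0, Multiset.map_zero, hs, List.map_cons, List.sum_cons] at hGm
    exact this (add_eq_zero.1 hGm.symm).1
  set w : ℕ → D A := fun d => if d = a then D.bag true (G.map fun f => f.lab i) else
    if d = b then D.bag false (ss.map WΓ).sum else v' d with hw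
  have hw' : ∀ d, d ≠ a → d ≠ b → w d = v' d := fun d h h' => by simp [hw, h, h']
  have hwa : w a = D.bag true (G.map fun f => f.lab i) := by simp [hw]
  have hwb : w b = D.bag false (ss.map WΓ).sum := by simp [hw, hab.symm]
  have hWs : (ss.map ((G.map Pt.str).sum + WΓ)).sum = (ss.map WΓ).sum := by
    congr 1
    refine List.map_congr_left fun s hs => ?_
    rw [Pi.add_apply, sum_str_apply, Multiset.sum_eq_zero, zero_add]
    simp only [Multiset.mem_map, forall_exists_index, and_imp, forall_apply_eq_imp_iff₂]
    exact fun f hf => (hGB f hf).eq_zero (hssB s hs)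
  refine ⟨w, (G.map Pt.str).sum + WΓ, (1 + (G.map Pt.size).sum) + (m + 1 + 1),
    ex_cons.2 ⟨_, _, _, _, rfl, rfl, ex_bang.2 ⟨G, hG0, hGB, hwa, rfl, rfl⟩,
      (ex_cons_of_iff ex_why).2 ⟨_, rfl, ⟨_, hwb, hWs.le, fun _ _ => hWs.symm⟩,
      (ex_cons_of_iff (ex_cut_of_or ht)).2 ⟨_, rfl, ?_, ?_⟩⟩⟩, ?_, ?_⟩
  · rw [hwa, hwb, D.neg_bag, ← hGm, Multiset.map_map]
    simp [D.neg_neg]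
  · refine (hΓ.of_expand (v := v') (U := (G.map Pt.str).sum + WΓ) hne ?_).congr (fun x hx => hw' x ?_ ?_) fun _ _ => rfl
    · intro ss' c hw s hs
      have hs' : .str s ∈ tgt Γ := mem_tgt.2 ⟨_, hw, by simp [hs]⟩
      exact heq s (hmem s (hsub (by simp [hs']))) (hdisj _ hs') fun h' => hsst s h' hs'
    · rintro rfl
      exact hx.elim ha ha'
    · rintro rfl
      exact hx.elim hb hb'
  · intro x _ hx
    simp only [tgt_cons, tgt_cut_of_or ht] at hx
    refine hw' x ?_ ?_ <;>
    · rintro rfl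
      exact hx (by simp)
  · intro s hs hs'
    simp only [tgt_cons, Link.tgt, Multiset.mem_add, Multiset.mem_cons, not_or] at hs'
    exact heq s (hmem s hs) hs'.1.2 fun h' => hs'.2.1 (by simpa using h')

theorem expandable_box {B' Γ : List Link} {c : ℕ} {θ : ℕ → List ℕ}
    (h : WF (.bang B i c :: Γ)) (hN : ∀ e ∈ src (.bang B i c :: Γ), e.name < N)
    (hst : StepRel N B B' θ) (hθ : ∀ s, θ s ≠ []) (ih : Expandable A B B' θ) :
    Expandable A (.bang B i c :: Γ) (.bang B' i c :: Γ.map (Link.expand θ)) θ := by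
  intro v W' n he
  have hB : WF B := h.box (List.mem_cons_self ..)
  obtain ⟨-, -, hBs, hib, hit, -⟩ := good_bang.1 (h.good _ (List.mem_cons_self ..))
  have hS := h.src_nodup
  have hT := h.tgt_nodup
  have hsub := h.subset
  rw [src_cons, Multiset.nodup_add] at hS
  rw [tgt_cons, Multiset.nodup_add] at hT
  have hBΓ : ∀ e ∈ src B, e ∉ src Γ := fun e he he' =>
    (Multiset.disjoint_left.1 hS.2.2 : _ → e ∉ _) (by simp [he]) he'
  have hΓN : ∀ e ∈ src Γ, e.name < N := fun e he => hN e (by simp [he])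
  obtain ⟨W₁, WΓ, n₁, n₂, rfl, rfl, h₁, hΓ⟩ := ex_cons.1 he
  obtain ⟨fs, hfs0, hfs, hc, rfl, rfl⟩ := ex_bang.1 h₁
  have key : ∀ f : Pt A, ∃ f' : Pt A, f ∈ fs → f'.Of true B ∧ f'.lab i = f.lab i ∧
      ∀ s, .str s ∈ src B → .str s ∉ tgt B → f'.str s = ((θ s).map f.str).sum := by
    intro f
    by_cases hf : f ∈ fs
    · obtain ⟨v', W', n', h₁, h₃, h₄⟩ := ih (hfs f hf)
      exact ⟨⟨v', W', n'⟩, fun _ => ⟨h₁, h₃ i hib hit, h₄⟩⟩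
    · exact ⟨f, fun h => absurd h hf⟩
  choose f' hf' using key
  have hex : (Link.bang B i c).Ex true v 0 ((fs.map f').map Pt.str).sum
      (1 + ((fs.map f').map Pt.size).sum) := by
    refine ex_bang.2 ⟨fs.map f', by simpa using hfs0, ?_, ?_, rfl, rfl⟩
    · intro f hf
      obtain ⟨g, hg, rfl⟩ := Multiset.mem_map.1 hf
      exact (hf' g hg).1
    · rw [hc, Multiset.map_map]
      congr 1
      exact Multiset.map_congr rfl fun f hf => (hf' f hf).2.1.symm
  have hW0 : ∀ s, .str s ∉ src Γ → WΓ s = 0 := fun s hs => hΓ.eq_zero (by rwa [src_expand])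
  have hnew : ∀ s, .str s ∈ src B' → .str s ∉ src Γ := by
    intro s hs hs'
    rcases hst.fresh _ hs with h' | h'
    · exact hBΓ _ h' hs'
    · exact absurd (hΓN _ hs') (not_lt.2 h')
  obtain ⟨X, hX⟩ := hB.exists_out
  have hout : ∀ s, .str s ∈ src B → .str s ∉ tgt B → ∀ y ∈ θ s, .str y ∈ src B' := by
    intro s hs hs' y hy
    have : Edge.str s ∈ X := (mem_out hB.src_nodup hX).2 ⟨hs, hs'⟩
    rw [hst.out X hX]
    exact Multiset.mem_add.2 (.inr (Multiset.mem_bind.2 ⟨_, this, by simpa [spread] using hy⟩))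
  have heq : ∀ s, .str s ∈ src (.bang B i c :: Γ) → .str s ∉ tgt B →
      (((fs.map f').map Pt.str).sum + WΓ) s = ((θ s).map ((fs.map Pt.str).sum + WΓ)).sum := by
    intro s hs hs'
    by_cases hsB : .str s ∈ src B
    · have h₂ : (θ s).map ((fs.map Pt.str).sum + WΓ) =
          (θ s).map fun y => (fs.map fun f => f.str y).sum := by
        refine List.map_congr_left fun y hy => ?_
        rw [Pi.add_apply, hW0 _ (hnew y (hout s hsB hs' y hy)), add_zero, sum_str_apply]
      have h₃ : ((θ s).map fun y => (fs.map fun f => f.str y).sum).sum =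
          (fs.map fun f => ((θ s).map f.str).sum).sum := by
        induction θ s with
        | nil => simp
        | cons y l ih => simp [ih, Multiset.sum_map_add]
      rw [h₂, h₃, Pi.add_apply, sum_str_apply, Multiset.map_map, hW0 _ (hBΓ _ hsB), add_zero]
      congr 1
      exact Multiset.map_congr rfl fun f hf => (hf' f hf).2.2 s hsB hs'
    · have hsΓ : .str s ∈ src Γ := by simpa [hsB] using hs
      rw [hst.old s hsB, List.map_singleton, List.sum_singleton, Pi.add_apply, Pi.add_apply,
        h₁.eq_zero (fun h' => hnew s (by simpa using h') hsΓ), hex.eq_zero (by simpa using hsB)]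
  refine ⟨v, ((fs.map f').map Pt.str).sum + WΓ, 1 + ((fs.map f').map Pt.size).sum + n₂,
    ex_cons.2 ⟨_, _, _, _, rfl, rfl, ex_bang.2 (ex_bang.1 hex), hΓ.of_expand hθ ?_⟩,
    fun _ _ _ => rfl, ?_⟩
  · intro ss c' hw s hs
    have hs' : .str s ∈ tgt Γ := mem_tgt.2 ⟨_, hw, by simp [hs]⟩
    refine heq s (hsub (by simp [hs'])) fun h' => ?_
    exact (Multiset.disjoint_left.1 hT.2.2 : _ → Edge.str s ∉ _) (by simp [Link.tgt, h']) hs'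
  · intro s hs hs'
    exact heq s hs fun h' => hs' (by simp [Link.tgt, h'])

theorem NonErasing.expandable {N : ℕ} {L L' : List Link} {θ : ℕ → List ℕ}
    (hst : NonErasing N L L' θ) (h : WF L) (hN : ∀ e ∈ src L, e.name < N) : Expandable A L L' θ := by
  induction hst with
  | ax hx ht hL => exact (expandable_ax ht hx (h.perm hL)).perm hL
  | tensorPar ht hL => exact (expandable_tensorPar ht (h.perm hL)).perm hL
  | oneBot ht hL => exact (expandable_oneBot ht (h.perm hL)).perm hL
  | bangWhy ht hss hL =>
    exact (expandable_bangWhy ht hss (h.perm hL) (src_perm hL ▸ hN)).perm hL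
  | box hL hB ih =>
    have h' := h.perm hL
    have hN' := hN
    rw [src_perm hL] at hN'
    have hb := h'.box (List.mem_cons_self ..)
    have hbN := fun e he => hN' e (mem_src.2 ⟨_, List.mem_cons_self .., by
      rw [Link.src_bang]; exact Multiset.mem_cons_of_mem he⟩)
    have h₂ := (wf_step hB.cutStep hb hbN).2
    exact (expandable_box h' hN' h₂ hB.ne_nil (ih hb hbN)).perm hL

end Expand

/-! ## Experiments and their labels -/

section Experiments

variable {A : Type u} {st : Bool} {v : ℕ → D A} {U W : ℕ → Multiset (D A)} {n : ℕ}

theorem WF.exists_str_source {L : List Link} (h : WF L) {l : Link} (hl : l ∈ L) {s : ℕ}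
    (hs : .str s ∈ l.prem) : ∃ m ∈ L, .str s ∈ m.concl := by
  have hst : .str s ∈ tgt L := mem_tgt.2 ⟨l, hl, l.prem_subset_tgt hs⟩
  obtain ⟨m, hm, hms⟩ := mem_src.1 (h.subset hst)
  refine ⟨m, hm, ?_⟩
  by_cases hb : ∃ B i c, m = .bang B i c
  · obtain ⟨B, i, c, rfl⟩ := hb
    rw [str_mem_concl_bang, mem_conclusions (h.box hm)]
    refine ⟨by simpa using hms, fun h' => ?_⟩
    have := h.eq_of_tgt hl hm (l.prem_subset_tgt hs) (by simp [Link.tgt, h'])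
    subst this
    simp [Link.prem] at hs
  · push Not at hb
    have := Link.src_eq_concl hb
    rw [this] at hms
    exact hms

theorem Ex.exists_of_mem_of_nodup {L : List Link} {l : Link} (h : LLNet.Ex st L v U W n)
    (hL : (src L).Nodup) (hl : l ∈ L) :
    ∃ W' n, l.Ex st v U W' n ∧ ∀ s, .str s ∈ l.src → W s = W' s := by
  obtain ⟨L₁, L₂, rfl⟩ := List.append_of_mem hl
  have hp : (L₁ ++ l :: L₂).Perm (l :: (L₁ ++ L₂)) := List.perm_middle
  rw [src_perm hp, src_cons, Multiset.nodup_add] at hL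
  obtain ⟨W₁, W₂, n₁, n₂, rfl, -, h₁, h₂⟩ := ex_cons.1 ((ex_perm hp).1 h)
  refine ⟨W₁, n₁, h₁, fun s hs => ?_⟩
  rw [Pi.add_apply, h₂.eq_zero (Multiset.disjoint_left.1 hL.2.2 hs), add_zero]

/-- Distinct links produce distinct structural edges, so the points found link by link do not
interfere when they are added up. -/
theorem exists_ex_of_forall {L : List Link}
    (hL : (src L).Nodup) {P : ℕ → Multiset (D A) → Prop}
    (hP : ∀ l ∈ L, ∃ W n, l.Ex st v U W n ∧ ∀ s, .str s ∈ l.concl → P s (W s)) :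
    ∃ W n, Ex st L v U W n ∧ ∀ l ∈ L, ∀ s, .str s ∈ l.concl → P s (W s) := by
  induction L with
  | nil => exact ⟨0, 0, ex_nil.2 ⟨rfl, rfl⟩, by simp⟩
  | cons l L ih =>
    rw [src_cons, Multiset.nodup_add] at hL
    obtain ⟨W₁, n₁, h₁, h₂⟩ := hP l (by simp)
    obtain ⟨W₂, n₂, h₃, h₄⟩ := ih hL.2.1 fun m hm => hP m (by simp [hm])
    have hd : ∀ e, e ∈ _ → e ∉ _ := fun _ => Multiset.disjoint_left.1 hL.2.2
    refine ⟨W₁ + W₂, n₁ + n₂, ex_cons.2 ⟨_, _, _, _, rfl, rfl, h₁, h₃⟩, ?_⟩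
    intro m hm s hs
    rw [Pi.add_apply]
    rcases List.mem_cons.1 hm with rfl | hm
    · rw [h₃.eq_zero (hd _ (Link.concl_subset_src _ hs)), add_zero]
      exact h₂ s hs
    · rw [h₁.eq_zero fun h' => hd _ h' (mem_src.2 ⟨m, hm, Link.concl_subset_src _ hs⟩), zero_add]
      exact h₄ m hm s hs

/-- The lines consumed inside boxes are governed by the experiments of the boxes; only the `?`-links
of the ground level look at `U`. -/
theorem Ex.congr_targets {L : List Link} {U' : ℕ → Multiset (D A)} (h : LLNet.Ex st L v U W n)
    (hU : ∀ l ∈ L, ∀ s, .str s ∈ l.prem → U' s = U s) : LLNet.Ex st L v U' W n := by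
  have := h.map (AddMonoidHom.id _) (k := id) (v' := v) (U' := U') fun l hl W n h' => ?_
  · simpa using this
  · by_cases hb : ∃ B i c, l = .bang B i c
    · obtain ⟨B, i, c, rfl⟩ := hb
      exact ex_bang.2 (ex_bang.1 h')
    · push Not at hb
      refine h'.congr (fun _ _ => rfl) fun s hs => hU l hl s ?_
      have := Link.tgt_eq_prem hb
      rw [this] at hs
      exact hs

open Experiment in
/-- The labels of an experiment. -/
theorem exists_ex_of_isSex {L : List Link} {e : Experiment A} (he : IsSex L e) (h : WF L) :
    ∃ W n, Ex false L e.lab W W n ∧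
      ∀ s, .str s ∈ conclusions L → e.slab s = D.bag false (W s) := by
  induction he with
  | @mk L e ax cut one bot tensor par flat why weakening nonempty boxes main aux ih =>
    -- Structural premises are first read from `slab`. Once all the links have been collected, these
    -- values are seen to be the points `W` of the sources.
    have key : ∀ l ∈ L, ∃ W n, l.Ex false e.lab (fun s => (e.slab s).elems) W n ∧
        ∀ s, .str s ∈ l.concl → e.slab s = D.bag false (W s) := by
      intro l hl
      cases l with
      | ax a b => exact ⟨0, 1, by simpa only [Link.Ex, and_true] using ax a b hl, by simp [Link.concl]⟩
      | cut a b =>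
        exact ⟨0, 1, by simpa only [Link.Ex, and_true] using cut a b hl, by simp [Link.concl]⟩
      | tensor a b c =>
        exact ⟨0, 1, by simpa only [Link.Ex, and_true] using tensor a b c hl, by simp [Link.concl]⟩
      | par a b c =>
        exact ⟨0, 1, by simpa only [Link.Ex, and_true] using par a b c hl, by simp [Link.concl]⟩
      | one c => exact ⟨0, 1, by simpa only [Link.Ex, and_true] using one c hl, by simp [Link.concl]⟩
      | bot c => exact ⟨0, 1, by simpa only [Link.Ex, and_true] using bot c hl, by simp [Link.concl]⟩
      | flat a s =>
        refine ⟨Pi.single s {e.lab a}, 1, by simp only [Link.Ex, and_self], ?_⟩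
        intro s' hs'
        simp only [Link.concl, List.mem_singleton, Edge.str.injEq] at hs'
        subst hs'
        rw [Pi.single_eq_same, flat a s' hl]
      | why ss c =>
        refine ⟨0, 1, (ex_why _ _).2 ⟨?_, rfl, rfl⟩, by simp [Link.concl]⟩
        by_cases hss : ss = []
        · subst hss
          obtain ⟨μ, hμ⟩ := weakening c hl
          exact ⟨μ, hμ, by simp, by simp⟩
        · obtain ⟨μ, hμ, hc⟩ := why ss c hl hss
          have : ss.map (fun s => (e.slab s).elems) = ss.map μ :=
            List.map_congr_left fun s hs => by rw [hμ s hs, D.elems_bag]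
          exact ⟨_, hc, by rw [this], by simp⟩
      | bang B i c =>
        have hB := h.box hl
        have key : ∀ f, ∃ W n, f ∈ e.copies c → Ex false B f.lab W W n ∧
            ∀ s, .str s ∈ conclusions B → f.slab s = D.bag false (W s) := by
          intro f
          by_cases hf : f ∈ e.copies c
          · obtain ⟨W, n, h⟩ := ih B i c hl f hf hB
            exact ⟨W, n, fun _ => h⟩
          · exact ⟨0, 0, fun h => absurd h hf⟩
        choose Wf nf hf using key
        refine ⟨_, _, ex_bang.2 ⟨((e.copies c).map fun f => (⟨f.lab, Wf f, nf f⟩ : Pt A) : List (Pt A)),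
          ?_, ?_, ?_, rfl, rfl⟩, ?_⟩
        · simpa using nonempty B i c hl
        · intro p hp
          obtain ⟨f, hf', rfl⟩ := List.mem_map.1 (Multiset.mem_coe.1 hp)
          exact (hf f hf').1
        · rw [main B i c hl]
          simp [Function.comp_def]
        · intro s hs
          rw [str_mem_concl_bang] at hs
          obtain ⟨μ, h₁, h₂⟩ := aux B i c hl s hs
          rw [h₂, sum_str_apply]
          congr 1
          simp only [Multiset.map_coe, Multiset.sum_coe, List.map_map]
          congr 1
          refine List.map_congr_left fun f hf' => ?_
          exact D.bag_inj ((h₁ f hf').symm.trans ((hf f hf').2 s hs))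
    obtain ⟨W, n, h₁, h₂⟩ := exists_ex_of_forall (P := fun s m => e.slab s = D.bag false m)
      h.src_nodup key
    refine ⟨W, n, h₁.congr_targets fun l hl s hs => ?_, fun s hs => ?_⟩
    · obtain ⟨m, hm, hms⟩ := h.exists_str_source hl hs
      rw [h₂ m hm s hms, D.elems_bag]
    · obtain ⟨m, hm, hms⟩ := mem_sources.1 (List.mem_filter.1 hs).1
      exact h₂ m hm s hms

open Experiment in
theorem exists_isSex_of_forall {L : List Link} (h : WF L)
    (ih : ∀ B i c, .bang B i c ∈ L → ∀ f : Pt A, f.Of true B → ∃ e : Experiment A, IsSex B e ∧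
      e.lab = f.lab ∧ e.slab = fun s => D.bag false (f.str s)) (he : Ex true L v W W n) :
    ∃ e : Experiment A, IsSex L e ∧ e.lab = v ∧ e.slab = fun s => D.bag false (W s) := by
  have hmem : ∀ l ∈ L, _ := fun l hl => he.exists_of_mem_of_nodup h.src_nodup hl
  have key : ∀ c, ∃ es : List (Experiment A), ∀ B i, .bang B i c ∈ L → es ≠ [] ∧
      (∀ f ∈ es, IsSex B f) ∧
      v c = D.bag true ((es.map (fun f => f.lab i) : List (D A)) : Multiset (D A)) ∧
      ∀ s, .str s ∈ conclusions B → ∃ μ : Experiment A → Multiset (D A),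
        (∀ f ∈ es, f.slab s = D.bag false (μ f)) ∧ W s = (es.map μ).sum := by
    intro c
    by_cases hb : ∃ B i, .bang B i c ∈ L
    · obtain ⟨B, i, hl⟩ := hb
      obtain ⟨W', n', h₁, h₂⟩ := hmem _ hl
      obtain ⟨fs, hfs0, hfs, hc, rfl, -⟩ := ex_bang.1 h₁
      -- A default value for the choice below; it is never used for an actual experiment of the box.
      have : Nonempty (Experiment A) :=
        ⟨.mk (fun _ => D.atom true none) (fun _ => D.atom true none) fun _ => []⟩
      choose! E hE using ih B i c hl
      obtain ⟨fs, rfl⟩ : ∃ l : List (Pt A), fs = l := ⟨fs.toList, fs.coe_toList.symm⟩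
      refine ⟨fs.map E, fun B' i' hl' => ?_⟩
      have := h.eq_of_src hl hl' (e := .log c) (by simp) (by simp)
      cases this
      refine ⟨by simpa using hfs0, ?_, ?_, ?_⟩
      · intro f hf
        obtain ⟨p, hp, rfl⟩ := List.mem_map.1 hf
        exact (hE p (hfs p hp)).1
      · rw [hc, List.map_map]
        congr 1
        refine congrArg _ (List.map_congr_left fun p hp => ?_)
        rw [Function.comp_apply, (hE p (hfs p hp)).2.1]
      · intro s hs
        refine ⟨fun f => (f.slab s).elems, ?_, ?_⟩
        · intro f hf
          obtain ⟨p, hp, rfl⟩ := List.mem_map.1 hf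
          simp only [(hE p (hfs p hp)).2.2, D.elems_bag]
        · rw [h₂ s (Link.concl_subset_src _ (str_mem_concl_bang.2 hs)), sum_str_apply, List.map_map]
          refine congrArg List.sum (List.map_congr_left fun p hp => ?_)
          rw [Function.comp_apply, (hE p (hfs p hp)).2.2, D.elems_bag]
    · exact ⟨[], fun B i hl => absurd ⟨B, i, hl⟩ hb⟩
  choose K hK using key
  refine ⟨.mk v (fun s => D.bag false (W s)) K, ?_, rfl, rfl⟩
  refine .mk ?_ ?_ ?_ ?_ ?_ ?_ ?_ ?_ ?_ ?_ ?_ ?_ ?_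
  · intro a b hl
    obtain ⟨_, _, h', -⟩ := hmem _ hl
    simp only [Link.Ex] at h'
    exact h'.1
  · intro a b hl
    obtain ⟨_, _, h', -⟩ := hmem _ hl
    exact ((ex_cut _ _).1 h').1
  · intro c hl
    obtain ⟨_, _, h', -⟩ := hmem _ hl
    exact ((ex_one _ _).1 h').1
  · intro c hl
    obtain ⟨_, _, h', -⟩ := hmem _ hl
    exact ((ex_bot _ _).1 h').1
  · intro a b c hl
    obtain ⟨_, _, h', -⟩ := hmem _ hl
    exact ((ex_tensor _ _).1 h').1
  · intro a b c hl
    obtain ⟨_, _, h', -⟩ := hmem _ hl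
    exact ((ex_par _ _).1 h').1
  · intro a s hl
    show D.bag false (W s) = _
    rw [he.str_flat h.src_nodup hl]
    rfl
  · intro ss c hl hss
    obtain ⟨_, _, h', -⟩ := hmem _ hl
    obtain ⟨⟨μ, h₁, -, h₂⟩, -⟩ := (ex_why _ _).1 h'
    refine ⟨W, fun s _ => rfl, ?_⟩
    rw [← h₂ rfl hss]
    exact h₁
  · intro c hl
    obtain ⟨_, _, h', -⟩ := hmem _ hl
    obtain ⟨⟨μ, h₁, -⟩, -⟩ := (ex_why _ _).1 h'
    exact ⟨μ, h₁⟩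
  · exact fun B i c hl => (hK c B i hl).1
  · exact fun B i c hl => (hK c B i hl).2.1
  · exact fun B i c hl => (hK c B i hl).2.2.1
  · intro B i c hl s hs
    obtain ⟨μ, h₁, h₂⟩ := (hK c B i hl).2.2.2 s hs
    exact ⟨μ, h₁, congrArg (D.bag false) h₂⟩

open Experiment in
/-- Strict labels come from an experiment. -/
theorem exists_isSex_of_ex {L : List Link} (h : WF L) (he : Ex true L v W W n) :
    ∃ e : Experiment A, IsSex L e ∧ e.lab = v ∧ e.slab = fun s => D.bag false (W s) := by
  refine exists_isSex_of_forall h (fun B i c hl => ?_) he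
  have hB := h.box hl
  clear hl
  suffices ∀ l : Link, ∀ B i c, l = .bang B i c → WF B → ∀ f : Pt A, f.Of true B →
      ∃ e : Experiment A, IsSex B e ∧ e.lab = f.lab ∧ e.slab = fun s => D.bag false (f.str s) from
    this (.bang B i c) B i c rfl hB
  refine Link.ind ?_ ?_
  · rintro B i c ih _ _ _ ⟨⟩ hB f hf
    exact exists_isSex_of_forall hB
      (fun B' i' c' hl f hf => ih _ hl B' i' c' rfl (hB.box hl) f hf) hf
  · rintro l hl B i c rfl
    exact absurd rfl (hl B i c)

end Experiments

/-! ## Topological sorting -/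

theorem exists_perm_cons_cons {α : Type*} {L : List α} {x y : α} (hx : x ∈ L) (hy : y ∈ L)
    (h : x ≠ y) : ∃ Γ, L.Perm (x :: y :: Γ) := by
  obtain ⟨L₁, L₂, rfl⟩ := List.append_of_mem hx
  have hp : (L₁ ++ x :: L₂).Perm (x :: (L₁ ++ L₂)) := List.perm_middle
  have hy' : y ∈ L₁ ++ L₂ := by simpa [h.symm] using hp.mem_iff.1 hy
  obtain ⟨L₃, L₄, h'⟩ := List.append_of_mem hy'
  refine ⟨L₃ ++ L₄, hp.trans (.cons _ ?_)⟩
  rw [h']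
  exact List.perm_middle

theorem exists_perm_cons_cons_cons {α : Type*} {L : List α} {x y z : α} (hx : x ∈ L) (hy : y ∈ L)
    (hz : z ∈ L) (h : x ≠ y) (h' : x ≠ z) (h'' : y ≠ z) : ∃ Γ, L.Perm (x :: y :: z :: Γ) := by
  obtain ⟨Γ, hp⟩ := exists_perm_cons_cons hx hy h
  have hz' : z ∈ Γ := by simpa [h'.symm, h''.symm] using hp.mem_iff.1 hz
  obtain ⟨L₃, L₄, rfl⟩ := List.append_of_mem hz'
  exact ⟨L₃ ++ L₄, hp.trans (.cons _ (.cons _ List.perm_middle))⟩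

/-- The sources of the premises of a link come after it. -/
inductive Sorted : List Link → Prop
  | nil : Sorted []
  | cons {l : Link} {L : List Link} (hl : ∀ e ∈ l.prem, e ∈ sources L) (hL : Sorted L) :
      Sorted (l :: L)

theorem sum_map_eq_one {m : Multiset Edge} (hm : m.Nodup) {χ : Edge → ZMod 2} {p : Edge}
    (hp : p ∈ m) (h1 : χ p = 1) (h0 : ∀ x ∈ m, x ≠ p → χ x = 0) : (m.map χ).sum = 1 := by
  rw [sum_map_eq_of_mem hm hp h0, h1]

/-- Some link has no conclusion among the premises of `L'`. -/
theorem WF.exists_terminal {L : List Link} (h : WF L) {L' : List Link} (hL' : L' ⊆ L)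
    (hne : L' ≠ []) : ∃ l ∈ L', ∀ e ∈ l.concl, e ∉ targets L' := by
  by_contra! hcon
  have key : ∀ l : {l // l ∈ L'}, ∃ e, ∃ m : {l // l ∈ L'}, e ∈ l.1.concl ∧ e ∈ m.1.prem := by
    rintro ⟨l, hl⟩
    obtain ⟨e, he, he'⟩ := hcon l hl
    obtain ⟨m, hm, hem⟩ := mem_targets.1 he'
    exact ⟨e, ⟨m, hm⟩, he, hem⟩
  choose e g he hg using key
  have : Finite {l // l ∈ L'} := List.finite_toSet L'
  -- Following from each link a conclusion to the link that consumes it, one ends up on a directed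
  -- cycle of the finite list.
  have hP : (Function.periodicPts g).Nonempty := by
    obtain ⟨l, hl⟩ := List.exists_mem_of_ne_nil _ hne
    obtain ⟨m, n, hmn, h⟩ : ∃ m n : ℕ, m < n ∧ g^[m] ⟨l, hl⟩ = g^[n] ⟨l, hl⟩ := by
      obtain ⟨m, n, hmn, h⟩ := Finite.exists_ne_map_eq_of_infinite fun n : ℕ => g^[n] ⟨l, hl⟩
      rcases lt_or_gt_of_ne hmn with h' | h'
      · exact ⟨m, n, h', h⟩
      · exact ⟨n, m, h', h.symm⟩
    refine ⟨g^[m] ⟨l, hl⟩, n - m, by omega, ?_⟩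
    rw [Function.IsPeriodicPt, Function.IsFixedPt, ← Function.iterate_add_apply,
      Nat.sub_add_cancel hmn.le, h]
  have hbij := Function.bijOn_periodicPts g
  set P := Function.periodicPts g
  classical
  -- The edges of all the directed cycles of `g`. As `g` permutes its periodic points, each such
  -- link has one incoming and one outgoing edge of this set. So this is a flow, even at `⅋`- and
  -- `?`-links, contrary to correctness.
  set χ : Edge → ZMod 2 := fun x => if ∃ l ∈ P, x = e l then 1 else 0 with hχ
  have hs : ∀ k ∈ L, ∀ x ∈ k.src, ∀ l ∈ P, x = e l → l.1 = k := by
    rintro k hk _ hx l - rfl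
    exact h.eq_of_src (hL' l.2) hk (Link.concl_subset_src _ (he l)) hx
  have ht : ∀ k ∈ L, ∀ x ∈ k.tgt, ∀ l ∈ P, x = e l → (g l).1 = k := by
    rintro k hk _ hx l - rfl
    exact h.eq_of_tgt (hL' (g l).2) hk (Link.prem_subset_tgt _ (hg l)) hx
  have hχ1 : ∀ l ∈ P, χ (e l) = 1 := fun l hl => if_pos ⟨l, hl, rfl⟩
  have hχ0 : ∀ x, (∀ l ∈ P, x ≠ e l) → χ x = 0 := fun x hx => if_neg fun ⟨l, hl, h'⟩ => hx l hl h'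
  have huniq : ∀ k ∈ L, ∀ x ∈ k.tgt, ∀ y ∈ k.tgt, x ≠ y → χ x * χ y = 0 := by
    intro k hk x hx y hy hxy
    by_contra h'
    obtain ⟨h₁, h₂⟩ := mul_ne_zero_iff.1 h'
    obtain ⟨l, hl, rfl⟩ : ∃ l ∈ P, x = e l := by
      by_contra hc
      exact h₁ (if_neg hc)
    obtain ⟨m, hm, rfl⟩ : ∃ l ∈ P, y = e l := by
      by_contra hc
      exact h₂ (if_neg hc)
    have h₃ := ht k hk _ hx l hl rfl
    have h₄ := ht k hk _ hy m hm rfl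
    exact hxy (congrArg e (hbij.injOn hl hm (Subtype.ext (h₃.trans h₄.symm))))
  have hnd : ∀ k ∈ L, k.src.Nodup ∧ k.tgt.Nodup := by
    intro k hk
    obtain ⟨L₁, L₂, rfl⟩ := List.append_of_mem hk
    have h₁ := h.src_nodup
    have h₂ := h.tgt_nodup
    rw [src_perm (List.perm_middle), src_cons, Multiset.nodup_add] at h₁
    rw [tgt_perm (List.perm_middle), tgt_cons, Multiset.nodup_add] at h₂
    exact ⟨h₁.1, h₂.1⟩
  have hflow : Flow L χ := by
    refine ⟨fun k hk => ?_, fun a b c hl => ?_, fun ss c hl => ?_⟩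
    · rw [flux]
      by_cases hkP : ∃ l ∈ P, l.1 = k
      · obtain ⟨l, hl, rfl⟩ := hkP
        obtain ⟨m, hm, rfl⟩ := hbij.surjOn hl
        rw [sum_map_eq_one (hnd _ hk).1 (Link.concl_subset_src _ (he _)) (hχ1 _ hl),
          sum_map_eq_one (hnd _ hk).2 (Link.prem_subset_tgt _ (hg m)) (hχ1 _ hm)]
        · rfl
        · intro x hx hne
          by_contra h0
          have := huniq _ hk x hx _ (Link.prem_subset_tgt _ (hg m)) hne
          rw [hχ1 _ hm, mul_one] at this
          exact h0 this
        · intro x hx hne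
          refine hχ0 x fun l' hl' h' => hne ?_
          have := hs _ hk x hx l' hl' h'
          rw [h', Subtype.ext this]
      · rw [Multiset.sum_eq_zero, Multiset.sum_eq_zero, add_zero]
        · simp only [Multiset.mem_map, forall_exists_index, and_imp, forall_apply_eq_imp_iff₂]
          exact fun x hx => hχ0 x fun l hl h' =>
            hkP ⟨g l, hbij.mapsTo hl, ht _ hk x hx l hl h'⟩
        · simp only [Multiset.mem_map, forall_exists_index, and_imp, forall_apply_eq_imp_iff₂]
          exact fun x hx => hχ0 x fun l hl h' => hkP ⟨l, hl, hs _ hk x hx l hl h'⟩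
    · refine huniq _ hl _ (by simp) _ (by simp) fun h' => ?_
      have := (hnd _ hl).2
      simp [h'] at this
    · have := (hnd _ hl).2
      simp only [Link.tgt, Multiset.coe_nodup] at this
      refine (List.Nodup.of_map _ this).imp_of_mem fun {s t} hs ht hst => ?_
      exact huniq _ hl _ (by simp [hs]) _ (by simp [ht]) (by simpa using hst)
  obtain ⟨l, hl⟩ := hP
  have h0 := h.correct χ hflow (fun x _ hx => hχ0 x fun l _ h' => hx ?_) _ (hL' (g l).2) _ (hg l)
  · rw [hχ1 l hl] at h0
    exact one_ne_zero h0
  · rw [h']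
    exact mem_tgt.2 ⟨_, hL' (g l).2, Link.prem_subset_tgt _ (hg l)⟩

/-- A terminal link is put in front and removed: what is left still contains the sources of all
premises. -/
theorem WF.exists_sorted {L : List Link} (h : WF L) : ∃ L', L.Perm L' ∧ Sorted L' := by
  have key : ∀ n, ∀ L' : List Link, L'.length = n → L' ⊆ L → targets L' ⊆ sources L' →
      ∃ L'', L'.Perm L'' ∧ Sorted L'' := by
    intro n
    induction n with
    | zero =>
      intro L' hn _ _
      rw [List.length_eq_zero_iff] at hn
      subst hn
      exact ⟨[], .refl _, .nil⟩
    | succ n ih =>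
      intro L' hn hs ht
      obtain ⟨l, hl, hc⟩ := h.exists_terminal hs (by rintro rfl; simp at hn)
      obtain ⟨L₁, L₂, rfl⟩ := List.append_of_mem hl
      have hp : (L₁ ++ l :: L₂).Perm (l :: (L₁ ++ L₂)) := List.perm_middle
      have hsub : ∀ e ∈ targets (L₁ ++ l :: L₂), e ∈ sources (L₁ ++ L₂) := by
        intro e he
        obtain ⟨m, hm, hem⟩ := mem_sources.1 (ht he)
        rcases List.mem_cons.1 (hp.mem_iff.1 hm) with rfl | hm
        · exact absurd he (hc e hem)
        · exact mem_sources.2 ⟨m, hm, hem⟩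
      obtain ⟨L'', hp', hs'⟩ := ih (L₁ ++ L₂) (by simpa using hp.length_eq.symm.trans hn)
        (fun m hm => hs (hp.mem_iff.2 (by simp [hm]))) (fun e he => hsub e (by
          obtain ⟨m, hm, hem⟩ := mem_targets.1 he
          exact mem_targets.2 ⟨m, hp.mem_iff.2 (by simp [hm]), hem⟩))
      refine ⟨l :: L'', hp.trans (.cons _ hp'), .cons (fun e he => ?_) hs'⟩
      obtain ⟨m, hm, hem⟩ := mem_sources.1 (hsub e (mem_targets.2 ⟨l, hl, he⟩))
      exact mem_sources.2 ⟨m, hp'.mem_iff.1 hm, hem⟩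
  refine key _ L rfl (fun _ h => h) fun e he => ?_
  obtain ⟨l, hl, hel⟩ := mem_targets.1 he
  cases e with
  | log a => exact mem_sources.2 (h.exists_source hl hel)
  | str s => exact mem_sources.2 (h.exists_str_source hl hel)

/-! ## Experiments of normal forms -/

/-- No step other than the erasing of a box is possible, and there is no clash. -/
structure Normal (N : ℕ) (L : List Link) : Prop where
  step : ∀ L' θ, ¬ NonErasing N L L' θ
  clash : ¬ HasClash L

theorem Normal.box {N : ℕ} {L B : List Link} {i c : ℕ} (h : Normal N L) (hl : .bang B i c ∈ L) :
    Normal N B := by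
  obtain ⟨L₁, L₂, rfl⟩ := List.append_of_mem hl
  refine ⟨fun B' θ hB => h.step _ θ (.box List.perm_middle hB), ?_⟩
  rintro ⟨G, hG, hc⟩
  exact h.clash ⟨G, .box hl hG, hc⟩

/-- Any other cut is a clash or can be reduced without erasing a box. -/
theorem Normal.cut {N : ℕ} {L : List Link} (h : Normal N L) (hL : WF L) {a b : ℕ} (hc : .cut a b ∈ L) :
    ∃ B i, (.bang B i a ∈ L ∧ .why [] b ∈ L) ∨ (.bang B i b ∈ L ∧ .why [] a ∈ L) := by
  obtain ⟨l, hl, ha⟩ := hL.exists_source hc (a := a) (by simp [Link.prem])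
  obtain ⟨m, hm, hb⟩ := hL.exists_source hc (a := b) (by simp [Link.prem])
  have hlc : l ≠ .cut a b := by
    rintro rfl
    simp [Link.concl] at ha
  have hmc : m ≠ .cut a b := by
    rintro rfl
    simp [Link.concl] at hb
  have hlax : ¬ l.IsAx := by
    intro hax
    obtain ⟨Γ, hp⟩ := exists_perm_cons_cons hl hc hlc
    cases l with
    | ax x y =>
      simp only [Link.concl, List.mem_cons, Edge.log.injEq, List.not_mem_nil, or_false] at ha
      rcases ha with rfl | rfl
      · exact h.step _ _ (.ax (.inl rfl) (.inl rfl) hp)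
      · exact h.step _ _ (.ax (.inr rfl) (.inl rfl) hp)
    | _ => exact hax
  have hmax : ¬ m.IsAx := by
    intro hax
    obtain ⟨Γ, hp⟩ := exists_perm_cons_cons hm hc hmc
    cases m with
    | ax x y =>
      simp only [Link.concl, List.mem_cons, Edge.log.injEq, List.not_mem_nil, or_false] at hb
      rcases hb with rfl | rfl
      · exact h.step _ _ (.ax (.inl rfl) (.inr rfl) hp)
      · exact h.step _ _ (.ax (.inr rfl) (.inr rfl) hp)
    | _ => exact hax
  have hd : l.Dual m := by
    by_contra hd
    exact h.clash ⟨L, .ground, a, b, hc, l, hl, m, hm, ha, hb, hlax, hmax, hd⟩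
  have hlm : l ≠ m := by
    rintro rfl
    cases l <;> exact hd
  obtain ⟨Γ, hp⟩ := exists_perm_cons_cons_cons hl hm hc hlm hlc hmc
  have hp' : L.Perm (m :: l :: .cut a b :: Γ) := hp.trans (.swap ..)
  cases l <;> cases m <;> try exact hd.elim
  all_goals
    simp only [Link.concl, Edge.log.injEq, List.mem_cons, List.mem_filter,
      Edge.isLog, Bool.not_true, Bool.false_and, Bool.false_eq_true, and_false,
      or_false, List.not_mem_nil] at ha hb
    subst ha hb
  · exact absurd (.tensorPar (.inl rfl) hp) (h.step _ _)
  · exact absurd (.tensorPar (.inr rfl) hp') (h.step _ _)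
  · exact absurd (.oneBot (.inl rfl) hp) (h.step _ _)
  · exact absurd (.oneBot (.inr rfl) hp') (h.step _ _)
  · rename_i ss B i
    by_cases hss : ss = []
    · subst hss
      exact ⟨B, i, .inr ⟨hm, hl⟩⟩
    · exact absurd (.bangWhy (.inr rfl) hss hp') (h.step _ _)
  · rename_i B i ss
    by_cases hss : ss = []
    · subst hss
      exact ⟨B, i, .inl ⟨hl, hm⟩⟩
    · exact absurd (.bangWhy (.inl rfl) hss hp) (h.step _ _)

-- Labelling a net that has only erasing steps

section Build

variable {A : Type u} {v : ℕ → D A} {U W W' : ℕ → Multiset (D A)} {n m : ℕ}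

/-- `l` is a box or a weakening with main conclusion `c`. -/
def Link.Fixes (l : Link) (c : ℕ) : Prop := (∃ B i, l = .bang B i c) ∨ l = .why [] c

theorem Ex.cons_of_src {L : List Link} (h : LLNet.Ex true L v W W n) (hL : tgt L ⊆ src L)
    {l : Link} (hd : Disjoint l.src (src L)) {v' : ℕ → D A}
    (hv : ∀ x, .log x ∈ src L → v' x = v x) (hl : l.Ex true v' (W' + W) W' m) :
    LLNet.Ex true (l :: L) v' (W' + W) (W' + W) (m + n) := by
  refine ex_cons.2 ⟨_, _, _, _, rfl, rfl, hl, h.congr (fun x hx => hv x ?_) fun s hs => ?_⟩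
  · exact hx.elim id fun h' => hL h'
  · rw [Pi.add_apply, hl.eq_zero fun h' => Multiset.disjoint_left.1 hd h' (hL hs), zero_add]

theorem Sorted.tgt_subset {L : List Link} (h : Sorted L)
    (hL : ∀ B i c, .bang B i c ∈ L → (Link.bang B i c).tgt ⊆ src B) : tgt L ⊆ src L := by
  induction h with
  | nil => simp
  | @cons l L hl _ ih =>
    intro e he
    rw [tgt_cons, Multiset.mem_add] at he
    rw [src_cons, Multiset.mem_add]
    rcases he with he | he
    · by_cases hb : ∃ B i c, l = .bang B i c
      · obtain ⟨B, i, c, rfl⟩ := hb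
        exact .inl (by simp [hL B i c (by simp) he])
      · push Not at hb
        rw [Link.tgt_eq_prem hb] at he
        exact .inr (sources_subset_src (hl e he))
    · exact .inr (ih (fun B i c h => hL B i c (by simp [h])) he)

/-- Labels are found for the links of `L` one after the other, if those of the conclusions of
boxes and weakenings are given. -/
theorem Sorted.exists_ex {L : List Link} (h : Sorted L) (hnd : (src L).Nodup) {w : ℕ → D A}
    (hL : ∀ B i c, .bang B i c ∈ L → (Link.bang B i c).tgt ⊆ src B)
    (hbang : ∀ B i c, .bang B i c ∈ L → ∃ f : Pt A, f.Of true B ∧ w c = D.bag true {f.lab i})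
    (hwhy : ∀ c, .why [] c ∈ L → ∃ μ, w c = D.bag false μ)
    (hcut : ∀ a b, .cut a b ∈ L → w a = (w b).neg ∧
      ∀ m ∈ L, (.log a ∈ m.concl → m.Fixes a) ∧ (.log b ∈ m.concl → m.Fixes b)) :
    ∃ v W n, Ex true L v W W n ∧ ∀ m ∈ L, ∀ c, m.Fixes c → v c = w c := by
  induction h with
  | nil => exact ⟨w, 0, 0, ex_nil.2 ⟨rfl, rfl⟩, by simp⟩
  | @cons l L hl hs ih =>
    rw [src_cons, Multiset.nodup_add] at hnd
    have ht := hs.tgt_subset fun B i c h => hL B i c (by simp [h])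
    obtain ⟨v, W, n, hv, hw⟩ := ih hnd.2.1 (fun B i c h => hL B i c (by simp [h]))
      (fun B i c h => hbang B i c (by simp [h])) (fun c h => hwhy c (by simp [h]))
      fun a b h => ⟨(hcut a b (by simp [h])).1, fun m hm => (hcut a b (by simp [h])).2 m (by simp [hm])⟩
    classical
    have hp : ∀ x, .log x ∈ l.prem → .log x ∈ src L := fun x hx => sources_subset_src (hl _ hx)
    -- `k` proposes labels for the conclusions of the new link `l`; the edges labelled before keep
    -- theirs, and `l.src` is disjoint from them.
    have key : ∀ (k : ℕ → D A) (W' : ℕ → Multiset (D A)) (m : ℕ),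
        (∀ v' : ℕ → D A, (∀ x, .log x ∈ src L → v' x = v x) → (∀ x, .log x ∈ l.src → v' x = k x) →
          l.Ex true v' (W' + W) W' m) →
        (∀ c, l.Fixes c → k c = w c) →
        ∃ v W n, Ex true (l :: L) v W W n ∧ ∀ m ∈ l :: L, ∀ c, m.Fixes c → v c = w c := by
      intro k W' m h₁ h₂
      have hfix : ∀ m : Link, ∀ c, m.Fixes c → .log c ∈ m.src := by
        rintro m c (⟨B, i, rfl⟩ | rfl) <;> simp
      have hv₁ : ∀ x, .log x ∈ src L → (if .log x ∈ src L then v x else k x) = v x :=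
        fun x hx => if_pos hx
      have hv₂ : ∀ x, .log x ∈ l.src → (if .log x ∈ src L then v x else k x) = k x :=
        fun x hx => if_neg (Multiset.disjoint_left.1 hnd.2.2 hx)
      refine ⟨fun x => if .log x ∈ src L then v x else k x, W' + W, m + n,
        hv.cons_of_src ht hnd.2.2 hv₁ (h₁ _ hv₁ hv₂), ?_⟩
      intro m hm c hc
      rcases List.mem_cons.1 hm with rfl | hm
      · exact (hv₂ c (hfix _ c hc)).trans (h₂ c hc)
      · exact (hv₁ c (mem_src.2 ⟨m, hm, hfix m c hc⟩)).trans (hw m hm c hc)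
    cases l with
    | ax a b =>
      have hab : a ≠ b := by
        rintro rfl
        simp at hnd
      -- Any pair of dual points would do: no remaining cut meets an axiom. Here `a` receives
      -- `(+,∗)` and `b` receives `(-,∗)`.
      refine key (fun x => D.atom (decide (x = a)) none) 0 1 (fun v' _ hv' => ?_) (by simp [Link.Fixes])
      simp only [Link.Ex, and_true]
      rw [hv' a (by simp), hv' b (by simp)]
      simp only [hab.symm, decide_true, decide_false]
      rfl
    | cut a b =>
      refine key v 0 1 (fun v' hv' _ => (ex_cut _ _).2 ⟨?_, rfl, rfl⟩) (by simp [Link.Fixes])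
      obtain ⟨h₁, h₂⟩ := hcut a b (by simp)
      obtain ⟨m₁, hm₁, ha⟩ := mem_sources.1 (hl (.log a) (by simp [Link.prem]))
      obtain ⟨m₂, hm₂, hb⟩ := mem_sources.1 (hl (.log b) (by simp [Link.prem]))
      rw [hv' a (hp a (by simp [Link.prem])), hv' b (hp b (by simp [Link.prem])),
        hw m₁ hm₁ a ((h₂ m₁ (by simp [hm₁])).1 ha), hw m₂ hm₂ b ((h₂ m₂ (by simp [hm₂])).2 hb), h₁]
    | tensor a b c =>
      refine key (fun _ => D.pair true (v a) (v b)) 0 1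
        (fun v' h₁ h₂ => (ex_tensor _ _).2 ⟨?_, rfl, rfl⟩) (by simp [Link.Fixes])
      rw [h₁ a (hp a (by simp [Link.prem])), h₁ b (hp b (by simp [Link.prem])), h₂ c (by simp)]
    | par a b c =>
      refine key (fun _ => D.pair false (v a) (v b)) 0 1
        (fun v' h₁ h₂ => (ex_par _ _).2 ⟨?_, rfl, rfl⟩) (by simp [Link.Fixes])
      rw [h₁ a (hp a (by simp [Link.prem])), h₁ b (hp b (by simp [Link.prem])), h₂ c (by simp)]
    | one c =>
      exact key (fun _ => D.atom true none) 0 1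
        (fun v' h₁ h₂ => (ex_one _ _).2 ⟨h₂ c (by simp), rfl, rfl⟩) (by simp [Link.Fixes])
    | bot c =>
      exact key (fun _ => D.atom false none) 0 1
        (fun v' h₁ h₂ => (ex_bot _ _).2 ⟨h₂ c (by simp), rfl, rfl⟩) (by simp [Link.Fixes])
    | flat a s =>
      refine key v (Pi.single s {v a}) 1 (fun v' h₁ h₂ => ?_) (by simp [Link.Fixes])
      simp only [Link.Ex, and_true]
      rw [h₁ a (hp a (by simp [Link.prem]))]
    | why ss c =>
      by_cases hss : ss = []
      · subst hss
        obtain ⟨μ, hμ⟩ := hwhy c (by simp)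
        refine key w 0 1 (fun v' _ h₂ => (ex_why _ _).2
          ⟨⟨μ, (h₂ c (by simp)).trans hμ, by simp, by simp⟩, rfl, rfl⟩) (by simp)
      · refine key (fun _ => D.bag false (ss.map W).sum) 0 1 (fun v' _ h₂ => (ex_why _ _).2
          ⟨⟨_, h₂ c (by simp), ?_, ?_⟩, rfl, rfl⟩) (by simp [Link.Fixes, hss]) <;> simp
    | bang B i c =>
      obtain ⟨f, hf, hc⟩ := hbang B i c (by simp)
      exact key w f.str (1 + f.size) (fun v' _ h₂ => ex_bang.2 ⟨{f}, by simp, by simpa using hf,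
        by simpa using (h₂ c (by simp)).trans hc, by simp, by simp⟩) (by simp)

/-- Labels of boxes and weakenings are fixed beforehand, so that all cuts are satisfied: each box
takes one experiment, and a weakening cut against it takes the dual label. All other labels follow
in topological order. -/
theorem Normal.exists_ex_of_forall {N : ℕ} {L : List Link} (h : Normal N L) (hL : WF L)
    (ih : ∀ B i c, .bang B i c ∈ L → ∃ f : Pt A, f.Of true B) :
    ∃ (v : ℕ → D A) (W : _) (n : _), Ex true L v W W n := by
  -- A positive bag at every name, used by a box or not, so that its dual is always a legitimate
  -- label of a weakening.
  have hβ : ∀ c, ∃ d : D A, (∀ B i, .bang B i c ∈ L → ∃ f : Pt A, f.Of true B ∧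
      d = D.bag true {f.lab i}) ∧ ∃ μ, d = D.bag true μ := by
    intro c
    by_cases hb : ∃ B i, .bang B i c ∈ L
    · obtain ⟨B, i, hl⟩ := hb
      obtain ⟨f, hf⟩ := ih B i c hl
      refine ⟨D.bag true {f.lab i}, fun B' i' hl' => ?_, _, rfl⟩
      have := hL.eq_of_src hl hl' (e := .log c) (by simp) (by simp)
      cases this
      exact ⟨f, hf, rfl⟩
    · exact ⟨D.bag true 0, fun B i hl => absurd ⟨B, i, hl⟩ hb, _, rfl⟩
  choose β hβ hβ' using hβ
  have hw : ∀ c, ∃ d : D A, (∀ B i, .bang B i c ∈ L → d = β c) ∧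
      (.why [] c ∈ L → (∃ μ, d = D.bag false μ) ∧
        ∀ a, (.cut a c ∈ L ∨ .cut c a ∈ L) → d = (β a).neg) := by
    intro c
    by_cases hb : .why [] c ∈ L
    · have hnb : ∀ B i, .bang B i c ∉ L := fun B i hl => by
        have := hL.eq_of_src hl hb (e := .log c) (by simp) (by simp)
        cases this
      by_cases hc : ∃ a, .cut a c ∈ L ∨ .cut c a ∈ L
      · obtain ⟨a, ha⟩ := hc
        obtain ⟨μ, hμ⟩ := hβ' a
        refine ⟨(β a).neg, fun B i hl => absurd hl (hnb B i), fun _ => ⟨⟨_, by rw [hμ, D.neg_bag]; rfl⟩, ?_⟩⟩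
        intro a' ha'
        obtain ⟨t, ht, hta⟩ : ∃ t ∈ L, t = .cut a c ∨ t = .cut c a := by
          rcases ha with h | h
          · exact ⟨_, h, .inl rfl⟩
          · exact ⟨_, h, .inr rfl⟩
        obtain ⟨t', ht', hta'⟩ : ∃ t ∈ L, t = .cut a' c ∨ t = .cut c a' := by
          rcases ha' with h | h
          · exact ⟨_, h, .inl rfl⟩
          · exact ⟨_, h, .inr rfl⟩
        have := hL.eq_of_tgt ht ht' (e := .log c) (by simp [tgt_cut_of_or hta])
          (by simp [tgt_cut_of_or hta'])
        subst this
        have : a = a' := by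
          rcases hta with rfl | rfl <;> rcases hta' with h | h <;> cases h <;> rfl
        rw [this]
      · exact ⟨D.bag false 0, fun B i hl => absurd hl (hnb B i),
          fun _ => ⟨⟨0, rfl⟩, fun a ha => absurd ⟨a, ha⟩ hc⟩⟩
    · exact ⟨β c, fun _ _ _ => rfl, fun h => absurd h hb⟩
  choose w hw₁ hw₂ using hw
  obtain ⟨L', hp, hs⟩ := hL.exists_sorted
  have hfix : ∀ {l : Link} {c : ℕ}, l ∈ L → l.Fixes c → ∀ m ∈ L, .log c ∈ m.concl → m.Fixes c := by
    intro l c hl hlc m hm hmc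
    have : .log c ∈ l.src := by
      rcases hlc with ⟨B, i, rfl⟩ | rfl <;> simp
    rwa [hL.eq_of_src hm hl (Link.concl_subset_src _ hmc) this]
  have h₁ : ∀ B i c, .bang B i c ∈ L' → ∃ f : Pt A, f.Of true B ∧ w c = D.bag true {f.lab i} :=
    fun B i c hl => hw₁ c B i (hp.mem_iff.2 hl) ▸ hβ c B i (hp.mem_iff.2 hl)
  have h₂ : ∀ a b, .cut a b ∈ L' → w a = (w b).neg ∧
      ∀ m ∈ L', (.log a ∈ m.concl → m.Fixes a) ∧ (.log b ∈ m.concl → m.Fixes b) := by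
    intro a b hl
    have hl' := hp.mem_iff.2 hl
    obtain ⟨B, i, ⟨h₁, h₂⟩ | ⟨h₁, h₂⟩⟩ := h.cut hL hl'
    · refine ⟨?_, fun m hm => ⟨hfix h₁ (.inl ⟨B, i, rfl⟩) m (hp.mem_iff.2 hm),
        hfix h₂ (.inr rfl) m (hp.mem_iff.2 hm)⟩⟩
      rw [hw₁ a B i h₁, (hw₂ b h₂).2 a (.inl hl'), D.neg_neg]
    · refine ⟨?_, fun m hm => ⟨hfix h₂ (.inr rfl) m (hp.mem_iff.2 hm),
        hfix h₁ (.inl ⟨B, i, rfl⟩) m (hp.mem_iff.2 hm)⟩⟩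
      rw [hw₁ b B i h₁, (hw₂ a h₂).2 b (.inr hl')]
  obtain ⟨v, W, n, hv, -⟩ := hs.exists_ex (src_perm hp ▸ hL.src_nodup)
    (fun B i c hl => tgt_bang_subset hL (hp.mem_iff.2 hl)) h₁
    (fun c hl => (hw₂ c (hp.mem_iff.2 hl)).1) h₂
  exact ⟨v, W, n, (ex_perm hp).2 hv⟩

theorem Normal.exists_ex (A : Type u) {N : ℕ} {L : List Link} (h : Normal N L) (hL : WF L) :
    ∃ (v : ℕ → D A) (W : _) (n : _), Ex true L v W W n := by
  refine h.exists_ex_of_forall hL fun B i c hl => ?_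
  have hB := hL.box hl
  have hn := h.box hl
  clear hl
  suffices ∀ l : Link, ∀ B i c, l = .bang B i c → WF B → Normal N B → ∃ f : Pt A, f.Of true B from
    this (.bang B i c) B i c rfl hB hn
  refine Link.ind ?_ ?_
  · rintro B i c ih _ _ _ ⟨⟩ hB hn
    obtain ⟨v, W, n, h⟩ := hn.exists_ex_of_forall hB
      fun B' i' c' hl => ih _ hl B' i' c' rfl (hB.box hl) (hn.box hl)
    exact ⟨⟨v, W, n⟩, h⟩
  · rintro l hl B i c rfl
    exact absurd rfl (hl B i c)

end Build

/-! ## Nets are well-formed -/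

theorem sources_le_src_of_forall {L : List Link} (h : ∀ l ∈ L, (l.concl : Multiset Edge) ≤ l.src) :
    (sources L : Multiset Edge) ≤ src L := by
  induction L with
  | nil => simp [sources]
  | cons l L ih =>
    rw [sources, ← Multiset.coe_add, src_cons]
    exact add_le_add (h l (by simp)) (ih fun m hm => h m (by simp [hm]))

theorem Link.concl_le_src (l : Link) : (l.concl : Multiset Edge) ≤ l.src := by
  refine Link.ind (P := fun l => (l.concl : Multiset Edge) ≤ l.src) ?_ ?_ l
  · intro B i c ih
    rw [Link.src_bang, Link.concl, ← Multiset.cons_coe]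
    refine Multiset.cons_le_cons _ (le_trans ?_ (sources_le_src_of_forall ih))
    exact Multiset.coe_le.2 List.filter_sublist.subperm
  · intro l hl
    rw [Link.src_eq_concl hl]

theorem sources_le_src (L : List Link) : (sources L : Multiset Edge) ≤ src L :=
  sources_le_src_of_forall fun l _ => l.concl_le_src

theorem sources_eq_targets_add {L : List Link} (hs : (src L).Nodup) (hg : IsGStruct L) :
    (sources L : Multiset Edge) = targets L + conclusions L := by
  have h : (sources L : Multiset Edge).Nodup := Multiset.nodup_of_le (sources_le_src L) hs
  have ht : (targets L : Multiset Edge) =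
      ((sources L).filter (fun e => decide (¬ e ∉ targets L)) : List Edge) := by
    refine (Multiset.Nodup.ext (Multiset.coe_nodup.2 hg.nodup) ?_).2 fun e => ?_
    · exact Multiset.coe_nodup.2 (List.Nodup.filter _ (Multiset.coe_nodup.1 h))
    · simpa using fun he => hg.subset he
  rw [ht, conclusions, Multiset.coe_add, eq_comm, Multiset.coe_eq_coe]
  refine List.perm_append_comm.trans ?_
  have := List.filter_append_perm (fun e => decide (e ∉ targets L)) (sources L)
  simpa using this

theorem src_add_targets {L : List Link}
    (h : ∀ l ∈ L, l.src + (l.prem : Multiset Edge) = l.tgt + (l.concl : Multiset Edge)) :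
    src L + (targets L : Multiset Edge) = tgt L + (sources L : Multiset Edge) := by
  induction L with
  | nil => simp [targets, sources]
  | cons l L ih =>
    have h₁ := h l (by simp)
    have h₂ := ih fun m hm => h m (by simp [hm])
    have h₃ : (targets (l :: L) : Multiset Edge) = (l.prem : Multiset Edge) + targets L := by
      simp [targets]
    rw [src_cons, tgt_cons, h₃, sources, ← Multiset.coe_add, add_add_add_comm, h₁, h₂,
      add_add_add_comm]

theorem src_eq_of_forall {L : List Link} (hs : (src L).Nodup) (hg : IsGStruct L)
    (h : ∀ l ∈ L, l.src + (l.prem : Multiset Edge) = l.tgt + (l.concl : Multiset Edge)) :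
    src L = tgt L + conclusions L := by
  have := src_add_targets h
  rw [sources_eq_targets_add hs hg, add_left_comm, add_comm (src L)] at this
  exact add_left_cancel this

theorem src_box_nodup {L B : List Link} {i c : ℕ} (hs : (src L).Nodup) (hl : .bang B i c ∈ L) :
    (src B).Nodup := by
  obtain ⟨L₁, L₂, rfl⟩ := List.append_of_mem hl
  rw [src_append, src_cons, Link.src_bang] at hs
  exact (Multiset.nodup_cons.1 (Multiset.nodup_add.1 (Multiset.nodup_add.1 hs).2.1).1).2

/-- The account of all depths and that of the ground level differ, for a box, by internal edges that
occur equally often as edges and as premises. Proved by induction on depth, with the decomposition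
`src_eq_of_forall` applied to the box. -/
theorem Link.src_add_prem {l : Link} {L : List Link} (hl : l ∈ L) (hs : (LLNet.src L).Nodup)
    (hg : ∀ G, GStructIn G L → IsGStruct G) :
    l.src + (l.prem : Multiset Edge) = l.tgt + (l.concl : Multiset Edge) := by
  revert L
  refine Link.ind (P := fun l => ∀ {L}, l ∈ L → (LLNet.src L).Nodup →
    (∀ G, GStructIn G L → IsGStruct G) →
    l.src + (l.prem : Multiset Edge) = l.tgt + (l.concl : Multiset Edge)) ?_ ?_ l
  · intro B i c ih L hl hs hg
    have hB : (LLNet.src B).Nodup := src_box_nodup hs hl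
    have hgB : ∀ G, GStructIn G B → IsGStruct G := fun G hG => hg G (.box hl hG)
    have h := src_eq_of_forall hB (hgB B .ground) fun m hm => ih m hm hm hB hgB
    have hc : (conclusions B : Multiset Edge) = .log i ::ₘ
        ((LLNet.sources B).filter (fun e => !e.isLog && decide (e ∉ targets B)) : List Edge) := by
      rw [Multiset.cons_coe, Multiset.coe_eq_coe]
      have h₁ := (List.filter_append_perm Edge.isLog (conclusions B)).symm
      rw [(hg L .ground).boxes B i c hl] at h₁
      simpa [conclusions, List.filter_filter] using h₁
    simp only [Link.src_bang, Link.prem, Link.tgt, Link.concl, h, hc, Multiset.coe_nil, add_zero,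
      ← Multiset.cons_coe]
    simp only [← Multiset.singleton_add]
    abel
  · intro l hb L _ _ _
    rw [Link.src_eq_concl hb, Link.tgt_eq_prem hb, add_comm]

theorem src_eq_tgt_add_conclusions {L : List Link} (hs : (src L).Nodup)
    (hg : ∀ G, GStructIn G L → IsGStruct G) : src L = tgt L + conclusions L :=
  src_eq_of_forall hs (hg L .ground) fun _ hl => Link.src_add_prem hl hs hg

-- From acyclic switchings to vanishing flows

theorem flux_eq_concl_add_prem {l : Link}
    (h : l.src + (l.prem : Multiset Edge) = l.tgt + (l.concl : Multiset Edge))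
    (χ : Edge → ZMod 2) : flux χ l = (l.concl.map χ).sum + (l.prem.map χ).sum := by
  have h' := congrArg (fun m => (Multiset.map χ m).sum) h
  simp only [Multiset.map_add, Multiset.sum_add, Multiset.map_coe, Multiset.sum_coe] at h'
  have h₂ : ∀ t : ZMod 2, t + t = 0 := CharTwo.add_self_eq_zero
  rw [flux]
  linear_combination h' + h₂ ((l.tgt.map χ).sum) - h₂ ((l.prem.map χ).sum)

theorem eq_of_mem_prem {L : List Link} (h : (targets L).Nodup) {j k : Fin L.length} {e : Edge}
    (hj : e ∈ (L.get j).prem) (hk : e ∈ (L.get k).prem) : j = k := by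
  have hp := List.pairwise_iff_get.1 (List.nodup_flatMap.1 h).2
  rcases lt_trichotomy j k with hlt | rfl | hlt
  · exact (hp j k hlt hj hk).elim
  · rfl
  · exact (hp k j hlt hk hj).elim

theorem sum_get_mul {L : List Link} (f : Link → List Edge) (χ : Edge → ZMod 2) :
    ∑ k : Fin L.length, ((f (L.get k)).map χ).sum = ((L.flatMap f).map χ).sum := by
  have h : ∑ k : Fin L.length, ((f (L.get k)).map χ).sum =
      (L.map fun l => ((f l).map χ).sum).sum :=
    Fin.sum_univ_fun_getElem L fun l => ((f l).map χ).sum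
  rw [h]
  clear h
  induction L with
  | nil => simp
  | cons l L ih => simp [ih]

theorem sources_eq_flatMap (L : List Link) : sources L = L.flatMap Link.concl := by
  induction L with
  | nil => simp [sources]
  | cons l L ih => simp [sources, ih]

theorem switchingGraph_adj {L : List Link} {S : Set Edge} {k : Fin L.length} {e : Edge}
    (hS : e ∈ S) (h : e ∈ (L.get k).prem ∨ e ∈ (L.get k).concl) :
    (switchingGraph L S).Adj (.inl k) (.inr e) := by
  rw [switchingGraph, SimpleGraph.fromRel_adj]
  exact ⟨by simp, .inl ⟨k, e, rfl, rfl, hS, h⟩⟩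

/-- An acyclic graph contains no non-empty set of edges that meets each link in an even number
of edges. -/
theorem eq_zero_of_isAcyclic {L : List Link} {S : Set Edge} {χ : Edge → ZMod 2}
    (hg : IsGStruct L) (hc : (sources L : Multiset Edge) = targets L + conclusions L)
    (hac : (switchingGraph L S).IsAcyclic)
    (hχ : ∀ l ∈ L, (l.concl.map χ).sum + (l.prem.map χ).sum = 0)
    (hχc : ∀ e ∈ conclusions L, χ e = 0) (hS : ∀ e ∈ sources L, χ e ≠ 0 → e ∈ S)
    {e : Edge} (he : e ∈ targets L) : χ e = 0 := by
  classical
  by_contra hne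
  obtain ⟨l, hl, hel⟩ := mem_targets.1 he
  obtain ⟨k', rfl⟩ := List.mem_iff_get.1 hl
  have hadj := switchingGraph_adj (hS e (hg.subset he) hne) (.inl hel)
  -- In an acyclic graph the half-edge between `e` and the link that consumes it is a bridge. The
  -- balance of `χ` is then computed on the side of `e`.
  have hbr := SimpleGraph.isBridge_iff.1 (SimpleGraph.isAcyclic_iff_forall_adj_isBridge.1 hac hadj)
  set H := (switchingGraph L S).deleteEdges {s(.inl k', .inr e)} with hH
  let ρ : Fin L.length → ZMod 2 := fun k => if H.Reachable (.inl k) (.inr e) then 1 else 0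
  let ψ : Edge → ZMod 2 := fun x => if H.Reachable (.inr x) (.inr e) then χ x else 0
  have hmem : ∀ k x, x ∈ (L.get k).prem ∨ x ∈ (L.get k).concl → x ∈ sources L := by
    rintro k x (h | h)
    · exact hg.subset (mem_targets.2 ⟨_, L.get_mem k, h⟩)
    · exact mem_sources.2 ⟨_, L.get_mem k, h⟩
  have hρ : ∀ k x, x ∈ (L.get k).prem ∨ x ∈ (L.get k).concl → ¬ (k = k' ∧ x = e) →
      ρ k * χ x = ψ x := by
    intro k x hx hkx
    by_cases hx0 : χ x = 0
    · simp [ψ, hx0]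
    · have hr : H.Adj (.inl k) (.inr x) := by
        rw [hH, SimpleGraph.deleteEdges_adj]
        refine ⟨switchingGraph_adj (hS x (hmem k x hx) hx0) hx, ?_⟩
        simpa using fun h₁ h₂ => hkx ⟨h₁, h₂⟩
      have : H.Reachable (.inl k) (.inr e) ↔ H.Reachable (.inr x) (.inr e) :=
        ⟨fun h => hr.reachable.symm.trans h, fun h => hr.reachable.trans h⟩
      simp only [ρ, ψ, this]
      split_ifs <;> simp
  have hconcl : ∀ k, ρ k * ((L.get k).concl.map χ).sum = ((L.get k).concl.map ψ).sum := by
    intro k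
    rw [← List.sum_map_mul_left]
    refine congrArg List.sum (List.map_congr_left fun x hx => hρ k x (.inr hx) ?_)
    rintro ⟨rfl, rfl⟩
    exact hg.acyclic x (.single ⟨_, hl, hel, hx⟩)
  have hprem : ∀ k, ρ k * ((L.get k).prem.map χ).sum =
      ((L.get k).prem.map (fun x => ψ x + (Pi.single e (χ e) : Edge → ZMod 2) x)).sum := by
    intro k
    rw [← List.sum_map_mul_left]
    refine congrArg List.sum (List.map_congr_left fun x hx => ?_)
    by_cases hxe : x = e
    · subst hxe
      obtain rfl := eq_of_mem_prem hg.nodup hx hel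
      have h₁ : ρ k = 0 := if_neg hbr
      have h₂ : ψ x = χ x := if_pos .rfl
      rw [h₁, h₂, Pi.single_eq_same, zero_mul, CharTwo.add_self_eq_zero]
    · rw [Pi.single_eq_of_ne hxe, add_zero]
      exact hρ k x (.inl hx) fun h => hxe h.2
  -- Summing the even totals over the links on the side of `e`: each edge of this side is counted at
  -- its source and at its target, except for `e`, whose target lies on the other side. What remains
  -- is `χ e`.
  have hsum : ∑ k : Fin L.length, ρ k * (((L.get k).concl.map χ).sum +
      ((L.get k).prem.map χ).sum) = 0 :=
    Finset.sum_eq_zero fun k _ => by rw [hχ _ (L.get_mem k), mul_zero]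
  simp only [mul_add, hconcl, hprem, Finset.sum_add_distrib, sum_get_mul] at hsum
  rw [← sources_eq_flatMap, List.sum_map_add] at hsum
  have h₁ : ((sources L).map ψ).sum = ((targets L).map ψ).sum := by
    have := congrArg (fun m => (Multiset.map ψ m).sum) hc
    simp only [Multiset.map_add, Multiset.sum_add, Multiset.map_coe, Multiset.sum_coe] at this
    rw [this, add_eq_left]
    refine List.sum_eq_zero fun t ht => ?_
    obtain ⟨x, hx, rfl⟩ := List.mem_map.1 ht
    simp [ψ, hχc x hx]
  have h₂ : ((targets L).map (Pi.single e (χ e) : Edge → ZMod 2)).sum = χ e := by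
    rw [← List.sum_toFinset _ hg.nodup, Finset.sum_eq_single e, Pi.single_eq_same]
    · exact fun x _ hx => Pi.single_eq_of_ne hx _
    · exact fun h => absurd (List.mem_toFinset.2 he) h
  rw [h₁] at hsum
  change _ + (((targets L).map ψ).sum + ((targets L).map (Pi.single e (χ e) : Edge → ZMod 2)).sum)
    = 0 at hsum
  rw [h₂, ← add_assoc, CharTwo.add_self_eq_zero, zero_add] at hsum
  exact hne hsum

/-- A set of edges with at most one premise of each `⅋`- and `?`-link is kept by a switching. -/
theorem exists_isSwitching {L : List Link} (hg : (targets L).Nodup) {T : Set Edge}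
    (hT : ∀ l ∈ L, l.IsSwitched → ∀ x ∈ l.prem, ∀ y ∈ l.prem, x ∈ T → y ∈ T → x = y) :
    ∃ S, IsSwitching L S ∧ T ⊆ S := by
  classical
  -- `σ l` is the premise of `l` to be kept: the one in `T` if there is one, and any other
  -- otherwise.
  have hσ : ∀ l : Link, ∃ x, (l.prem ≠ [] → x ∈ l.prem) ∧ ((∃ y ∈ l.prem, y ∈ T) → x ∈ T) := by
    intro l
    by_cases h : ∃ y ∈ l.prem, y ∈ T
    · obtain ⟨y, hy, hyT⟩ := h
      exact ⟨y, fun _ => hy, fun _ => hyT⟩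
    · by_cases hl : l.prem = []
      · exact ⟨.log 0, fun h' => absurd hl h', fun h' => absurd h' h⟩
      · obtain ⟨x, hx⟩ := List.exists_mem_of_ne_nil _ hl
        exact ⟨x, fun _ => hx, fun h' => absurd h' h⟩
  choose σ hσ hσT using hσ
  have hmem : ∀ l ∈ L, l.IsSwitched → ∀ x ∈ l.prem,
      ((∀ m ∈ L, m.IsSwitched → x ∈ m.prem → x = σ m) ↔ x = σ l) := by
    intro l hl hsw x hx
    refine ⟨fun h => h l hl hsw hx, fun h m hm _ hxm => ?_⟩
    obtain ⟨j, rfl⟩ := List.mem_iff_get.1 hl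
    obtain ⟨k, rfl⟩ := List.mem_iff_get.1 hm
    rwa [eq_of_mem_prem hg hxm hx]
  refine ⟨{x | ∀ l ∈ L, l.IsSwitched → x ∈ l.prem → x = σ l}, ⟨?_, ?_, ?_⟩, ?_⟩
  · intro a b c hl
    have ha := hmem _ hl trivial (.log a) (by simp [Link.prem])
    have hb := hmem _ hl trivial (.log b) (by simp [Link.prem])
    rw [Set.mem_ofPred_eq, Set.mem_ofPred_eq, ha, hb]
    have hab : (Link.par a b c).prem.Nodup := (List.nodup_flatMap.1 hg).1 _ hl
    have hs := hσ (Link.par a b c) (by simp [Link.prem])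
    simp only [Link.prem, List.mem_cons, List.not_mem_nil, or_false, List.nodup_cons] at hs hab
    rcases hs with hs | hs <;> rw [hs]
    · simpa using Ne.symm hab.1
    · simpa using hab.1
  · intro ss c hl hss
    have hs := hσ (Link.why ss c) (by simp [Link.prem, hss])
    obtain ⟨s, hs', hse⟩ := List.mem_map.1 (show σ (.why ss c) ∈ ss.map Edge.str from hs)
    have h := fun t (ht : t ∈ ss) => hmem _ hl trivial (.str t) (List.mem_map_of_mem ht)
    refine ⟨s, ⟨hs', (h s hs').2 hse⟩, fun t ht => ?_⟩
    have := (h t ht.1).1 ht.2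
    rw [← hse] at this
    exact Edge.str.inj this
  · intro x _ h l hl hsw hx
    exact absurd hx (h l hl hsw)
  · intro x hx l hl hsw hxl
    exact hT l hl hsw x hxl _ (hσ l (List.ne_nil_of_mem hxl)) hx (hσT l ⟨x, hxl, hx⟩)

/-- The support of a flow contains at most one premise of each switched link, so it is kept by some
switching, whose acyclicity forces the flow to vanish. -/
theorem correct_of_isAcyclic {L : List Link} (hs : (src L).Nodup)
    (hg : ∀ G, GStructIn G L → IsGStruct G)
    (hac : ∀ S, IsSwitching L S → (switchingGraph L S).IsAcyclic) : Correct L := by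
  intro χ hχ hχ0 l hl e he
  have h2 : ∀ {x y}, χ x * χ y = 0 → χ x ≠ 0 → χ y ≠ 0 → False := fun h hx hy =>
    (mul_ne_zero hx hy) h
  obtain ⟨S, hS, hST⟩ := exists_isSwitching (hg L .ground).nodup (T := {x | χ x ≠ 0}) (by
    intro m hm hsw x hx y hy hxT hyT
    cases m with
    | par a b c =>
      have := hχ.par a b c hm
      simp only [Link.prem, List.mem_cons, List.not_mem_nil, or_false] at hx hy
      rcases hx with rfl | rfl <;> rcases hy with rfl | rfl
      · rfl
      · exact (h2 this hxT hyT).elim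
      · exact (h2 this hyT hxT).elim
      · rfl
    | why ss c =>
      obtain ⟨s, hs, rfl⟩ := List.mem_map.1 (show x ∈ ss.map Edge.str from hx)
      obtain ⟨t, ht, rfl⟩ := List.mem_map.1 (show y ∈ ss.map Edge.str from hy)
      by_contra hst
      have : Std.Symm fun s t => χ (.str s) * χ (.str t) = 0 := ⟨fun s t h => by rwa [mul_comm]⟩
      have hp := (hχ.why ss c hm).forall hs ht fun h => hst (congrArg _ h)
      exact h2 hp hxT hyT
    | _ => exact hsw.elim)
  have hX := src_eq_tgt_add_conclusions hs hg
  refine eq_zero_of_isAcyclic (hg L .ground) (sources_eq_targets_add hs (hg L .ground)) (hac S hS)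
    (fun m hm => ?_) (fun x hx => ?_) (fun x _ hx => hST hx) (mem_targets.2 ⟨l, hl, he⟩)
  · rw [← flux_eq_concl_add_prem (Link.src_add_prem hm hs hg)]
    exact hχ.flux m hm
  · obtain ⟨h₁, h₂⟩ := (mem_out hs hX).1 (Multiset.mem_coe.2 hx)
    exact hχ0 x h₁ h₂

theorem Link.good_of_isAcyclic {l : Link} {L : List Link} (hl : l ∈ L) (hs : (LLNet.src L).Nodup)
    (hg : ∀ G, GStructIn G L → IsGStruct G)
    (hac : ∀ G, GStructIn G L → ∀ S, IsSwitching G S → (switchingGraph G S).IsAcyclic) :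
    l.Good := by
  revert L
  refine Link.ind (P := fun l => ∀ {L}, l ∈ L → (LLNet.src L).Nodup →
    (∀ G, GStructIn G L → IsGStruct G) →
    (∀ G, GStructIn G L → ∀ S, IsSwitching G S → (switchingGraph G S).IsAcyclic) → l.Good) ?_ ?_ l
  · intro B i c ih L hl hs hg hac
    have hB : (LLNet.src B).Nodup := src_box_nodup hs hl
    have hgB : ∀ G, GStructIn G B → IsGStruct G := fun G hG => hg G (.box hl hG)
    have hacB : ∀ G, GStructIn G B → ∀ S, IsSwitching G S → (switchingGraph G S).IsAcyclic :=
      fun G hG => hac G (.box hl hG)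
    have hwf : WF B := .mk' hB (src_eq_tgt_add_conclusions hB hgB)
      (correct_of_isAcyclic hB hgB (hacB B .ground)) fun m hm => ih m hm hm hB hgB hacB
    have hc : ∀ x, .log x ∈ conclusions B ↔ x = i := by
      intro x
      have := List.mem_filter (p := fun e => e.isLog) (as := conclusions B) (x := .log x)
      rw [(hg L .ground).boxes B i c hl] at this
      simpa [Edge.isLog, eq_comm] using this.symm
    exact good_bang_of_out hwf (src_eq_tgt_add_conclusions hB hgB)
      (Multiset.mem_coe.2 ((hc i).2 rfl)) fun x hx => (hc x).1 (Multiset.mem_coe.1 hx)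
  · intro l hb L _ _ _ _
    exact good_of_not_bang hb

theorem Struct.IsNet.wf {π : Struct} (h : π.IsNet) : WF π.links :=
  have hs : (src π.links).Nodup := Multiset.coe_nodup.2 h.names_nodup
  .mk' hs (src_eq_tgt_add_conclusions hs h.gstruct)
    (correct_of_isAcyclic hs h.gstruct (h.switching _ .ground))
    fun _ hl => Link.good_of_isAcyclic hl hs h.gstruct h.switching

theorem Struct.name_lt_fresh (π : Struct) : ∀ e ∈ src π.links, e.name < π.fresh := by
  intro e he
  have key : ∀ M : List Edge, e ∈ M → e.name < M.foldr (fun e n => max (e.name + 1) n) 0 := by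
    intro M
    induction M with
    | nil => simp
    | cons x M ih =>
      intro h
      rw [List.foldr_cons]
      rcases List.mem_cons.1 h with rfl | h
      · omega
      · have := ih h
        omega
  exact key _ he

/-! ## Strong normalization -/

namespace Struct

theorem Reduces.wf {π π' : Struct} (h : π.Reduces π') (hπ : WF π.links) : WF π'.links := by
  obtain ⟨⟨θ, hθ⟩, -⟩ := h
  exact (wf_step hθ hπ π.name_lt_fresh).1

/-- The size of relaxed experiments decreases along any reduction sequence, and an experiment of a
reduct excludes clashes in it. -/
theorem stronglyNormalizable_of_ex {A : Type u} {π : Struct} (hπ : WF π.links)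
    (he : ∃ (v : ℕ → D A) (W : _) (n : _), Ex false π.links v W W n) :
    π.StronglyNormalizable := by
  have hred : ∀ {ρ ρ' : Struct} {n : ℕ}, WF ρ.links → ρ.Reduces ρ' →
      (∃ (v : ℕ → D A) (W : _), Ex false ρ.links v W W n) →
      ∃ n' < n, ∃ (v : ℕ → D A) (W : _), Ex false ρ'.links v W W n' := by
    rintro ρ ρ' n hρ ⟨⟨θ, hθ⟩, -⟩ ⟨v, W, h⟩
    obtain ⟨v', W', n', h', hn, -⟩ := Ex.reduce hθ hρ ρ.name_lt_fresh h
    exact ⟨n', hn, v', W', h'⟩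
  refine ⟨?_, fun π' hπ' => ?_⟩
  · rintro ⟨R, rfl, hR⟩
    have key : ∀ n k, WF (R k).links → ¬ ∃ (v : ℕ → D A) (W : _), Ex false (R k).links v W W n := by
      intro n
      induction n using Nat.strong_induction_on with
      | _ n ih =>
        intro k hk h
        obtain ⟨n', hn, h'⟩ := hred hk (hR k) h
        exact ih n' hn (k + 1) ((hR k).wf hk) h'
    obtain ⟨v, W, n, h⟩ := he
    exact key n 0 hπ ⟨v, W, h⟩
  · have key : WF π'.links ∧ ∃ n, ∃ (v : ℕ → D A) (W : _), Ex false π'.links v W W n := by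
      induction hπ' with
      | refl =>
        obtain ⟨v, W, n, h⟩ := he
        exact ⟨hπ, n, v, W, h⟩
      | tail _ h ih =>
        obtain ⟨h₁, n, h₂⟩ := ih
        obtain ⟨n', -, h'⟩ := hred h₁ h h₂
        exact ⟨h.wf h₁, n', h'⟩
    obtain ⟨-, n, v, W, h⟩ := key
    exact h.not_hasClash

/-- As long as a step erasing no box exists it is performed, and the experiment of the reduct is
pulled back. Otherwise the experiment is built directly; erasing steps may still be possible but are
never needed. -/
theorem exists_ex_of_acc (A : Type u) {π : Struct} (hacc : Acc (flip Reduces) π)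
    (hc : ∀ π', Relation.ReflTransGen Reduces π π' → ¬ HasClash π'.links) (hπ : WF π.links) :
    ∃ (v : ℕ → D A) (W : _) (n : _), Ex true π.links v W W n := by
  induction hacc with
  | intro π _ ih =>
    by_cases h : ∃ L' θ, NonErasing π.fresh π.links L' θ
    · obtain ⟨L', θ, h⟩ := h
      have hr : π.Reduces ⟨L', π.concl⟩ := ⟨⟨θ, h.cutStep⟩, rfl⟩
      obtain ⟨v, W, n, he⟩ := ih ⟨L', π.concl⟩ hr (fun π' h' => hc π' (.head hr h')) (hr.wf hπ)
      obtain ⟨v, W, n, he, -⟩ := h.expandable hπ π.name_lt_fresh he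
      exact ⟨v, W, n, he⟩
    · push Not at h
      exact Normal.exists_ex A ⟨h, hc π .refl⟩ hπ

theorem StronglyNormalizable.acc {π : Struct} (h : π.StronglyNormalizable) :
    Acc (flip Reduces) π := by
  by_contra hacc
  obtain ⟨R, hR, hstep⟩ := not_acc_iff_exists_descending_chain.1 hacc
  exact h.1 ⟨R, hR, hstep⟩

end Struct

end LLNet

theorem mainTheorem1 (A : Type*) (π : LLNet.Struct) (hπ : π.IsNet) :
    π.StronglyNormalizable ↔ (π.sexInterpretation A).Nonempty := by
  constructor
  · intro h
    obtain ⟨v, W, n, he⟩ := LLNet.Struct.exists_ex_of_acc A h.acc h.2 hπ.wf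
    obtain ⟨e, he, -⟩ := LLNet.exists_isSex_of_ex hπ.wf he
    exact ⟨_, e, he, rfl⟩
  · rintro ⟨_, e, he, -⟩
    obtain ⟨W, n, he, -⟩ := LLNet.exists_ex_of_isSex he hπ.wf
    exact LLNet.Struct.stronglyNormalizable_of_ex hπ.wf ⟨_, W, n, he⟩
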